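/- Let $n\ge 1$, use coordinates $(z,w)\in\mathbb C^n\times\mathbb C$ on $\mathbb C^{n+1}$, $w=u+iv$, and put $\langle z,\zeta\rangle=\sum_j z_j\bar\zeta_j$, $\|z\|^2=\langle z,z\rangle$. Give $z_j,\bar z_j$ weight $1$ and $u$ weight $2$. A function of $(z,u)\in\mathbb C^n\times\mathbb R$ that is smooth near $0$ has a Taylor expansion at $0$ into weighted homogeneous polynomials in $(z,\bar z,u)$; it *vanishes up to weighted order* $k$ if all its components of weight $\le k$ are zero. *Normal form.* Fix $5\le N\le\infty$. A set $D\subset\mathbb C^{n+1}$ is in Chern–Moser normal form (at $0$) if near $0$ it is $\{\operatorname{Im}w>\|z\|^2+\varphi(z,\bar z,\operatorname{Re}w)\}$ with a real function $\varphi$, smooth near $0$, whose Taylor expansion $\sum_\mu\varphi_\mu$ into weighted homogeneous components satisfies: every monomial of every $\varphi_\mu$ has degree at least $2$ in $z$ and at least $2$ in $\bar z$ (so $\varphi_\mu=0$ for $\mu<4$), and, for the part $\varphi_{j,k}$ of degree $j$ in $z$ and $k$ in $\bar z$ of $\varphi_\mu$, for all $\mu\le N$, $$\operatorname{tr}\varphi_{2,2}=0,\qquad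 \operatorname{tr}^2\varphi_{3,2}=\operatorname{tr}^2\varphi_{2,3}=0,\qquad \operatorname{tr}^3\varphi_{3,3}=0 .$$ Here, for $Q$ of bidegree $(j,k)$ in $(z,\bar z)$, $\operatorname{tr}Q=\frac1{jk}\sum_{\alpha}\partial^2Q/\partial z_\alpha\partial\bar z_\alpha$. For $N=\infty$ this is the full Chern–Moser normal form; for $N=5$ the trace conditions are just $\operatorname{tr}\varphi_4=0$ and $\operatorname{tr}^2\varphi_5=0$. *Maps.* Let $D,D'\subset\mathbb C^{n+1}$ be in Chern–Moser normal form, with functions $\varphi,\varphi'$ (they may be domains, but only their germs at $0$ matter). Let $F$ be a $\mathbb C^{n+1}$-valued map that is smooth in a neighborhood $U$ of $0$, holomorphic on $U\cap D$, with $F(U\cap D)\subset D'$, $F(0)=0$, and $$F(z,w)=(z,w)+\big(F^z_{1,1}(z,w)+F^z_{0,2}(w),\,F^w_{0,2}(w)\big)+O(3),$$ where $F^z_{1,1}(z,w)=w\,Bz$ with $B\colon\mathbb C^n\to\mathbb C^n$ linear, $F^z_{0,2}(w)=w^2a$ with $a\in\mathbb C^n$, $F^w_{0,2}(w)=c\,w^2$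 with $c\in\mathbb C$, and $O(3)$ denotes a map whose derivatives of order less than $3$ all vanish at $0$. Then the following are equivalent. 1. $F$ is $2$-flat: there are biholomorphic maps $h,g$ between neighborhoods of $0$ in $\mathbb C^{n+1}$ with $h(0)=g(0)=0$ such that $h(D)$ and $g(D')$ (understood locally) are in Chern–Moser normal form (with the same $N$) and all derivatives of order at most $2$ of $g\circ F\circ h^{-1}-\mathrm{id}$ vanish at $0$. 2. $F(\partial D)$ is tangent to $\partial D'$ at $0$ up to weighted order $4$: with $\rho'(z,w)=\operatorname{Im}w-\|z\|^2-\varphi'(z,\bar z,\operatorname{Re}w)$ and $\gamma(z,u)=\big(z,\,u+i(\|z\|^2+\varphi(z,\bar z,u))\big)$, the function $\rho'\circ F\circ\gamma$ vanishes at $0$ up to weighted order $4$. 3. $\operatorname{Im}\langle z,F^z_{1,1}(z,1)\rangle=0$ for all $z\in\mathbb C^n$. -/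

import Mathlib

open scoped ContDiff Topology

namespace BoundaryJets

/-- The space `ℂⁿ⁺¹ = ℂⁿ × ℂ` with coordinates `(z, w)`; `‖z‖² = |z₁|² + ⋯ + |zₙ|²`. -/
abbrev Space (n : ℕ) : Type := EuclideanSpace ℂ (Fin n) × ℂ

/-- The parameter space `ℂⁿ × ℝ` with coordinates `(z, u)`, `u = Re w`. -/
abbrev Param (n : ℕ) : Type := EuclideanSpace ℂ (Fin n) × ℝ

/-- The component of weight `μ` in the Taylor expansion at `0` of `f`, where `z`, `z̄` have weight `1`
and `u` has weight `2`: the coefficient of `t ^ μ` in the Taylor expansion of `f (t z, t² u)`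
with respect to the real variable `t`. -/
noncomputable def weightedPart {n : ℕ} (f : Param n → ℝ) (μ : ℕ) (x : Param n) : ℝ :=
  iteratedDeriv μ (fun t : ℝ => f (t • x.1, t ^ 2 * x.2)) 0 / (μ.factorial : ℝ)

/-- `f` vanishes at `0` up to weighted order `k`. -/
def VanishesToWeightedOrder {n : ℕ} (k : ℕ) (f : Param n → ℝ) : Prop :=
  ∀ μ ≤ k, ∀ x : Param n, weightedPart f μ x = 0

/-- The indeterminates `z₁, …, zₙ` (`inl i`), `z̄₁, …, z̄ₙ` (`inr (inl i)`) and `u` (`inr (inr ())`). -/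
abbrev Vars (n : ℕ) : Type := Fin n ⊕ Fin n ⊕ Unit

/-- The weights `1, 1, 2` of `zᵢ`, `z̄ᵢ`, `u`. -/
def weight {n : ℕ} : Vars n → ℕ :=
  Sum.elim (fun _ => 1) (Sum.elim (fun _ => 1) (fun _ => 2))

/-- The bidegrees `(1, 0)`, `(0, 1)`, `(0, 0)` of `zᵢ`, `z̄ᵢ`, `u`. -/
def bidegree {n : ℕ} : Vars n → ℕ × ℕ :=
  Sum.elim (fun _ => (1, 0)) (Sum.elim (fun _ => (0, 1)) (fun _ => (0, 0)))

/-- The value `P(z, z̄, u)`. -/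
noncomputable def evalAt {n : ℕ} (x : Param n) (P : MvPolynomial (Vars n) ℂ) : ℂ :=
  MvPolynomial.eval
    (Sum.elim (fun i => x.1 i)
      (Sum.elim (fun i => (starRingEnd ℂ) (x.1 i)) (fun _ => (x.2 : ℂ)))) P

/-- The part `P_{j,k}` of `P` which is of degree `j` in `z` and of degree `k` in `z̄`. -/
noncomputable def bidegreePart {n : ℕ} (j k : ℕ) (P : MvPolynomial (Vars n) ℂ) :
    MvPolynomial (Vars n) ℂ :=
  MvPolynomial.weightedHomogeneousComponent bidegree (j, k) P

/-- The trace (contraction of one `z`-index with one `z̄`-index) of a polynomial `Q` of bidegree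
`(j, k)` in `(z, z̄)`: if `Q = ∑ a_{α₁…αⱼβ₁…βₖ} z_{α₁}⋯z_{αⱼ} z̄_{β₁}⋯z̄_{βₖ}` with `a` symmetric in
the `α`'s and in the `β`'s, then `∑_α ∂²Q/∂z_α∂z̄_α` is `j k` times
`∑ (∑_γ a_{α₁…αⱼ₋₁γβ₁…βₖ₋₁γ}) z_{α₁}⋯z_{αⱼ₋₁} z̄_{β₁}⋯z̄_{βₖ₋₁}`. -/
noncomputable def trace {n : ℕ} (j k : ℕ) (Q : MvPolynomial (Vars n) ℂ) :
    MvPolynomial (Vars n) ℂ :=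
  MvPolynomial.C ((j : ℂ) * (k : ℂ))⁻¹ *
    ∑ α : Fin n, MvPolynomial.pderiv (Sum.inl α)
      (MvPolynomial.pderiv (Sum.inr (Sum.inl α)) Q)

/-- The Taylor expansion `∑ φ_μ` of `φ` at `0` satisfies the Chern-Moser conditions: every monomial
of `φ_μ` is divisible by some `z_{j₁} z_{j₂} z̄_{k₁} z̄_{k₂}` (so `φ_μ = 0` for `μ < 4`), and in the
weights `μ ≤ N` the trace conditions `tr φ_{2,2} = 0`, `tr² φ_{3,2} = tr² φ_{2,3} = 0`,
`tr³ φ_{3,3} = 0` hold. For `N = ⊤` this is the full Chern-Moser normal form, for `N = 5` the trace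
conditions are just `tr φ₄ = 0` and `tr² φ₅ = 0`. -/
def ChernMoserConditions {n : ℕ} (N : ℕ∞) (φ : Param n → ℝ) : Prop :=
  ∃ P : ℕ → MvPolynomial (Vars n) ℂ,
    (∀ μ, (P μ).IsWeightedHomogeneous weight μ) ∧
    (∀ μ x, (weightedPart φ μ x : ℂ) = evalAt x (P μ)) ∧
    (∀ μ, ∀ m ∈ (P μ).support,
      2 ≤ ∑ i : Fin n, m (Sum.inl i) ∧ 2 ≤ ∑ i : Fin n, m (Sum.inr (Sum.inl i))) ∧
    (∀ μ : ℕ, (μ : ℕ∞) ≤ N →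
      trace 2 2 (bidegreePart 2 2 (P μ)) = 0 ∧
      trace 2 1 (trace 3 2 (bidegreePart 3 2 (P μ))) = 0 ∧
      trace 1 2 (trace 2 3 (bidegreePart 2 3 (P μ))) = 0 ∧
      trace 1 1 (trace 2 2 (trace 3 3 (bidegreePart 3 3 (P μ)))) = 0)

/-- Near `0`, the set `D` is `{Im w > ‖z‖² + φ(z, z̄, Re w)}` with `φ` smooth near `0` and subject to
the Chern-Moser conditions. -/
def HasNormalForm {n : ℕ} (N : ℕ∞) (D : Set (Space n)) (φ : Param n → ℝ) : Prop :=
  (∃ V : Set (Param n), IsOpen V ∧ (0 : Param n) ∈ V ∧ ContDiffOn ℝ ∞ φ V) ∧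
  (∀ᶠ Z in 𝓝 (0 : Space n), Z ∈ D ↔ ‖Z.1‖ ^ 2 + φ (Z.1, Z.2.re) < Z.2.im) ∧
  ChernMoserConditions N φ

/-- `D` is in Chern-Moser normal form at `0`. -/
def InNormalForm {n : ℕ} (N : ℕ∞) (D : Set (Space n)) : Prop :=
  ∃ φ : Param n → ℝ, HasNormalForm N D φ

/-- `F` represents a germ in `𝓙_{p,p'}(D, D')`: it is smooth in a neighborhood `U` of `p`,
holomorphic in `U ∩ D`, maps `U ∩ D` into `D'`, and sends `p` to `p'`. -/
def IsBoundaryGerm {n : ℕ} (D D' : Set (Space n)) (p p' : Space n) (F : Space n → Space n) :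
    Prop :=
  F p = p' ∧ ∃ U : Set (Space n), IsOpen U ∧ p ∈ U ∧ ContDiffOn ℝ ∞ F U ∧
    DifferentiableOn ℂ F (U ∩ D) ∧ Set.MapsTo F (U ∩ D) D'

/-- `H` and all its (real) derivatives of order less than `m` vanish at `0`: `H = O(m)`. -/
def IsBigO {n : ℕ} (m : ℕ) (H : Space n → Space n) : Prop :=
  ∀ j < m, iteratedFDeriv ℝ j H 0 = 0

/-- `h` is a system of local holomorphic coordinates vanishing at `p`. -/
def IsLocalCoordinates {n : ℕ} (h : OpenPartialHomeomorph (Space n) (Space n)) (p : Space n) :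
    Prop :=
  p ∈ h.source ∧ h p = 0 ∧ DifferentiableOn ℂ h h.source ∧ DifferentiableOn ℂ h.symm h.target

/-- The germ `F` is `k`-flat: in suitable local holomorphic coordinates `h` at `p` and `g` at `p'`, in
which `D` and `D'` are in Chern-Moser normal form, it is `id + o(k)`. -/
def IsFlat {n : ℕ} (N : ℕ∞) (k : ℕ) (D D' : Set (Space n)) (p p' : Space n)
    (F : Space n → Space n) : Prop :=
  ∃ h g : OpenPartialHomeomorph (Space n) (Space n),
    IsLocalCoordinates h p ∧ IsLocalCoordinates g p' ∧
    InNormalForm N (h '' (h.source ∩ D)) ∧ InNormalForm N (g '' (g.source ∩ D')) ∧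
    IsBigO (k + 1) (fun Z => g (F (h.symm Z)) - Z)

/-- The parametrization `(z, u) ↦ (z, u + i (‖z‖² + φ(z, z̄, u)))` of the boundary of
`{Im w > ‖z‖² + φ(z, z̄, Re w)}`. -/
noncomputable def boundaryPoint {n : ℕ} (φ : Param n → ℝ) (x : Param n) : Space n :=
  (x.1, (x.2 : ℂ) + Complex.I * ((‖x.1‖ ^ 2 + φ x : ℝ) : ℂ))

/-- The defining function `Im w - ‖z‖² - φ(z, z̄, Re w)`. -/
noncomputable def definingFunction {n : ℕ} (φ : Param n → ℝ) (Z : Space n) : ℝ :=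
  Z.2.im - ‖Z.1‖ ^ 2 - φ (Z.1, Z.2.re)

/-- The image under `F` of the hypersurface `Im w = ‖z‖² + φ` is tangent at `0` to the hypersurface
`Im w = ‖z‖² + φ'` up to weighted order `k`. -/
def ImageTangentToOrder {n : ℕ} (k : ℕ) (φ φ' : Param n → ℝ) (F : Space n → Space n) : Prop :=
  VanishesToWeightedOrder k (fun x => definingFunction φ' (F (boundaryPoint φ x)))

end BoundaryJets

/-! Put `s = ‖z‖²`, `w₀ = u + i s`, `b = inner ℂ z (B z)`, and consider `f = ρ' ∘ F ∘ γ`. Since `F`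
maps `D` into `D'`, its boundary values lie in the closure of `D'`, so `f ≥ 0` near `0`. Hence,
along each weighted dilation, the first nonzero weighted component of `f` is nonnegative. Although
`F` is holomorphic only on one side, its derivatives at `0` are limits of derivatives at points of
holomorphy and are therefore complex multilinear. This makes the expansion of `f (t η z, t² u)` with
`|η| = 1` explicit up to `t⁵` (`germ_expansion`). Its coefficients are trigonometric polynomials in
`η` and polynomials in `u`.

In weight four the `η`-dependent terms have frequencies `2` and `4`. Averaging over four rotations
removes them and leaves `ψ - s² Im c + 2 s Im b + 2 (s Re c - Re b) u + (Im c) u²`, where `ψ` is the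
value of the trace-free polynomial `P₄ - P₄'`.

(2 ⇒ 3) If this vanishes for all `u`, then `Im c = 0` and `ψ = -2 s Im b`. Thus `‖z‖²` times a
Hermitian form is trace-free, which forces the Hermitian form to vanish.

(3 ⇒ 1) Let `Im b = 0`. The weight three part is odd in `z` and nonnegative, so it is zero; then the
weight four part is nonnegative, and so is its mean. At `z = 0` this gives `Im c ≥ 0`, and at `u =
0` it gives `ψ ≥ s² Im c ≥ 0`. A nonnegative trace-free polynomial of bidegree `(2, 2)` is zero, so
`ψ = 0` and `Im c = 0`. A nonnegative affine function of `u` is constant, so `b = c s` and `B = c ·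
id` with `c` real. The weight four part is nonnegative with mean zero, hence zero. Now the weight
five part is nonnegative and odd in `z`, hence zero. Its frequency-one coefficient, compared in
powers of `u`, shows that the difference of the `(3, 2)` parts is `-4 ‖z‖⁴` times the linear form
conjugate to `inner ℂ z a`; the double trace gives `a = 0`. So `F = (1 + c w)(z, w) + O(3)`, and
composing with the automorphism `(z, w) / (1 + c w)` of the model quadric yields the identity to
second order. It remains to see that this automorphism preserves the Chern–Moser conditions: in the
bidegrees that matter it acts on `φ` by rescalings depending on `u` alone, and these commute with
traces up to factors in `u`.

(1 ⇒ 2) In flat coordinates `B`, `a`, `c` are all zero, so the argument above gives tangency up to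
weight four there. Biholomorphisms between normal forms respect the weighted gauge, and the defining
functions are comparable, so tangency carries over to the original coordinates. -/

namespace BoundaryJets

open Asymptotics Filter

/-! ### Taylor estimates and uniqueness of expansions. -/

section Taylor

variable {E F : Type*} [NormedAddCommGroup E] [NormedSpace ℝ E] [NormedAddCommGroup F]
  [NormedSpace ℝ F]

theorem taylor_isBigO [CompleteSpace F] {f : E → F} (n : ℕ) (hf : ContDiffAt ℝ (n + 1) f 0) :
    (fun x => f x - ∑ j ∈ Finset.range (n + 1),
      (j.factorial : ℝ)⁻¹ • iteratedFDeriv ℝ j f 0 (fun _ => x)) =O[𝓝 0]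
      fun x => ‖x‖ ^ (n + 1) := by
  have hev : ∀ᶠ x in 𝓝 (0 : E), ContDiffAt ℝ (n + 1) f x := by
    have := hf.eventually (by exact_mod_cast (by simp : ((n + 1 : ℕ) : ℕ∞ω) ≠ ∞))
    exact this
  have hcont : ContinuousAt (iteratedFDeriv ℝ (n + 1) f) 0 :=
    hf.continuousAt_iteratedFDeriv (by norm_cast)
  have hbd : ∀ᶠ x in 𝓝 (0 : E), ‖iteratedFDeriv ℝ (n + 1) f x‖ <
      ‖iteratedFDeriv ℝ (n + 1) f 0‖ + 1 :=
    hcont.norm.eventually_lt_const (by linarith)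
  obtain ⟨r, hr, hball⟩ := Metric.eventually_nhds_iff_ball.1 (hev.and hbd)
  set M := ‖iteratedFDeriv ℝ (n + 1) f 0‖ + 1 with hM
  refine IsBigO.of_bound ((n.factorial : ℝ)⁻¹ * M) ?_
  filter_upwards [Metric.ball_mem_nhds (0 : E) hr] with x hx
  have hseg : ∀ t ∈ Set.Icc (0 : ℝ) 1, (0 : E) + t • x ∈ Metric.ball (0 : E) r := by
    intro t ht
    rw [zero_add, mem_ball_zero_iff, norm_smul, Real.norm_eq_abs, abs_of_nonneg ht.1]
    calc t * ‖x‖ ≤ 1 * ‖x‖ := by gcongr; exact ht.2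
      _ < r := by simpa using hx
  have h := map_add_eq_sum_add_integral_iteratedFDeriv (f := f) (x := 0) (y := x) (n := n)
    fun t ht => (hball _ (hseg t ht)).1
  rw [zero_add] at h
  rw [h, add_sub_cancel_left, norm_smul, norm_inv, Real.norm_natCast, mul_assoc]
  gcongr
  have : ‖∫ t in (0 : ℝ)..1, (1 - t) ^ n •
      iteratedFDeriv ℝ (n + 1) f (0 + t • x) (fun _ => x)‖ ≤ (M * ‖x‖ ^ (n + 1)) * |(1 : ℝ) - 0| := by
    refine intervalIntegral.norm_integral_le_of_norm_le_const fun t ht => ?_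
    rw [Set.uIoc_of_le zero_le_one] at ht
    have ht' : t ∈ Set.Icc (0 : ℝ) 1 := ⟨ht.1.le, ht.2⟩
    rw [norm_smul]
    have h1 : ‖(1 - t) ^ n‖ ≤ 1 := by
      rw [norm_pow, Real.norm_eq_abs, abs_of_nonneg (by linarith [ht.2])]
      exact pow_le_one₀ (by linarith [ht.2]) (by linarith [ht.1])
    have h2 : ‖iteratedFDeriv ℝ (n + 1) f (0 + t • x) (fun _ => x)‖ ≤ M * ‖x‖ ^ (n + 1) := by
      refine (ContinuousMultilinearMap.le_opNorm _ _).trans ?_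
      rw [Finset.prod_const, Finset.card_univ, Fintype.card_fin]
      gcongr
      exact (hball _ (hseg t ht')).2.le
    calc _ ≤ 1 * (M * ‖x‖ ^ (n + 1)) := by gcongr
      _ = _ := one_mul _
  simpa using this

/-- A polynomial of degree `< K` which is `O(t ^ K)` at `0⁺` vanishes. -/
theorem coeff_eq_zero_of_isBigO {d : ℕ → F} (K : ℕ)
    (h : (fun t : ℝ => ∑ j ∈ Finset.range K, t ^ j • d j) =O[𝓝[>] 0] fun t => t ^ K) :
    ∀ j < K, d j = 0 := by
  induction K with
  | zero => intro j hj; omega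
  | succ K ih =>
    have hpow : (fun t : ℝ => t ^ (K + 1)) =O[𝓝[>] 0] fun t => t ^ K :=
      IsBigO.of_bound 1 (by
        filter_upwards [self_mem_nhdsWithin, nhdsWithin_le_nhds (Iio_mem_nhds zero_lt_one)]
          with t h1 h2
        rw [one_mul, norm_pow, norm_pow, Real.norm_eq_abs, abs_of_pos (show (0 : ℝ) < t from h1)]
        exact pow_le_pow_of_le_one (show (0 : ℝ) < t from h1).le (show t < 1 from h2).le
          (Nat.le_succ K))
    have hlast : (fun t : ℝ => t ^ K • d K) =O[𝓝[>] 0] fun t => t ^ K := by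
      refine IsBigO.of_bound ‖d K‖ (Eventually.of_forall fun t => ?_)
      rw [norm_smul, mul_comm]
    have hlow := ih (by
      have := (h.trans hpow).sub hlast
      simpa [Finset.sum_range_succ] using this)
    intro j hj
    rcases Nat.lt_succ_iff_lt_or_eq.1 hj with hj | rfl
    · exact hlow j hj
    -- Once the lower coefficients are gone, dividing by `t ^ j` bounds `‖d j‖` by `C t`, which
    -- tends to zero.
    · have h1 : (fun t : ℝ => t ^ j • d j) =O[𝓝[>] 0] fun t => t ^ (j + 1) := by
        refine h.congr_left fun t => ?_
        rw [Finset.sum_range_succ, Finset.sum_eq_zero, zero_add]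
        intro i hi
        rw [hlow i (Finset.mem_range.1 hi), smul_zero]
      obtain ⟨C, hC⟩ := h1.bound
      have h2 : ∀ᶠ t : ℝ in 𝓝[>] 0, ‖d j‖ ≤ C * t := by
        filter_upwards [hC, self_mem_nhdsWithin] with t ht htp
        have htp : 0 < t := htp
        rw [norm_smul, norm_pow, norm_pow, Real.norm_eq_abs, abs_of_pos htp, pow_succ] at ht
        have := pow_pos htp j
        nlinarith
      have h3 : Tendsto (fun t : ℝ => C * t) (𝓝[>] 0) (𝓝 0) := by
        have : Tendsto (fun t : ℝ => C * t) (𝓝 0) (𝓝 (C * 0)) :=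
          (continuous_const.mul continuous_id).tendsto 0
        rw [mul_zero] at this
        exact this.mono_left nhdsWithin_le_nhds
      exact norm_le_zero_iff.1 (ge_of_tendsto h3 h2)

/-- Subtracting the Taylor polynomial leaves a polynomial of degree at most `k` that is `O(t ^ (k +
1))`. A one-sided estimate is enough because smoothness of `q` is assumed separately. -/
theorem iteratedDeriv_eq_of_isBigO [CompleteSpace F] {q : ℝ → F} (k : ℕ)
    (hq : ContDiffAt ℝ ∞ q 0) {d : ℕ → F}
    (h : (fun t : ℝ => q t - ∑ j ∈ Finset.range (k + 1), t ^ j • d j) =O[𝓝[>] 0]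
      fun t => t ^ (k + 1)) (j : ℕ) (hj : j ≤ k) :
    iteratedDeriv j q 0 = (j.factorial : ℝ) • d j := by
  have h1 := (taylor_isBigO k (hq.of_le (by exact_mod_cast le_top))).mono
    (nhdsWithin_le_nhds (s := Set.Ioi 0))
  have h2 : (fun t : ℝ => ∑ j ∈ Finset.range (k + 1),
      t ^ j • (d j - (j.factorial : ℝ)⁻¹ • iteratedDeriv j q 0)) =O[𝓝[>] 0]
      fun t => t ^ (k + 1) := by
    have h3 : (fun t : ℝ => ‖t‖ ^ (k + 1)) =O[𝓝[>] 0] fun t => t ^ (k + 1) :=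
      IsBigO.of_bound 1 (Eventually.of_forall fun t => by simp)
    refine ((h1.trans h3).sub h).congr_left fun t => ?_
    simp_rw [smul_sub, Finset.sum_sub_distrib]
    rw [sub_sub_sub_cancel_left]
    congr 1
    refine Finset.sum_congr rfl fun j _ => ?_
    rw [iteratedDeriv_eq_iteratedFDeriv, smul_comm]
    congr 1
    have := (iteratedFDeriv ℝ j q 0).map_smul_univ (fun _ => t) (fun _ => (1 : ℝ))
    simpa using this
  have h4 := coeff_eq_zero_of_isBigO (k + 1) h2 j (by omega)
  rw [sub_eq_zero.1 h4, smul_smul, mul_inv_cancel₀ (by positivity), one_smul]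

/-- A smooth map which is `O(‖x‖³)` has vanishing derivatives of order at most two. -/
theorem iteratedFDeriv_eq_zero_of_isBigO [CompleteSpace F] {H : E → F} (hH : ContDiffAt ℝ ∞ H 0)
    (h : H =O[𝓝 0] fun x => ‖x‖ ^ 3) : ∀ j < 3, iteratedFDeriv ℝ j H 0 = 0 := by
  have hdiag : ∀ j < 3, ∀ v : E, iteratedFDeriv ℝ j H 0 (fun _ => v) = 0 := by
    intro j hj v
    have h1 := taylor_isBigO 2 (by exact_mod_cast contDiffAt_infty.1 hH 3)
    have h2 := h1.sub h
    have h3 : Tendsto (fun t : ℝ => t • v) (𝓝[>] 0) (𝓝 0) := by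
      have : Tendsto (fun t : ℝ => t • v) (𝓝 0) (𝓝 ((0 : ℝ) • v)) :=
        (continuous_id.smul continuous_const).tendsto 0
      rw [zero_smul] at this
      exact this.mono_left nhdsWithin_le_nhds
    have h4 := h2.comp_tendsto h3
    have h5 : (fun t : ℝ => ∑ j ∈ Finset.range 3,
        t ^ j • (-((j.factorial : ℝ)⁻¹ • iteratedFDeriv ℝ j H 0 (fun _ => v)))) =O[𝓝[>] 0]
        fun t => t ^ 3 := by
      refine (h4.congr_left fun t => ?_).trans (IsBigO.of_bound (‖v‖ ^ 3)
        (Eventually.of_forall fun t => ?_))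
      · simp only [Function.comp, smul_neg, Finset.sum_neg_distrib]
        rw [sub_sub_cancel_left]
        congr 1
        refine Finset.sum_congr rfl fun j _ => ?_
        have := (iteratedFDeriv ℝ j H 0).map_smul_univ (fun _ => t) (fun _ => v)
        rw [this, smul_comm]
        simp
      · simp [norm_smul, mul_pow, mul_comm]
    have h6 := coeff_eq_zero_of_isBigO 3 h5 j hj
    rw [neg_eq_zero, smul_eq_zero] at h6
    exact h6.resolve_left (by positivity)
  intro j hj
  interval_cases j
  · ext m
    rw [Subsingleton.elim m (fun _ => 0)]
    simpa using hdiag 0 hj 0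
  · ext m
    have : m = fun _ => m 0 := by ext i; rw [Subsingleton.elim i 0]
    rw [this]
    simpa using hdiag 1 hj (m 0)
  -- Orders zero and one have only diagonal arguments. In order two, vanishing on the diagonal is
  -- polarized by means of the symmetry of the second derivative.
  · have hsymm : IsSymmSndFDerivAt ℝ H 0 :=
      ContDiffAt.isSymmSndFDerivAt (n := 2) (by exact_mod_cast contDiffAt_infty.1 hH 2) (by simp)
    have hd : ∀ v, fderiv ℝ (fderiv ℝ H) 0 v v = 0 := by
      intro v
      have := hdiag 2 hj v
      rwa [iteratedFDeriv_two_apply] at this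
    ext m
    rw [iteratedFDeriv_two_apply]
    have h1 := hd (m 0 + m 1)
    have h2 := hsymm (m 0) (m 1)
    simp only [map_add, _root_.add_apply, hd, zero_add, add_zero] at h1
    rw [← h2, ← two_smul ℝ, smul_eq_zero] at h1
    simpa using h1.resolve_left two_ne_zero

theorem isBigO_of_iteratedFDeriv_eq_zero [CompleteSpace F] {H : E → F} (m : ℕ)
    (hH : ContDiffAt ℝ ∞ H 0) (h : ∀ j < m + 1, iteratedFDeriv ℝ j H 0 = 0) :
    H =O[𝓝 0] fun x => ‖x‖ ^ (m + 1) := by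
  refine (taylor_isBigO m (hH.of_le (by exact_mod_cast le_top))).congr_left fun x => ?_
  rw [Finset.sum_eq_zero, sub_zero]
  intro j hj
  rw [h j (Finset.mem_range.1 hj)]
  simp

end Taylor

end BoundaryJets

/-! ### Smoothness of holomorphic maps and their derivatives at boundary points. -/

namespace BoundaryJets

open Asymptotics Filter

section SeveralComplexVariables

variable {E F : Type*} [NormedAddCommGroup E] [NormedSpace ℂ E] [FiniteDimensional ℂ E]
  [NormedAddCommGroup F] [NormedSpace ℂ F] [FiniteDimensional ℂ F]

/-- Cauchy's formula on the disc `Z + ζ v`, `|ζ| ≤ r`, expresses the directional derivative as an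
integral of values of `f`. This integral can be differentiated in `Z` under the integral sign,
because Cauchy's estimate bounds the first derivative of `f` uniformly. -/
theorem differentiableOn_fderiv_apply {f : E → F} {U : Set E} (hU : IsOpen U)
    (hf : DifferentiableOn ℂ f U) (v : E) :
    DifferentiableOn ℂ (fun Z => fderiv ℂ f Z v) U := by
  have : CompleteSpace F := FiniteDimensional.complete ℂ F
  have : ProperSpace (E →L[ℂ] F) := FiniteDimensional.proper ℂ _
  have : ProperSpace F := FiniteDimensional.proper ℂ _
  borelize E
  borelize (E →L[ℂ] F)
  intro Z₀ hZ₀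
  -- Nested radii: `Z` varies in the ball of radius `R`, its translates along the circle stay within
  -- `3 R`, and Cauchy's estimate about those points uses balls of radius `R` inside `4 R`. Since
  -- `f` varies by less than `2` on each such ball, the derivative bound is `2 / R`.
  obtain ⟨R, hR, hRU⟩ : ∃ R > 0, ∀ Z ∈ Metric.ball Z₀ (4 * R), Z ∈ U ∧ dist (f Z) (f Z₀) < 1 := by
    have h1 := (hU.mem_nhds hZ₀)
    have h2 := (hf.differentiableAt h1).continuousAt.eventually (Metric.ball_mem_nhds (f Z₀) one_pos)
    obtain ⟨R, hR, h⟩ := Metric.eventually_nhds_iff_ball.1 (Filter.Eventually.and h1 h2)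
    exact ⟨R / 4, by positivity, fun Z hZ => h Z (by rwa [mul_div_cancel₀ _ four_ne_zero] at hZ)⟩
  have hbound : ∀ Z ∈ Metric.ball Z₀ (3 * R), ‖fderiv ℂ f Z‖ ≤ 2 / R := by
    intro Z hZ
    have hsub : ∀ Y ∈ Metric.ball Z R, Y ∈ Metric.ball Z₀ (4 * R) := by
      intro Y hY
      rw [Metric.mem_ball] at *
      linarith [dist_triangle Y Z Z₀]
    refine Complex.norm_fderiv_le_div_of_mapsTo_ball
      (fun Y hY => ((hf.differentiableAt (hU.mem_nhds (hRU Y (hsub Y hY)).1))).differentiableWithinAt)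
      (fun Y hY => ?_) hR
    have h1 := (hRU Y (hsub Y hY)).2
    have h2 := (hRU Z (hsub Z (Metric.mem_ball_self hR))).2
    rw [Metric.mem_closedBall]
    linarith [dist_triangle_right (f Y) (f Z) (f Z₀)]
  set r : ℝ := R / (‖v‖ + 1) with hr_def
  have hr : 0 < r := by positivity
  have hrv : r * ‖v‖ ≤ R := by
    rw [hr_def, div_mul_eq_mul_div, div_le_iff₀ (by positivity)]
    nlinarith [norm_nonneg v]
  have hshift : ∀ Z ∈ Metric.ball Z₀ R, ∀ ζ : ℂ, ‖ζ‖ ≤ r →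
      Z + ζ • v ∈ Metric.ball Z₀ (3 * R) := by
    intro Z hZ ζ hζ
    rw [Metric.mem_ball, dist_eq_norm] at *
    calc ‖Z + ζ • v - Z₀‖ = ‖(Z - Z₀) + ζ • v‖ := by congr 1; abel
      _ ≤ ‖Z - Z₀‖ + ‖ζ‖ * ‖v‖ := by rw [← norm_smul]; exact norm_add_le _ _
      _ ≤ ‖Z - Z₀‖ + r * ‖v‖ := by gcongr
      _ < 3 * R := by linarith
  have hsubU : ∀ Z ∈ Metric.ball Z₀ (3 * R), DifferentiableAt ℂ f Z := by
    intro Z hZ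
    exact hf.differentiableAt (hU.mem_nhds (hRU Z (Metric.ball_subset_ball (by linarith) hZ)).1)
  set k : ℝ → ℂ := fun θ => deriv (circleMap 0 r) θ * ((circleMap 0 r θ - 0) ^ 2)⁻¹ with hk
  have hkc : Continuous k := by
    have hne : ∀ θ, (circleMap 0 r θ - 0) ^ 2 ≠ 0 := fun θ => by
      simp [hr.ne']
    have : Continuous fun θ => ((circleMap 0 r θ - 0) ^ 2)⁻¹ :=
      Continuous.inv₀ (by fun_prop) hne
    simp only [hk, deriv_circleMap]
    fun_prop
  have hcirc : ∀ θ, ‖circleMap 0 r θ‖ ≤ r := fun θ => by simp [abs_of_pos hr]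
  have hline : Continuous fun θ : ℝ => circleMap 0 r θ • v := by fun_prop
  have hcauchy : ∀ Z ∈ Metric.ball Z₀ R, fderiv ℂ f Z v =
      (2 * Real.pi * Complex.I : ℂ)⁻¹ •
        ∫ θ in (0 : ℝ)..2 * Real.pi, k θ • f (Z + circleMap 0 r θ • v) := by
    intro Z hZ
    set g : ℂ → F := fun ζ => f (Z + ζ • v) with hg
    have hV : IsOpen {ζ : ℂ | Z + ζ • v ∈ Metric.ball Z₀ (3 * R)} :=
      Metric.isOpen_ball.preimage (by fun_prop)
    have hgd : DifferentiableOn ℂ g {ζ : ℂ | Z + ζ • v ∈ Metric.ball Z₀ (3 * R)} := by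
      intro ζ hζ
      have h1 : DifferentiableAt ℂ (fun ζ : ℂ => Z + ζ • v) ζ := by fun_prop
      exact ((hsubU _ hζ).comp ζ h1).differentiableWithinAt
    have h2 := Complex.cderiv_eq_deriv (z := 0) hV hgd hr (fun ζ hζ => hshift Z hZ ζ (by simpa using hζ))
    have h3 : deriv g 0 = fderiv ℂ f Z v := by
      have := DifferentiableAt.deriv_comp_add_smul (𝕜 := ℂ) (f := f) (x := Z) (y := v) (t := 0)
        (hsubU _ (hshift Z hZ 0 (by simpa using hr.le)))
      simpa using this
    rw [← h3, ← h2, Complex.cderiv, circleIntegral]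
    simp only [hk, hg, smul_smul]
  have hev : (fun Z => fderiv ℂ f Z v) =ᶠ[𝓝 Z₀] fun Z => (2 * Real.pi * Complex.I : ℂ)⁻¹ •
        ∫ θ in (0 : ℝ)..2 * Real.pi, k θ • f (Z + circleMap 0 r θ • v) := by
    filter_upwards [Metric.ball_mem_nhds Z₀ hR] with Z hZ using hcauchy Z hZ
  refine DifferentiableAt.differentiableWithinAt ?_
  refine (DifferentiableAt.const_smul ?_ _).congr_of_eventuallyEq hev
  have hcont : ∀ Z ∈ Metric.ball Z₀ R, Continuous fun θ => k θ • f (Z + circleMap 0 r θ • v) := by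
    intro Z hZ
    refine hkc.smul (continuous_iff_continuousAt.2 fun θ => ?_)
    have h1 : ContinuousAt (fun θ : ℝ => Z + circleMap 0 r θ • v) θ := by fun_prop
    exact ContinuousAt.comp (f := fun θ : ℝ => Z + circleMap 0 r θ • v)
      (hsubU _ (hshift Z hZ _ (hcirc θ))).continuousAt h1
  have hder := fun Z (hZ : Z ∈ Metric.ball Z₀ R) θ =>
    ((hsubU _ (hshift Z hZ _ (hcirc θ))).hasFDerivAt.comp Z
      ((hasFDerivAt_id Z).add_const (circleMap 0 r θ • v))).const_smul (k θ)
  simp_rw [intervalIntegral.integral_of_le Real.two_pi_pos.le]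
  refine (hasFDerivAt_integral_of_dominated_of_fderiv_le (𝕜 := ℂ)
    (F := fun Z θ => k θ • f (Z + circleMap 0 r θ • v))
    (F' := fun Z θ => k θ • (fderiv ℂ f (Z + circleMap 0 r θ • v)).comp (.id ℂ E))
    (bound := fun θ => ‖k θ‖ * (2 / R))
    (Metric.ball_mem_nhds Z₀ hR) ?_ ?_ ?_ ?_ ?_ ?_).differentiableAt
  · filter_upwards [Metric.ball_mem_nhds Z₀ hR] with Z hZ
    exact (hcont Z hZ).aestronglyMeasurable
  · exact ((hcont Z₀ (Metric.mem_ball_self hR)).intervalIntegrable _ _).1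
  · refine (hkc.measurable.smul ?_).aestronglyMeasurable
    simp only [ContinuousLinearMap.comp_id]
    exact (measurable_fderiv ℂ f).comp (by fun_prop)
  · refine Eventually.of_forall fun θ Z hZ => ?_
    rw [norm_smul, ContinuousLinearMap.comp_id]
    gcongr
    exact hbound _ (hshift Z hZ _ (hcirc θ))
  · exact ((hkc.norm.mul continuous_const).intervalIntegrable _ _).1
  · exact Eventually.of_forall fun θ Z hZ => hder Z hZ θ

/-- Osgood's lemma: complex differentiable maps on open subsets of `ℂⁿ` are smooth. -/
theorem contDiffOn_of_differentiableOn {U : Set E} (hU : IsOpen U) {f : E → F}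
    (hf : DifferentiableOn ℂ f U) : ContDiffOn ℂ ∞ f U := by
  rw [contDiffOn_infty]
  intro m
  induction m generalizing f with
  | zero => exact contDiffOn_zero.2 hf.continuousOn
  | succ m ih =>
    have := (contDiffOn_succ_iff_fderiv_of_isOpen (n := (m : ℕ∞ω)) (f := f) (𝕜 := ℂ) hU).2
      ⟨hf, fun h => absurd h (by simp), contDiffOn_clm_apply.2 fun v =>
        ih (differentiableOn_fderiv_apply hU hf v)⟩
    exact_mod_cast this

/-- If a smooth map is holomorphic on an open set accumulating at `p`, its derivatives at `p` are
complex multilinear. -/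
theorem iteratedFDeriv_map_update_smul [NormedSpace ℝ E] [IsScalarTower ℝ ℂ E] [NormedSpace ℝ F]
    [IsScalarTower ℝ ℂ F] {f : E → F} {O : Set E} {p : E} (hO : IsOpen O) (hp : p ∈ closure O)
    (hf : DifferentiableOn ℂ f O) (hfp : ContDiffAt ℝ ∞ f p) (j : ℕ) (m : Fin j → E) (i : Fin j)
    (c : ℂ) (x : E) :
    iteratedFDeriv ℝ j f p (Function.update m i (c • x)) =
      c • iteratedFDeriv ℝ j f p (Function.update m i x) := by
  have hcont : ContinuousAt (iteratedFDeriv ℝ j f) p :=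
    (contDiffAt_infty.1 hfp j).continuousAt_iteratedFDeriv le_rfl
  have hne : (𝓝[O] p).NeBot := mem_closure_iff_nhdsWithin_neBot.1 hp
  have hlim : ∀ v : Fin j → E, Tendsto (fun Z => iteratedFDeriv ℝ j f Z v) (𝓝[O] p)
      (𝓝 (iteratedFDeriv ℝ j f p v)) := fun v =>
    (((ContinuousMultilinearMap.apply ℝ (fun _ : Fin j => E) F v).continuous.tendsto _).comp
      (hcont.tendsto)).mono_left nhdsWithin_le_nhds
  -- On `O` the real derivatives are restrictions of complex ones, hence complex homogeneous in each
  -- slot. Continuity of the real derivative carries this over to the limit point `p`.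
  refine tendsto_nhds_unique (hlim _) (((hlim _).const_smul c).congr' ?_)
  filter_upwards [self_mem_nhdsWithin] with Z hZ
  have h1 : ContDiffAt ℂ j f Z :=
    contDiffAt_infty.1 ((contDiffOn_of_differentiableOn hO hf).contDiffAt (hO.mem_nhds hZ)) j
  have h2 := h1.restrictScalars_iteratedFDeriv (𝕜 := ℝ)
  rw [← h2]
  simp

end SeveralComplexVariables

end BoundaryJets

/-! ### The filtration of polynomials by weighted order. -/

namespace BoundaryJets

open Asymptotics Filter MvPolynomial

section Filtration

variable {σ τ R : Type*} [CommRing R]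

/-- The ideal of polynomials all of whose monomials have weight at least `k`. -/
def orderIdeal (ν : σ → ℕ) (k : ℕ) : Ideal (MvPolynomial σ R) where
  carrier := {p | ∀ m, coeff m p ≠ 0 → k ≤ Finsupp.weight ν m}
  zero_mem' := by simp
  add_mem' := by
    intro p q hp hq m hm
    rw [coeff_add] at hm
    by_cases h : coeff m p = 0
    · exact hq m (by simpa [h] using hm)
    · exact hp m h
  smul_mem' := by
    classical
    intro c p hp m hm
    rw [smul_eq_mul, coeff_mul] at hm
    obtain ⟨x, hx, hne⟩ := Finset.exists_ne_zero_of_sum_ne_zero hm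
    rw [← Finset.HasAntidiagonal.mem_antidiagonal.1 hx, map_add]
    exact (hp _ (right_ne_zero_of_mul hne)).trans (Nat.le_add_left _ _)

theorem mem_orderIdeal {ν : σ → ℕ} {k : ℕ} {p : MvPolynomial σ R} :
    p ∈ orderIdeal ν k ↔ ∀ m, coeff m p ≠ 0 → k ≤ Finsupp.weight ν m := Iff.rfl

theorem orderIdeal_zero (ν : σ → ℕ) (p : MvPolynomial σ R) : p ∈ orderIdeal ν 0 :=
  fun _ _ => Nat.zero_le _

theorem orderIdeal_mono {ν : σ → ℕ} {k l : ℕ} (h : l ≤ k) :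
    (orderIdeal ν k : Ideal (MvPolynomial σ R)) ≤ orderIdeal ν l :=
  fun _ hp m hm => h.trans (hp m hm)

theorem mul_mem_orderIdeal {ν : σ → ℕ} {k l : ℕ} {p q : MvPolynomial σ R}
    (hp : p ∈ orderIdeal ν k) (hq : q ∈ orderIdeal ν l) : p * q ∈ orderIdeal ν (k + l) := by
  classical
  intro m hm
  rw [coeff_mul] at hm
  obtain ⟨x, hx, hne⟩ := Finset.exists_ne_zero_of_sum_ne_zero hm
  rw [← Finset.HasAntidiagonal.mem_antidiagonal.1 hx, map_add]
  exact Nat.add_le_add (hp _ (left_ne_zero_of_mul hne)) (hq _ (right_ne_zero_of_mul hne))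

theorem pow_mem_orderIdeal {ν : σ → ℕ} {k : ℕ} {p : MvPolynomial σ R}
    (hp : p ∈ orderIdeal ν k) (j : ℕ) : p ^ j ∈ orderIdeal ν (j * k) := by
  induction j with
  | zero => rw [Nat.zero_mul]; exact orderIdeal_zero _ _
  | succ j ih =>
    rw [pow_succ, Nat.succ_mul]
    exact mul_mem_orderIdeal ih hp

theorem monomial_mem_orderIdeal (ν : σ → ℕ) (m : σ →₀ ℕ) (c : R) :
    monomial m c ∈ orderIdeal ν (Finsupp.weight ν m) := by
  classical
  intro m' hm'
  rw [coeff_monomial] at hm'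
  by_cases h : m = m'
  · rw [h]
  · simp [h] at hm'

theorem X_mem_orderIdeal (ν : σ → ℕ) (i : σ) : (X i : MvPolynomial σ R) ∈ orderIdeal ν (ν i) := by
  have := monomial_mem_orderIdeal ν (Finsupp.single i 1) (1 : R)
  rwa [Finsupp.weight_single, smul_eq_mul, one_mul] at this

theorem aeval_mem_orderIdeal {ν : σ → ℕ} {ν' : τ → ℕ} {q : σ → MvPolynomial τ R}
    (hq : ∀ i, q i ∈ orderIdeal ν' (ν i)) {k : ℕ} {p : MvPolynomial σ R}
    (hp : p ∈ orderIdeal ν k) : aeval q p ∈ orderIdeal ν' k := by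
  rw [p.as_sum, map_sum]
  refine Ideal.sum_mem _ fun m hm => ?_
  refine orderIdeal_mono (hp m (mem_support_iff.1 hm)) ?_
  rw [aeval_monomial]
  refine Ideal.mul_mem_left _ _ ?_
  have : ∀ s : Finset σ, ∏ i ∈ s, q i ^ m i ∈ orderIdeal ν' (∑ i ∈ s, m i * ν i) := by
    classical
    intro s
    induction s using Finset.induction_on with
    | empty => exact orderIdeal_zero _ _
    | insert i s hi ih =>
      rw [Finset.prod_insert hi, Finset.sum_insert hi]
      exact mul_mem_orderIdeal (pow_mem_orderIdeal (hq i) _) ih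
  simpa [Finsupp.weight_apply, Finsupp.sum, Finsupp.prod] using this m.support

theorem sub_sum_component_mem_orderIdeal (ν : σ → ℕ) (k : ℕ) (p : MvPolynomial σ R) :
    p - ∑ j ∈ Finset.range k, weightedHomogeneousComponent ν j p ∈ orderIdeal ν k := by
  classical
  intro m hm
  by_contra h
  push Not at h
  apply hm
  rw [coeff_sub, coeff_sum]
  simp only [coeff_weightedHomogeneousComponent]
  rw [Finset.sum_ite_eq, if_pos (Finset.mem_range.2 h), sub_self]

theorem component_eq_zero_of_mem_orderIdeal {ν : σ → ℕ} {k : ℕ} {p : MvPolynomial σ R}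
    (hp : p ∈ orderIdeal ν k) {j : ℕ} (hj : j < k) :
    weightedHomogeneousComponent ν j p = 0 := by
  classical
  ext m
  rw [coeff_weightedHomogeneousComponent, coeff_zero]
  split_ifs with h
  · by_contra hne
    have := hp m hne
    omega
  · rfl

theorem mem_orderIdeal_of_component_eq_zero {ν : σ → ℕ} {k : ℕ} {p : MvPolynomial σ R}
    (hp : ∀ j < k, weightedHomogeneousComponent ν j p = 0) : p ∈ orderIdeal ν k := by
  have := sub_sum_component_mem_orderIdeal ν k p
  rwa [Finset.sum_eq_zero fun j hj => hp j (Finset.mem_range.1 hj), sub_zero] at this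

end Filtration

/-! ### Polynomials in `z`, `z̄`, `u` as functions. -/

section Evaluation

variable {n : ℕ}

/-- The weighted dilation `(z, u) ↦ (t z, t² u)`. -/
noncomputable def dilate (t : ℝ) (x : Param n) : Param n := (t • x.1, t ^ 2 * x.2)

/-- The values of the indeterminates at a point. -/
noncomputable def varValue (x : Param n) : Vars n → ℂ :=
  Sum.elim (fun i => x.1 i) (Sum.elim (fun i => (starRingEnd ℂ) (x.1 i)) (fun _ => (x.2 : ℂ)))

theorem evalAt_eq (x : Param n) (P : MvPolynomial (Vars n) ℂ) :
    evalAt x P = eval (varValue x) P := rfl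

theorem varValue_dilate (t : ℝ) (x : Param n) (v : Vars n) :
    varValue (dilate t x) v = (t : ℂ) ^ weight v * varValue x v := by
  rcases v with i | i | i <;> simp [varValue, dilate, weight]

theorem evalAt_dilate {μ : ℕ} {P : MvPolynomial (Vars n) ℂ}
    (hP : P.IsWeightedHomogeneous weight μ) (t : ℝ) (x : Param n) :
    evalAt (dilate t x) P = (t : ℂ) ^ μ * evalAt x P := by
  rw [evalAt_eq, evalAt_eq, eval_eq, eval_eq, Finset.mul_sum]
  refine Finset.sum_congr rfl fun m hm => ?_
  rw [← hP (mem_support_iff.1 hm)]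
  simp_rw [varValue_dilate, mul_pow, Finset.prod_mul_distrib]
  rw [Finsupp.weight_apply, Finsupp.sum, ← Finset.prod_pow_eq_pow_sum]
  simp_rw [smul_eq_mul, mul_comm (m _), pow_mul]
  ring

theorem contDiff_varValue (v : Vars n) : ContDiff ℝ ∞ fun x : Param n => varValue x v := by
  have h : ∀ i, ContDiff ℝ ∞ fun x : Param n => x.1 i := fun i =>
    ((EuclideanSpace.proj (𝕜 := ℂ) i).restrictScalars ℝ).contDiff.comp contDiff_fst
  rcases v with i | i | i
  · exact h i
  · exact Complex.conjCLE.contDiff.comp (h i)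
  · exact Complex.ofRealCLM.contDiff.comp contDiff_snd

theorem contDiff_evalAt (P : MvPolynomial (Vars n) ℂ) :
    ContDiff ℝ ∞ fun x : Param n => evalAt x P := by
  simp_rw [evalAt_eq, eval_eq]
  exact ContDiff.sum fun m _ => contDiff_const.mul (contDiff_prod fun v _ =>
    (contDiff_varValue v).pow _)

/-- Substitution of `xᵢ + i yᵢ`, `xᵢ - i yᵢ` for `zᵢ`, `z̄ᵢ`. -/
noncomputable def realCoords : Vars n → MvPolynomial (Vars n) ℂ :=
  Sum.elim (fun i => X (Sum.inl i) + C Complex.I * X (Sum.inr (Sum.inl i)))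
    (Sum.elim (fun i => X (Sum.inl i) - C Complex.I * X (Sum.inr (Sum.inl i)))
      (fun _ => X (Sum.inr (Sum.inr ()))))

/-- Substitution of the real and imaginary parts of `zᵢ` for `xᵢ`, `yᵢ`. -/
noncomputable def complexCoords : Vars n → MvPolynomial (Vars n) ℂ :=
  Sum.elim (fun i => C (1 / 2) * (X (Sum.inl i) + X (Sum.inr (Sum.inl i))))
    (Sum.elim (fun i => C (1 / (2 * Complex.I)) * (X (Sum.inl i) - X (Sum.inr (Sum.inl i))))
      (fun _ => X (Sum.inr (Sum.inr ()))))

theorem aeval_complexCoords_realCoords (P : MvPolynomial (Vars n) ℂ) :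
    aeval complexCoords (aeval realCoords P) = P := by
  have h2 : (C (1 / 2 : ℂ) : MvPolynomial (Vars n) ℂ) * 2 = 1 := by
    rw [show (2 : MvPolynomial (Vars n) ℂ) = C 2 from rfl, ← C_mul]; norm_num
  have hI : (C Complex.I : MvPolynomial (Vars n) ℂ) * C (1 / (2 * Complex.I)) = C (1 / 2) := by
    rw [← C_mul]; congr 1; field_simp
  have : ((aeval (complexCoords (n := n))).comp (aeval realCoords) :
      MvPolynomial (Vars n) ℂ →ₐ[ℂ] _) = AlgHom.id ℂ _ := by
    ext v : 1
    rcases v with i | i | i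
    · simp only [realCoords, complexCoords, AlgHom.comp_apply, aeval_X, Sum.elim_inl, Sum.elim_inr,
        map_add, map_mul, algHom_C, algebraMap_eq, AlgHom.id_apply]
      linear_combination (X (Sum.inl i) - X (Sum.inr (Sum.inl i))) * hI + X (Sum.inl i) * h2
    · simp only [realCoords, complexCoords, AlgHom.comp_apply, aeval_X, Sum.elim_inl, Sum.elim_inr,
        map_sub, map_mul, algHom_C, algebraMap_eq, AlgHom.id_apply]
      linear_combination -(X (Sum.inl i) - X (Sum.inr (Sum.inl i))) * hI +
        X (Sum.inr (Sum.inl i)) * h2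
    · simp [realCoords, complexCoords]
  exact DFunLike.congr_fun this P

/-- The values of `z` and `z̄` are not independent, so vanishing at all points is not vanishing on a
product of infinite sets. The invertible linear change to real and imaginary parts turns it into
vanishing at all real points, which is. -/
theorem eq_zero_of_evalAt_eq_zero {P : MvPolynomial (Vars n) ℂ} (h : ∀ x, evalAt x P = 0) :
    P = 0 := by
  rw [← aeval_complexCoords_realCoords P]
  suffices aeval realCoords P = (0 : MvPolynomial (Vars n) ℂ) by rw [this, map_zero]
  refine funext_set (fun _ => Set.range ((↑) : ℝ → ℂ))
    (fun _ => Set.infinite_range_of_injective Complex.ofReal_injective) fun y hy => ?_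
  choose r hr using fun v => hy v (Set.mem_univ v)
  rw [map_zero, ← h (WithLp.toLp 2 (fun i => (r (Sum.inl i) : ℂ) +
    Complex.I * (r (Sum.inr (Sum.inl i)) : ℂ)), r (Sum.inr (Sum.inr ()))), evalAt_eq]
  rw [← aeval_eq_eval, ← aeval_eq_eval, ← AlgHom.comp_apply]
  congr 1
  ext v
  rcases v with i | i | i <;> simp [realCoords, varValue, hr, ← sub_eq_add_neg]
  simp [← hr]

end Evaluation

end BoundaryJets

/-! ### Weighted Taylor approximation of functions. -/

namespace BoundaryJets

open Asymptotics Filter MvPolynomial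

variable {n : ℕ}

/-- The weighted gauge `max (‖z‖, |u|^{1/2})`. -/
noncomputable def gauge (x : Param n) : ℝ := max ‖x.1‖ (√|x.2|)

theorem gauge_nonneg (x : Param n) : 0 ≤ gauge x := le_max_of_le_left (norm_nonneg _)

theorem norm_fst_le_gauge (x : Param n) : ‖x.1‖ ≤ gauge x := le_max_left _ _

theorem abs_snd_le_gauge_sq (x : Param n) : |x.2| ≤ gauge x ^ 2 := by
  rw [← Real.sq_sqrt (abs_nonneg x.2)]
  exact pow_le_pow_left₀ (Real.sqrt_nonneg _) (le_max_right _ _) 2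

theorem gauge_le_of {x : Param n} {r : ℝ} (hr : 0 ≤ r) (h1 : ‖x.1‖ ≤ r) (h2 : |x.2| ≤ r ^ 2) :
    gauge x ≤ r :=
  max_le h1 (Real.sqrt_le_iff.2 ⟨hr, h2⟩)

theorem gauge_dilate (t : ℝ) (x : Param n) : gauge (dilate t x) = |t| * gauge x := by
  rw [gauge, gauge, mul_max_of_nonneg _ _ (abs_nonneg t)]
  simp only [dilate, norm_smul, Real.norm_eq_abs, abs_mul, abs_pow]
  rw [Real.sqrt_mul (by positivity), Real.sqrt_sq (abs_nonneg t)]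

theorem continuous_gauge : Continuous (gauge (n := n)) := by
  unfold gauge
  fun_prop

theorem tendsto_gauge : Tendsto (gauge (n := n)) (𝓝 0) (𝓝 0) := by
  have := (continuous_gauge (n := n)).tendsto 0
  simpa [gauge] using this

theorem eventually_gauge_le_one : ∀ᶠ x : Param n in 𝓝 0, gauge x ≤ 1 :=
  (tendsto_gauge.eventually_lt_const one_pos).mono fun _ h => h.le

theorem norm_le_gauge {x : Param n} (h : gauge x ≤ 1) : ‖x‖ ≤ gauge x := by
  rw [Prod.norm_def]
  refine max_le (norm_fst_le_gauge x) ((abs_snd_le_gauge_sq x).trans ?_)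
  nlinarith [gauge_nonneg x]

theorem isBigO_norm_pow_gauge (k : ℕ) :
    (fun x : Param n => ‖x‖ ^ k) =O[𝓝 0] fun x => gauge x ^ k := by
  refine IsBigO.of_bound 1 ?_
  filter_upwards [eventually_gauge_le_one] with x hx
  rw [one_mul, Real.norm_of_nonneg (by positivity),
    Real.norm_of_nonneg (pow_nonneg (gauge_nonneg x) k)]
  exact pow_le_pow_left₀ (norm_nonneg x) (norm_le_gauge hx) k

theorem isBigO_gauge_pow {k l : ℕ} (h : l ≤ k) :
    (fun x : Param n => gauge x ^ k) =O[𝓝 0] fun x => gauge x ^ l := by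
  refine IsBigO.of_bound 1 ?_
  filter_upwards [eventually_gauge_le_one] with x hx
  rw [one_mul, Real.norm_of_nonneg (pow_nonneg (gauge_nonneg x) k),
    Real.norm_of_nonneg (pow_nonneg (gauge_nonneg x) l)]
  exact pow_le_pow_of_le_one (gauge_nonneg x) hx h

theorem norm_varValue_le (x : Param n) (v : Vars n) : ‖varValue x v‖ ≤ gauge x ^ weight v := by
  rcases v with i | i | i
  · simpa [varValue, weight] using (PiLp.norm_apply_le x.1 i).trans (norm_fst_le_gauge x)
  · simpa [varValue, weight] using (PiLp.norm_apply_le x.1 i).trans (norm_fst_le_gauge x)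
  · simpa [varValue, weight] using abs_snd_le_gauge_sq x

theorem evalAt_isBigO {k : ℕ} {p : MvPolynomial (Vars n) ℂ} (hp : p ∈ orderIdeal weight k) :
    (fun x : Param n => evalAt x p) =O[𝓝 0] fun x => gauge x ^ k := by
  simp_rw [evalAt_eq, eval_eq]
  refine IsBigO.fun_sum fun m hm => ?_
  refine IsBigO.trans ?_ (isBigO_gauge_pow (hp m (mem_support_iff.1 hm)))
  refine IsBigO.of_bound ‖coeff m p‖ (Eventually.of_forall fun x => ?_)
  rw [norm_mul, norm_prod, Real.norm_of_nonneg (pow_nonneg (gauge_nonneg x) _),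
    Finsupp.weight_apply, Finsupp.sum, ← Finset.prod_pow_eq_pow_sum]
  refine mul_le_mul_of_nonneg_left (Finset.prod_le_prod (fun _ _ => norm_nonneg _) fun v _ => ?_)
    (norm_nonneg _)
  rw [norm_pow, smul_eq_mul, mul_comm, pow_mul]
  exact pow_le_pow_left₀ (norm_nonneg _) (norm_varValue_le x v) _

theorem dilate_zero (x : Param n) : dilate 0 x = 0 := by
  simp [dilate]

theorem tendsto_dilate (x : Param n) : Tendsto (fun t : ℝ => dilate t x) (𝓝 0) (𝓝 0) := by
  have h : Continuous fun t : ℝ => dilate t x := by unfold dilate; fun_prop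
  simpa only [dilate_zero] using h.tendsto 0

theorem contDiff_dilate (x : Param n) : ContDiff ℝ ∞ fun t : ℝ => dilate t x := by
  unfold dilate
  fun_prop

theorem evalAt_sum {ι : Type*} (s : Finset ι) (p : ι → MvPolynomial (Vars n) ℂ) (x : Param n) :
    evalAt x (∑ i ∈ s, p i) = ∑ i ∈ s, evalAt x (p i) := by
  simp [evalAt]

/-- `f` agrees with the polynomial `p` up to terms of weight larger than `k`. -/
def Approx (k : ℕ) (f : Param n → ℂ) (p : MvPolynomial (Vars n) ℂ) : Prop :=
  (fun x => f x - evalAt x p) =O[𝓝 0] fun x => gauge x ^ (k + 1)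

namespace Approx

variable {k : ℕ} {f g : Param n → ℂ} {p q : MvPolynomial (Vars n) ℂ}

theorem evalAt_self (k : ℕ) (p : MvPolynomial (Vars n) ℂ) : Approx k (fun x => evalAt x p) p := by
  simp only [Approx, sub_self]
  exact isBigO_zero _ _

theorem isBigO_one (hf : Approx k f p) : f =O[𝓝 0] fun _ => (1 : ℝ) := by
  have h1 : (fun x => f x - evalAt x p) =O[𝓝 0] fun _ => (1 : ℝ) := by
    simpa using hf.trans (isBigO_gauge_pow (Nat.zero_le (k + 1)))
  have h2 : (fun x : Param n => evalAt x p) =O[𝓝 0] fun _ => (1 : ℝ) := by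
    simpa using evalAt_isBigO (orderIdeal_zero weight p)
  simpa using h1.add h2

theorem add (hf : Approx k f p) (hg : Approx k g q) :
    Approx k (fun x => f x + g x) (p + q) := by
  refine (IsBigO.add hf hg).congr_left fun x => ?_
  simp only [evalAt, map_add]
  ring

theorem neg (hf : Approx k f p) : Approx k (fun x => -f x) (-p) := by
  refine (IsBigO.neg_left hf).congr_left fun x => ?_
  simp only [evalAt, map_neg]
  ring

theorem sub (hf : Approx k f p) (hg : Approx k g q) :
    Approx k (fun x => f x - g x) (p - q) := by
  simpa [sub_eq_add_neg] using hf.add hg.neg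

theorem mul (hf : Approx k f p) (hg : Approx k g q) :
    Approx k (fun x => f x * g x) (p * q) := by
  have h1 := IsBigO.mul hf hg.isBigO_one
  have h2 := IsBigO.mul (evalAt_self k p).isBigO_one hg
  simp only [mul_one] at h1
  simp only [one_mul] at h2
  refine (h1.add h2).congr_left fun x => ?_
  simp only [evalAt, map_mul]
  ring

theorem const (k : ℕ) (c : ℂ) : Approx k (fun _ : Param n => c) (C c) := by
  simpa [evalAt] using evalAt_self k (C c)

theorem pow (hf : Approx k f p) (j : ℕ) : Approx k (fun x => f x ^ j) (p ^ j) := by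
  induction j with
  | zero => simpa using const (n := n) k 1
  | succ j ih => simpa [pow_succ] using ih.mul hf

theorem congr (hf : Approx k f p) (h : f =ᶠ[𝓝 0] g) : Approx k g p :=
  IsBigO.congr' hf (h.sub EventuallyEq.rfl) EventuallyEq.rfl

theorem congr_right (hf : Approx k f p) (h : p - q ∈ orderIdeal weight (k + 1)) :
    Approx k f q := by
  refine (IsBigO.add hf (evalAt_isBigO h)).congr_left fun x => ?_
  simp only [evalAt, map_sub]
  ring

theorem eval₂ {v : Param n → Vars n → ℂ} {q : Vars n → MvPolynomial (Vars n) ℂ}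
    (h : ∀ i, Approx k (fun x => v x i) (q i)) (P : MvPolynomial (Vars n) ℂ) :
    Approx k (fun x => eval (v x) P) (aeval q P) := by
  induction P using MvPolynomial.induction_on with
  | C a => simpa using const (n := n) k a
  | add p q hp hq => simpa using hp.add hq
  | mul_X p i hp => simpa using hp.mul (h i)

/-- Uniqueness of the weighted Taylor polynomial: along a dilation, the components of `p - q` of
weight at most `k` become the coefficients of a polynomial in `t` that is `O(t ^ (k + 1))`, and each
coefficient vanishes at every point. -/
theorem sub_mem_orderIdeal (hp : Approx k f p) (hq : Approx k f q) :
    p - q ∈ orderIdeal weight (k + 1) := by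
  refine mem_orderIdeal_of_component_eq_zero fun j hj => ?_
  refine eq_zero_of_evalAt_eq_zero fun x => ?_
  set r := p - q with hr
  have h1 : (fun x => evalAt x r) =O[𝓝 0] fun x => gauge x ^ (k + 1) := by
    refine (IsBigO.sub hq hp).congr_left fun x => ?_
    simp only [hr, evalAt, map_sub]
    ring
  have h2 : (fun x => evalAt x (∑ j ∈ Finset.range (k + 1), weightedHomogeneousComponent weight j r))
      =O[𝓝 0] fun x => gauge x ^ (k + 1) := by
    refine (h1.sub (evalAt_isBigO (sub_sum_component_mem_orderIdeal weight (k + 1) r))).congr_left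
      fun x => ?_
    simp only [evalAt, map_sub]
    ring
  have h3 := (tendsto_dilate x).mono_left (nhdsWithin_le_nhds (s := Set.Ioi 0))
  have h4 := h2.comp_tendsto h3
  refine coeff_eq_zero_of_isBigO (d := fun j => evalAt x (weightedHomogeneousComponent weight j r))
    (k + 1) ((h4.congr_left fun t => ?_).trans (IsBigO.of_bound (gauge x ^ (k + 1))
      (Eventually.of_forall fun t => ?_))) j hj
  · simp only [Function.comp]
    rw [evalAt_sum]
    refine Finset.sum_congr rfl fun j _ => ?_
    rw [evalAt_dilate (weightedHomogeneousComponent_isWeightedHomogeneous j r)]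
    simp
  · simp only [Function.comp, gauge_dilate]
    rw [Real.norm_of_nonneg (by have := gauge_nonneg x; positivity), mul_pow]
    simp [mul_comm]

end Approx

/-- Expansion along a weighted dilation. -/
theorem Approx.dilate_isBigO {k : ℕ} {f : Param n → ℂ} {p : MvPolynomial (Vars n) ℂ}
    (h : Approx k f p) (x : Param n) :
    (fun t : ℝ => f (dilate t x) - ∑ j ∈ Finset.range (k + 1),
      t ^ j • evalAt x (weightedHomogeneousComponent weight j p)) =O[𝓝 0] fun t => t ^ (k + 1) := by
  have h2 : Approx k f (∑ j ∈ Finset.range (k + 1), weightedHomogeneousComponent weight j p) :=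
    h.congr_right (sub_sum_component_mem_orderIdeal _ _ _)
  refine ((IsBigO.comp_tendsto h2 (tendsto_dilate x)).congr_left fun t => ?_).trans
    (IsBigO.of_bound (gauge x ^ (k + 1)) (Eventually.of_forall fun t => ?_))
  · simp only [Function.comp]
    rw [evalAt_sum]
    congr 1
    refine Finset.sum_congr rfl fun j _ => ?_
    rw [evalAt_dilate (weightedHomogeneousComponent_isWeightedHomogeneous j p)]
    simp
  · simp only [Function.comp, gauge_dilate]
    rw [Real.norm_of_nonneg (by have := gauge_nonneg x; positivity), mul_pow]
    simp [mul_comm]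

/-- The real parts of the components match the derivatives of `f` along the dilation. Because `f` is
real-valued, the imaginary parts alone form a polynomial in `t` of too high an order, and therefore
vanish. -/
theorem weightedPart_eq_evalAt {k : ℕ} {f : Param n → ℝ} {p : MvPolynomial (Vars n) ℂ}
    (hf : ContDiffAt ℝ ∞ f 0) (h : Approx k (fun x => (f x : ℂ)) p) {μ : ℕ} (hμ : μ ≤ k)
    (x : Param n) :
    (weightedPart f μ x : ℂ) = evalAt x (weightedHomogeneousComponent weight μ p) := by
  have h1 := (h.dilate_isBigO x).mono (nhdsWithin_le_nhds (s := Set.Ioi 0))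
  have hre := iteratedDeriv_eq_of_isBigO (q := fun t => f (dilate t x)) k
    (ContDiffAt.comp (0 : ℝ) (by rwa [dilate_zero]) (contDiff_dilate x).contDiffAt)
    (d := fun j => (evalAt x (weightedHomogeneousComponent weight j p)).re)
    (by
      refine ((Complex.reCLM.isBigO_comp _ _).trans h1).congr_left fun t => ?_
      simp [-Complex.ofReal_pow]) μ hμ
  have him := coeff_eq_zero_of_isBigO
    (d := fun j => (evalAt x (weightedHomogeneousComponent weight j p)).im) (k + 1)
    (by
      refine (((Complex.imCLM.isBigO_comp _ _).trans h1).neg_left).congr_left fun t => ?_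
      simp [-Complex.ofReal_pow]) μ (by omega)
  apply Complex.ext
  · rw [Complex.ofReal_re, weightedPart]
    have : iteratedDeriv μ (fun t : ℝ => f (t • x.1, t ^ 2 * x.2)) 0 = _ := hre
    rw [this, smul_eq_mul, mul_div_cancel_left₀ _ (by positivity)]
  · rw [Complex.ofReal_im]
    exact him.symm

/-- A real multilinear form on the diagonal is a polynomial in `(z, z̄, u)`. -/
theorem exists_evalAt_eq_multilinear {j : ℕ}
    (L : MultilinearMap ℝ (fun _ : Fin j => Param n) ℝ) :
    ∃ p : MvPolynomial (Vars n) ℂ, ∀ x, ((L fun _ => x : ℝ) : ℂ) = evalAt x p := by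
  classical
  set b : Vars n → Param n := Sum.elim (fun i => (EuclideanSpace.single i 1, 0))
    (Sum.elim (fun i => (EuclideanSpace.single i Complex.I, 0)) (fun _ => (0, 1))) with hb
  set c : Param n → Vars n → ℝ := fun x => Sum.elim (fun i => (x.1 i).re)
    (Sum.elim (fun i => (x.1 i).im) (fun _ => x.2)) with hc
  have hx : ∀ x : Param n, x = ∑ v, c x v • b v := by
    intro x
    rw [Fintype.sum_sum_type, Fintype.sum_sum_type]
    refine Prod.ext ?_ ?_
    · ext i
      simp only [hc, hb, Sum.elim_inl, Sum.elim_inr, Prod.fst_add, Prod.fst_sum, Prod.smul_fst,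
        PiLp.add_apply, WithLp.ofLp_sum, Finset.sum_apply, WithLp.ofLp_smul, Pi.smul_apply]
      simp [Finset.sum_ite_eq, Complex.re_add_im]
    · simp [hc, hb, Prod.snd_sum]
  set q : Vars n → MvPolynomial (Vars n) ℂ := complexCoords with hq
  have hcq : ∀ x v, (c x v : ℂ) = evalAt x (q v) := by
    intro x v
    rcases v with i | i | i
    · simp only [hc, hq, evalAt_eq, complexCoords, Sum.elim_inl, map_mul, map_add, eval_C, eval_X,
        varValue, Sum.elim_inr]
      rw [Complex.re_eq_add_conj]
      ring
    · simp only [hc, hq, evalAt_eq, complexCoords, Sum.elim_inl, map_mul, map_sub, eval_C, eval_X,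
        varValue, Sum.elim_inr]
      rw [Complex.im_eq_sub_conj]
      ring
    · simp [hc, hq, evalAt_eq, complexCoords, varValue]
  refine ⟨∑ r : Fin j → Vars n, (∏ i, q (r i)) * C ((L fun i => b (r i) : ℝ) : ℂ), fun x => ?_⟩
  conv_lhs => rw [hx x]
  rw [MultilinearMap.map_sum, evalAt_sum, Complex.ofReal_sum]
  refine Finset.sum_congr rfl fun r _ => ?_
  rw [MultilinearMap.map_smul_univ]
  simp only [smul_eq_mul, Complex.ofReal_mul, Complex.ofReal_prod, hcq, evalAt_eq, map_mul, map_prod,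
    eval_C]

/-- The ordinary Taylor polynomial of degree `k` suffices: near `0` one has `‖x‖ ≤ gauge x`, so the
ordinary remainder is also of weighted order `k + 1`. -/
theorem exists_approx {f : Param n → ℝ} (hf : ContDiffAt ℝ ∞ f 0) (k : ℕ) :
    ∃ p, Approx k (fun x => (f x : ℂ)) p := by
  choose q hq using fun j => exists_evalAt_eq_multilinear (iteratedFDeriv ℝ j f 0).toMultilinearMap
  refine ⟨∑ j ∈ Finset.range (k + 1), C ((j.factorial : ℂ)⁻¹) * q j, ?_⟩
  have h1 := (taylor_isBigO k (by exact_mod_cast contDiffAt_infty.1 hf (k + 1))).trans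
    (isBigO_norm_pow_gauge (n := n) (k + 1))
  refine (IsBigO.trans (Complex.ofRealCLM.isBigO_comp _ _) h1).congr_left fun x => ?_
  rw [evalAt_sum]
  have h2 : ∀ j, evalAt x (C ((j.factorial : ℂ)⁻¹) * q j) =
      (j.factorial : ℂ)⁻¹ * evalAt x (q j) := fun j => by simp [evalAt]
  simp_rw [h2, ← hq]
  simp

theorem weightedPart_eq_zero_of_isBigO {k : ℕ} {f : Param n → ℝ} (hf : ContDiffAt ℝ ∞ f 0)
    (h : f =O[𝓝 0] fun x => gauge x ^ (k + 1)) {μ : ℕ} (hμ : μ ≤ k) (x : Param n) :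
    weightedPart f μ x = 0 := by
  have h1 : Approx k (fun x => (f x : ℂ)) 0 := by
    refine (IsBigO.trans (Complex.ofRealCLM.isBigO_comp _ _) h).congr_left fun x => ?_
    simp [evalAt]
  have := weightedPart_eq_evalAt hf h1 hμ x
  simpa [evalAt] using this

theorem approx_of_weightedPart {k : ℕ} {f : Param n → ℝ} {P : ℕ → MvPolynomial (Vars n) ℂ}
    (hf : ContDiffAt ℝ ∞ f 0)
    (h : ∀ μ ≤ k, ∀ x, (weightedPart f μ x : ℂ) = evalAt x (P μ)) :
    Approx k (fun x => (f x : ℂ)) (∑ μ ∈ Finset.range (k + 1), P μ) := by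
  obtain ⟨p, hp⟩ := exists_approx hf k
  refine hp.congr_right ?_
  have h1 := sub_sum_component_mem_orderIdeal weight (k + 1) p
  convert h1 using 3 with μ hμ
  have hμ' : μ ≤ k := by simpa [Nat.lt_succ_iff] using hμ
  rw [← sub_eq_zero]
  refine eq_zero_of_evalAt_eq_zero fun x => ?_
  have := weightedPart_eq_evalAt hf hp hμ' x
  rw [h μ hμ' x] at this
  rw [evalAt, map_sub, sub_eq_zero]
  exact this

theorem isBigO_gauge_of_vanishes {k : ℕ} {f : Param n → ℝ} (hf : ContDiffAt ℝ ∞ f 0)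
    (h : VanishesToWeightedOrder k f) : f =O[𝓝 0] fun x => gauge x ^ (k + 1) := by
  have := approx_of_weightedPart (P := fun _ => 0) hf
    (k := k) (fun μ hμ x => by simp [h μ hμ x, evalAt])
  have h2 : (fun x => ((f x : ℝ) : ℂ)) =O[𝓝 0] fun x => gauge x ^ (k + 1) := by
    refine IsBigO.congr_left this fun x => ?_
    simp [evalAt]
  simpa using h2.norm_left

end BoundaryJets

/-! ### Traces and multiplication by `‖z‖²`. -/

namespace BoundaryJets

open Filter MvPolynomial

variable {n : ℕ}

/-- The operator `∑ ∂²/∂z_α∂z̄_α`. -/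
noncomputable def laplacian : MvPolynomial (Vars n) ℂ →ₗ[ℂ] MvPolynomial (Vars n) ℂ :=
  ∑ α : Fin n, (pderiv (Sum.inl α)).toLinearMap ∘ₗ (pderiv (Sum.inr (Sum.inl α))).toLinearMap

theorem laplacian_apply (Q : MvPolynomial (Vars n) ℂ) :
    laplacian Q = ∑ α : Fin n, pderiv (Sum.inl α) (pderiv (Sum.inr (Sum.inl α)) Q) := by
  simp [laplacian]

theorem trace_eq (j k : ℕ) (Q : MvPolynomial (Vars n) ℂ) :
    trace j k Q = C ((j : ℂ) * (k : ℂ))⁻¹ * laplacian Q := by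
  rw [trace, laplacian_apply]

theorem trace_eq_zero_iff {j k : ℕ} (hj : j ≠ 0) (hk : k ≠ 0) {Q : MvPolynomial (Vars n) ℂ} :
    trace j k Q = 0 ↔ laplacian Q = 0 := by
  rw [trace_eq, mul_eq_zero, or_iff_right]
  rw [C_eq_zero]
  positivity

theorem laplacian_C_mul (c : ℂ) (Q : MvPolynomial (Vars n) ℂ) :
    laplacian (C c * Q) = C c * laplacian Q := by
  rw [← smul_eq_C_mul, map_smul, smul_eq_C_mul]

theorem trace_trace_eq_zero_iff {j k : ℕ} (hj : j ≠ 0) (hk : k ≠ 0) {j' k' : ℕ} (hj' : j' ≠ 0)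
    (hk' : k' ≠ 0) {Q : MvPolynomial (Vars n) ℂ} :
    trace j k (trace j' k' Q) = 0 ↔ laplacian (laplacian Q) = 0 := by
  rw [trace_eq_zero_iff hj hk, trace_eq, laplacian_C_mul, mul_eq_zero, or_iff_right]
  rw [C_eq_zero]
  positivity

theorem trace_trace_trace_eq_zero_iff {j k : ℕ} (hj : j ≠ 0) (hk : k ≠ 0) {j' k' : ℕ} (hj' : j' ≠ 0)
    (hk' : k' ≠ 0) {i l : ℕ} (hi : i ≠ 0) (hl : l ≠ 0) {Q : MvPolynomial (Vars n) ℂ} :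
    trace j k (trace j' k' (trace i l Q)) = 0 ↔ laplacian (laplacian (laplacian Q)) = 0 := by
  rw [trace_trace_eq_zero_iff hj hk hj' hk', trace_eq, laplacian_C_mul, laplacian_C_mul, mul_eq_zero,
    or_iff_right]
  rw [C_eq_zero]
  positivity

/-- The degree in `z`. -/
def holDegree (v : Vars n) : ℕ := (bidegree v).1

/-- The degree in `z̄`. -/
def antiholDegree (v : Vars n) : ℕ := (bidegree v).2

theorem weight_bidegree (m : Vars n →₀ ℕ) :
    Finsupp.weight bidegree m = (Finsupp.weight holDegree m, Finsupp.weight antiholDegree m) := by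
  simp only [Finsupp.weight_apply, Finsupp.sum]
  ext
  · simp [Prod.fst_sum, holDegree]
  · simp [Prod.snd_sum, antiholDegree]

theorem weight_holDegree (m : Vars n →₀ ℕ) :
    Finsupp.weight holDegree m = ∑ i : Fin n, m (Sum.inl i) := by
  rw [Finsupp.weight_apply, Finsupp.sum_fintype _ _ (by simp)]
  simp [Fintype.sum_sum_type, holDegree, bidegree]

theorem weight_antiholDegree (m : Vars n →₀ ℕ) :
    Finsupp.weight antiholDegree m = ∑ i : Fin n, m (Sum.inr (Sum.inl i)) := by
  rw [Finsupp.weight_apply, Finsupp.sum_fintype _ _ (by simp)]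
  simp [Fintype.sum_sum_type, antiholDegree, bidegree]

theorem weight_weight (m : Vars n →₀ ℕ) :
    Finsupp.weight weight m = (∑ i : Fin n, m (Sum.inl i)) + ((∑ i : Fin n, m (Sum.inr (Sum.inl i))) +
      m (Sum.inr (Sum.inr ())) * 2) := by
  rw [Finsupp.weight_apply, Finsupp.sum_fintype _ _ (by simp)]
  simp [Fintype.sum_sum_type, weight]

theorem euler_hol {j k : ℕ} {Q : MvPolynomial (Vars n) ℂ}
    (hQ : Q.IsWeightedHomogeneous bidegree (j, k)) :
    ∑ i : Fin n, X (Sum.inl i) * pderiv (Sum.inl i) Q = j • Q := by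
  have h : Q.IsWeightedHomogeneous holDegree j := fun m hm => by
    have := hQ hm
    rw [weight_bidegree, Prod.mk.injEq] at this
    exact this.1
  have := h.sum_weight_X_mul_pderiv
  simpa [Fintype.sum_sum_type, holDegree, bidegree] using this

theorem euler_antihol {j k : ℕ} {Q : MvPolynomial (Vars n) ℂ}
    (hQ : Q.IsWeightedHomogeneous bidegree (j, k)) :
    ∑ i : Fin n, X (Sum.inr (Sum.inl i)) * pderiv (Sum.inr (Sum.inl i)) Q = k • Q := by
  have h : Q.IsWeightedHomogeneous antiholDegree k := fun m hm => by
    have := hQ hm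
    rw [weight_bidegree, Prod.mk.injEq] at this
    exact this.2
  have := h.sum_weight_X_mul_pderiv
  simpa [Fintype.sum_sum_type, antiholDegree, bidegree] using this

/-- The polynomial `‖z‖²`. -/
noncomputable def normSq (n : ℕ) : MvPolynomial (Vars n) ℂ :=
  ∑ i : Fin n, X (Sum.inl i) * X (Sum.inr (Sum.inl i))

theorem evalAt_normSq (x : Param n) : evalAt x (normSq n) = ((‖x.1‖ ^ 2 : ℝ) : ℂ) := by
  rw [evalAt_eq, normSq, map_sum, EuclideanSpace.norm_sq_eq, Complex.ofReal_sum]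
  refine Finset.sum_congr rfl fun i _ => ?_
  simp [varValue, Complex.mul_conj, Complex.normSq_eq_norm_sq]

theorem pderiv_hol_normSq (α : Fin n) :
    pderiv (Sum.inl α) (normSq n) = X (Sum.inr (Sum.inl α)) := by
  classical
  simp [normSq, pderiv_X, Pi.single_apply]

theorem pderiv_antihol_normSq (α : Fin n) :
    pderiv (Sum.inr (Sum.inl α)) (normSq n) = X (Sum.inl α) := by
  classical
  simp [normSq, pderiv_X, Pi.single_apply]

/-- Leibniz' rule together with Euler's identities in `z` and in `z̄`: the commutator of the
Laplacian with multiplication by `‖z‖²` is a scalar on each bidegree. -/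
theorem laplacian_normSq_mul {j k : ℕ} {Q : MvPolynomial (Vars n) ℂ}
    (hQ : Q.IsWeightedHomogeneous bidegree (j, k)) :
    laplacian (normSq n * Q) = (n + j + k) • Q + normSq n * laplacian Q := by
  have h : ∀ α : Fin n, pderiv (Sum.inl α) (pderiv (Sum.inr (Sum.inl α)) (normSq n * Q)) =
      Q + X (Sum.inl α) * pderiv (Sum.inl α) Q +
        X (Sum.inr (Sum.inl α)) * pderiv (Sum.inr (Sum.inl α)) Q +
        normSq n * pderiv (Sum.inl α) (pderiv (Sum.inr (Sum.inl α)) Q) := by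
    intro α
    rw [pderiv_mul, map_add, pderiv_mul, pderiv_mul, pderiv_antihol_normSq, pderiv_hol_normSq,
      pderiv_X_self]
    ring
  rw [laplacian_apply, Finset.sum_congr rfl fun α _ => h α, Finset.sum_add_distrib,
    Finset.sum_add_distrib, Finset.sum_add_distrib, euler_hol hQ, euler_antihol hQ,
    laplacian_apply, Finset.mul_sum]
  simp [add_smul]

theorem bidegree_X_hol (i : Fin n) :
    (X (Sum.inl i) : MvPolynomial (Vars n) ℂ).IsWeightedHomogeneous bidegree (1, 0) :=
  isWeightedHomogeneous_X ℂ bidegree (Sum.inl i)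

theorem bidegree_X_antihol (i : Fin n) :
    (X (Sum.inr (Sum.inl i)) : MvPolynomial (Vars n) ℂ).IsWeightedHomogeneous bidegree (0, 1) :=
  isWeightedHomogeneous_X ℂ bidegree (Sum.inr (Sum.inl i))

theorem bidegree_C_mul {d : ℕ × ℕ} {Q : MvPolynomial (Vars n) ℂ} (c : ℂ)
    (hQ : Q.IsWeightedHomogeneous bidegree d) : (C c * Q).IsWeightedHomogeneous bidegree d := by
  simpa using (isWeightedHomogeneous_C bidegree c).mul hQ

theorem bidegree_sum {ι : Type*} (s : Finset ι) {d : ℕ × ℕ} {Q : ι → MvPolynomial (Vars n) ℂ}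
    (hQ : ∀ i ∈ s, (Q i).IsWeightedHomogeneous bidegree d) :
    (∑ i ∈ s, Q i).IsWeightedHomogeneous bidegree d := by
  rw [← mem_weightedHomogeneousSubmodule]
  exact Submodule.sum_mem _ fun i hi => hQ i hi

theorem bidegree_normSq : (normSq n).IsWeightedHomogeneous bidegree (1, 1) :=
  bidegree_sum _ fun i _ => by simpa using (bidegree_X_hol i).mul (bidegree_X_antihol i)

/-- The sesquilinear polynomial `∑ Hᵢⱼ zⱼ z̄ᵢ`. -/
noncomputable def hermitianPoly (H : Fin n → Fin n → ℂ) : MvPolynomial (Vars n) ℂ :=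
  ∑ i, ∑ j, C (H i j) * (X (Sum.inl j) * X (Sum.inr (Sum.inl i)))

theorem bidegree_hermitianPoly (H : Fin n → Fin n → ℂ) :
    (hermitianPoly H).IsWeightedHomogeneous bidegree (1, 1) :=
  bidegree_sum _ fun i _ => bidegree_sum _ fun j _ => bidegree_C_mul _ <| by
    simpa using (bidegree_X_hol j).mul (bidegree_X_antihol i)

theorem laplacian_hermitianPoly (H : Fin n → Fin n → ℂ) :
    laplacian (hermitianPoly H) = C (∑ i, H i i) := by
  classical
  rw [laplacian_apply, map_sum]
  refine Finset.sum_congr rfl fun α _ => ?_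
  simp [hermitianPoly, pderiv_X, Pi.single_apply]

theorem laplacian_C (c : ℂ) : laplacian (C c : MvPolynomial (Vars n) ℂ) = 0 := by
  simp [laplacian_apply]

/-- With `τ` the trace of `H`, the hypothesis reads `(n + 2) H + τ ‖z‖² = 0`. A second Laplacian
gives `(2 n + 2) τ = 0`, whence `τ = 0` and then `H = 0`. -/
theorem hermitianPoly_eq_zero {H : Fin n → Fin n → ℂ}
    (h : laplacian (normSq n * hermitianPoly H) = 0) : hermitianPoly H = 0 := by
  have h1 := h
  rw [laplacian_normSq_mul (bidegree_hermitianPoly H), laplacian_hermitianPoly] at h1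
  have h2 := congrArg laplacian h1
  have hC : (C (∑ i, H i i) : MvPolynomial (Vars n) ℂ).IsWeightedHomogeneous bidegree (0, 0) :=
    isWeightedHomogeneous_C _ _
  rw [map_add, map_nsmul, laplacian_hermitianPoly, laplacian_normSq_mul hC, laplacian_C, mul_zero,
    add_zero, map_zero, ← add_smul, smul_eq_zero] at h2
  rcases h2 with h2 | h2
  · omega
  · rw [h2, mul_zero, add_zero, smul_eq_zero] at h1
    exact h1.resolve_left (by omega)

/-- The linear polynomial `∑ aᵢ zᵢ`. -/
noncomputable def linearPoly (a : Fin n → ℂ) : MvPolynomial (Vars n) ℂ :=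
  ∑ i, C (a i) * X (Sum.inl i)

theorem bidegree_linearPoly (a : Fin n → ℂ) :
    (linearPoly a).IsWeightedHomogeneous bidegree (1, 0) :=
  bidegree_sum _ fun i _ => bidegree_C_mul _ (bidegree_X_hol i)

theorem laplacian_linearPoly (a : Fin n → ℂ) : laplacian (linearPoly a) = 0 := by
  simp [laplacian_apply, linearPoly, pderiv_X]

/-- The double Laplacian of `‖z‖⁴ L` is `(2 n + 4) (n + 1) L`, because a linear form in `z` is
harmonic. -/
theorem linearPoly_eq_zero {a : Fin n → ℂ}
    (h : laplacian (laplacian (normSq n * (normSq n * linearPoly a))) = 0) : linearPoly a = 0 := by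
  have h0 := laplacian_normSq_mul (bidegree_linearPoly a)
  rw [laplacian_linearPoly, mul_zero, add_zero] at h0
  have h1 : (normSq n * linearPoly a).IsWeightedHomogeneous bidegree (2, 1) := by
    simpa using bidegree_normSq.mul (bidegree_linearPoly a)
  rw [laplacian_normSq_mul h1, map_add, h0, mul_smul_comm, map_nsmul, map_nsmul, h0, ← add_smul,
    smul_smul, smul_eq_zero] at h
  refine h.resolve_left ?_
  positivity

theorem eq_zero_of_linearPoly_eq_zero {a : Fin n → ℂ} (h : linearPoly a = 0) : a = 0 := by
  classical
  ext i
  have := congrArg (pderiv (Sum.inl i)) h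
  simpa [linearPoly, pderiv_X, Pi.single_apply] using this

end BoundaryJets

/-! ### Nonnegative trace-free polynomials of bidegree `(2, 2)`, treated by finite averages. -/

namespace BoundaryJets

open Filter MvPolynomial

variable {n : ℕ}

/-- The polynomial `∑ T_{αβγδ} z_α z_β z̄_γ z̄_δ`. -/
noncomputable def tensorPoly (T : Fin n → Fin n → Fin n → Fin n → ℂ) : MvPolynomial (Vars n) ℂ :=
  ∑ α, ∑ β, ∑ γ, ∑ δ, C (T α β γ δ) *
    (X (Sum.inl α) * X (Sum.inl β) * X (Sum.inr (Sum.inl γ)) * X (Sum.inr (Sum.inl δ)))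

theorem exists_eq_add_single {ι : Type*} (e : Fin n → ι) {m : ι →₀ ℕ}
    (h : ∑ i, m (e i) ≠ 0) : ∃ α m', m = Finsupp.single (e α) 1 + m' := by
  obtain ⟨α, -, hα⟩ := Finset.exists_ne_zero_of_sum_ne_zero h
  refine ⟨α, m - Finsupp.single (e α) 1, ?_⟩
  rw [add_tsub_cancel_of_le]
  rw [Finsupp.single_le_iff]
  omega

theorem exists_tensor_monomial {m : Vars n →₀ ℕ} (h1 : ∑ i : Fin n, m (Sum.inl i) = 2)
    (h2 : ∑ i : Fin n, m (Sum.inr (Sum.inl i)) = 2) (h3 : m (Sum.inr (Sum.inr ())) = 0) :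
    ∃ α β γ δ, (monomial m 1 : MvPolynomial (Vars n) ℂ) =
      X (Sum.inl α) * X (Sum.inl β) * X (Sum.inr (Sum.inl γ)) * X (Sum.inr (Sum.inl δ)) := by
  classical
  obtain ⟨α, m, rfl⟩ := exists_eq_add_single (n := n) Sum.inl (m := m)
    (by rw [h1]; norm_num)
  simp [Finset.sum_add_distrib, Finsupp.single_apply] at h1 h2 h3
  obtain ⟨β, m, rfl⟩ := exists_eq_add_single (n := n) Sum.inl (m := m)
    (by omega)
  simp [Finset.sum_add_distrib, Finsupp.single_apply] at h1 h2 h3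
  obtain ⟨γ, m, rfl⟩ := exists_eq_add_single (n := n)
    (fun i => Sum.inr (Sum.inl i)) (m := m) (by omega)
  simp [Finset.sum_add_distrib, Finsupp.single_apply] at h1 h2 h3
  obtain ⟨δ, m, rfl⟩ := exists_eq_add_single (n := n)
    (fun i => Sum.inr (Sum.inl i)) (m := m) (by omega)
  simp [Finset.sum_add_distrib, Finsupp.single_apply] at h1 h2 h3
  have hm : m = 0 := by
    ext v
    rcases v with i | i | i
    · exact (Finset.sum_eq_zero_iff.1 (show ∑ i : Fin n, m (Sum.inl i) = 0 by omega)) i (Finset.mem_univ i)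
    · exact (Finset.sum_eq_zero_iff.1 (show ∑ i : Fin n, m (Sum.inr (Sum.inl i)) = 0 by omega)) i
        (Finset.mem_univ i)
    · exact h3
  refine ⟨α, β, γ, δ, ?_⟩
  simp [hm, X, monomial_mul, add_assoc]

theorem exists_tensor {Q : MvPolynomial (Vars n) ℂ}
    (hQ : ∀ m ∈ Q.support, ∑ i : Fin n, m (Sum.inl i) = 2 ∧
      ∑ i : Fin n, m (Sum.inr (Sum.inl i)) = 2 ∧ m (Sum.inr (Sum.inr ())) = 0) :
    ∃ T, Q = tensorPoly T := by
  classical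
  have hzero : tensorPoly (0 : Fin n → Fin n → Fin n → Fin n → ℂ) = 0 := by simp [tensorPoly]
  have hadd : ∀ T T' : Fin n → Fin n → Fin n → Fin n → ℂ,
      tensorPoly (T + T') = tensorPoly T + tensorPoly T' := by
    intro T T'
    simp [tensorPoly, add_mul, Finset.sum_add_distrib]
  have hmon : ∀ m ∈ Q.support, ∃ T, monomial m (coeff m Q) = tensorPoly T := by
    intro m hm
    obtain ⟨h1, h2, h3⟩ := hQ m hm
    obtain ⟨α, β, γ, δ, h⟩ := exists_tensor_monomial h1 h2 h3
    refine ⟨fun a b c d => if a = α then if b = β then if c = γ then if d = δ then coeff m Q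
      else 0 else 0 else 0 else 0, ?_⟩
    have : monomial m (coeff m Q) = C (coeff m Q) * monomial m 1 := by
      rw [C_mul_monomial, mul_one]
    rw [this, h, tensorPoly]
    simp only [apply_ite C, map_zero, ite_mul, zero_mul, Finset.sum_ite_irrel, Finset.sum_const_zero,
      Finset.sum_ite_eq', Finset.mem_univ, if_true]
  rw [Q.as_sum]
  refine Finset.sum_induction _ (fun P => ∃ T, P = tensorPoly T) ?_ ⟨0, hzero.symm⟩ hmon
  rintro _ _ ⟨T, rfl⟩ ⟨T', rfl⟩
  exact ⟨T + T', (hadd T T').symm⟩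

theorem evalAt_tensorPoly (T : Fin n → Fin n → Fin n → Fin n → ℂ) (x : Param n) :
    evalAt x (tensorPoly T) = ∑ α, ∑ β, ∑ γ, ∑ δ, T α β γ δ *
      (x.1 α * x.1 β * (starRingEnd ℂ) (x.1 γ) * (starRingEnd ℂ) (x.1 δ)) := by
  simp [evalAt, tensorPoly]

/-- The Kronecker symbol. -/
noncomputable def kron (i j : Fin n) : ℂ := if i = j then 1 else 0

theorem evalAt_laplacian_tensorPoly (T : Fin n → Fin n → Fin n → Fin n → ℂ) (x : Param n) :
    evalAt x (laplacian (tensorPoly T)) = ∑ κ, ∑ α, ∑ β, ∑ γ, ∑ δ, T α β γ δ *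
      ((kron κ α * x.1 β + kron κ β * x.1 α) *
        (kron κ γ * (starRingEnd ℂ) (x.1 δ) + kron κ δ * (starRingEnd ℂ) (x.1 γ))) := by
  classical
  rw [laplacian_apply, evalAt_sum]
  refine Finset.sum_congr rfl fun κ _ => ?_
  simp only [evalAt, tensorPoly, map_sum, pderiv_mul, pderiv_C, pderiv_X, Pi.single_apply, map_mul,
    map_add, eval_C, eval_X, Sum.elim_inl, Sum.elim_inr]
  refine Finset.sum_congr rfl fun α _ => Finset.sum_congr rfl fun β _ =>
    Finset.sum_congr rfl fun γ _ => Finset.sum_congr rfl fun δ _ => ?_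
  have hk : ∀ i : Fin n, (if κ = i then (1 : ℂ) else 0) = kron κ i := fun i => rfl
  simp only [reduceCtorEq, if_false, Sum.inr.injEq, Sum.inl.injEq, map_zero, apply_ite (pderiv _),
    apply_ite (eval _), map_one, pderiv_one, ite_self, @eq_comm _ _ κ, hk]
  ring

/-- The point `(z + ζ e_κ, 0)`. -/
noncomputable def shiftPoint (z : EuclideanSpace ℂ (Fin n)) (κ : Fin n) (ζ : ℂ) : Param n :=
  (z + ζ • EuclideanSpace.single κ 1, 0)

theorem shiftPoint_apply (z : EuclideanSpace ℂ (Fin n)) (κ : Fin n) (ζ : ℂ) (i : Fin n) :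
    (shiftPoint z κ ζ).1 i = z i + ζ * kron κ i := by
  simp [shiftPoint, kron, @eq_comm _ κ i]

theorem conj_kron (i j : Fin n) : (starRingEnd ℂ) (kron i j) = kron i j := by
  unfold kron; split_ifs <;> simp

/-- A discrete mean value formula. Averaging over `ζ = ± r, ± r i` keeps only the monomials with
equally many factors `ζ` and `ζ̄`, since both exponents are at most two. The `r²` terms add up over
`κ` to the Laplacian, and the `r⁴` terms to the values at the unit vectors. -/
theorem sum_shiftPoint (T : Fin n → Fin n → Fin n → Fin n → ℂ) (z : EuclideanSpace ℂ (Fin n))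
    (r : ℝ) :
    ∑ κ, (evalAt (shiftPoint z κ r) (tensorPoly T) +
      evalAt (shiftPoint z κ (r * Complex.I)) (tensorPoly T) +
      evalAt (shiftPoint z κ (-r)) (tensorPoly T) +
      evalAt (shiftPoint z κ (-(r * Complex.I))) (tensorPoly T)) =
    4 * n * evalAt (z, 0) (tensorPoly T) + 4 * r ^ 2 * evalAt (z, 0) (laplacian (tensorPoly T)) +
      4 * r ^ 4 * ∑ κ, evalAt (shiftPoint 0 κ 1) (tensorPoly T) := by
  rw [evalAt_laplacian_tensorPoly]
  have hn : (4 * n * evalAt (z, 0) (tensorPoly T) : ℂ) =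
      ∑ _κ : Fin n, 4 * evalAt (z, 0) (tensorPoly T) := by
    simp; ring
  rw [hn, Finset.mul_sum, Finset.mul_sum, ← Finset.sum_add_distrib, ← Finset.sum_add_distrib]
  refine Finset.sum_congr rfl fun κ _ => ?_
  simp only [evalAt_tensorPoly, shiftPoint_apply, Finset.mul_sum, ← Finset.sum_add_distrib]
  refine Finset.sum_congr rfl fun α _ => Finset.sum_congr rfl fun β _ =>
    Finset.sum_congr rfl fun γ _ => Finset.sum_congr rfl fun δ _ => ?_
  simp only [map_add, map_mul, map_neg, conj_kron, Complex.conj_I, Complex.conj_ofReal,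
    PiLp.zero_apply, map_zero, map_one]
  have hI : Complex.I ^ 2 = -1 := Complex.I_sq
  have hI4 : Complex.I ^ 4 = 1 := Complex.I_pow_four
  ring_nf
  simp only [hI, hI4]
  ring

/-- The `4`-th root of unity `i ^ a`. -/
noncomputable def unitRoot (a : ZMod 4) : ℂ := Complex.I ^ a.val

theorem unitRoot_add_one (a : ZMod 4) : unitRoot (a + 1) = Complex.I * unitRoot a := by
  rw [unitRoot, unitRoot, ← pow_succ', ZMod.val_add, show (1 : ZMod 4).val = 1 from rfl,
    ← pow_eq_pow_mod _ Complex.I_pow_four]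

theorem unitRoot_mul_conj (a : ZMod 4) : unitRoot a * (starRingEnd ℂ) (unitRoot a) = 1 := by
  rw [Complex.mul_conj, unitRoot, Complex.normSq_eq_norm_sq]
  simp

/-- The shift permutes the summands while multiplying the total by `c ≠ 1`. -/
theorem sum_eq_zero_of_shift {f : (Fin n → ZMod 4) → ℂ} (κ : Fin n) {c : ℂ} (hc : c ≠ 1)
    (h : ∀ ε, f (ε + Pi.single κ 1) = c * f ε) : ∑ ε, f ε = 0 := by
  have h1 : ∑ ε, f (ε + Pi.single κ 1) = ∑ ε, f ε :=
    Fintype.sum_equiv (Equiv.addRight (Pi.single κ 1)) _ _ fun ε => rfl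
  simp_rw [h, ← Finset.mul_sum] at h1
  have h2 : (c - 1) * ∑ ε, f ε = 0 := by rw [sub_mul, h1, one_mul, sub_self]
  exact (mul_eq_zero.1 h2).resolve_left (sub_ne_zero.2 hc)

theorem unitRoot_shift (ε : Fin n → ZMod 4) (κ i : Fin n) :
    unitRoot ((ε + Pi.single κ 1 : Fin n → ZMod 4) i) = (if i = κ then Complex.I else 1) * unitRoot (ε i) := by
  rw [Pi.add_apply, Pi.single_apply]
  split_ifs
  · exact unitRoot_add_one _
  · simp

/-- Orthogonality of characters: the sum is nonzero only if `{α, β} = {γ, δ}` as multisets. The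
subtracted sum over `κ` corrects the double count when all four indices coincide. In the vanishing
cases, one shifts a coordinate whose net frequency is not divisible by four. -/
theorem sum_unitRoot (α β γ δ : Fin n) :
    ∑ ε : Fin n → ZMod 4, unitRoot (ε α) * unitRoot (ε β) * (starRingEnd ℂ) (unitRoot (ε γ)) *
      (starRingEnd ℂ) (unitRoot (ε δ)) = 4 ^ n * (kron α γ * kron β δ + kron α δ * kron β γ -
        ∑ κ, kron κ α * kron κ β * kron κ γ * kron κ δ) := by
  have hcard : ∑ _ε : Fin n → ZMod 4, (1 : ℂ) = 4 ^ n := by simp [ZMod.card]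
  have hall : ∑ κ, kron κ α * kron κ β * kron κ γ * kron κ δ =
      kron α β * kron α γ * kron α δ := by
    rw [Finset.sum_eq_single α]
    · simp [kron]
    · intro κ _ hκ
      simp [kron, hκ]
    · simp
  rw [hall]
  have hII : Complex.I * Complex.I = -1 := Complex.I_mul_I
  have hI1 : Complex.I ≠ 1 := fun h => by simpa using congrArg Complex.re h
  have hshift := fun κ ε => unitRoot_shift (n := n) ε κ
  by_cases h1 : α = γ
  · subst h1
    by_cases h2 : β = δ
    · subst h2
      rw [Finset.sum_congr rfl fun ε _ => show _ = (1 : ℂ) by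
        linear_combination (unitRoot (ε β) * (starRingEnd ℂ) (unitRoot (ε β))) *
          unitRoot_mul_conj (ε α) + unitRoot_mul_conj (ε β), hcard]
      by_cases h3 : α = β
      · subst h3; simp [kron]
      · simp [kron, h3]
    · rw [sum_eq_zero_of_shift β hI1]
      · by_cases h3 : α = δ
        · subst h3
          simp [kron, h2, Ne.symm h2]
        · simp [kron, h2, h3]
      · intro ε
        simp only [hshift, Ne.symm h2, if_true, if_false]
        by_cases h3 : α = β
        · simp only [h3, if_true, map_mul, map_one, Complex.conj_I]
          linear_combination (-Complex.I * unitRoot (ε β) * unitRoot (ε β) *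
            (starRingEnd ℂ) (unitRoot (ε β)) * (starRingEnd ℂ) (unitRoot (ε δ))) * hII
        · simp only [h3, if_false]
          ring_nf
  · by_cases h2 : α = δ
    · subst h2
      by_cases h3 : β = γ
      · subst h3
        rw [Finset.sum_congr rfl fun ε _ => show _ = (1 : ℂ) by
          linear_combination (unitRoot (ε β) * (starRingEnd ℂ) (unitRoot (ε β))) *
            unitRoot_mul_conj (ε α) + unitRoot_mul_conj (ε β), hcard]
        simp [kron, h1]
      · rw [sum_eq_zero_of_shift β hI1]
        · simp [kron, h1, h3]
        · intro ε
          simp only [hshift, Ne.symm h3, if_true, if_false]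
          by_cases h4 : α = β
          · simp only [h4, if_true, map_mul, map_one, Complex.conj_I]
            linear_combination (-Complex.I * unitRoot (ε β) * unitRoot (ε β) *
              (starRingEnd ℂ) (unitRoot (ε γ)) * (starRingEnd ℂ) (unitRoot (ε β))) * hII
          · simp only [h4, if_false]
            ring_nf
    · rw [sum_eq_zero_of_shift α (c := Complex.I * if β = α then Complex.I else 1)]
      · simp [kron, h1, h2]
      · split_ifs
        · rw [hII]; norm_num
        · simpa using hI1
      · intro ε
        simp only [hshift, Ne.symm h1, Ne.symm h2, if_true, if_false]
        ring_nf

/-- The point all of whose coordinates are `4`-th roots of unity. -/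
noncomputable def torusPoint (ε : Fin n → ZMod 4) : Param n :=
  (WithLp.toLp 2 fun i => unitRoot (ε i), 0)

/-- Replaces integration over the sphere: both the sum over the torus points, corrected at the unit
vectors, and the sum of the Laplacian over the unit vectors compute the full double contraction of
`T`. -/
theorem sum_torusPoint (T : Fin n → Fin n → Fin n → Fin n → ℂ) :
    2 * ∑ ε : Fin n → ZMod 4, evalAt (torusPoint ε) (tensorPoly T) +
      2 * 4 ^ n * ∑ κ, evalAt (shiftPoint 0 κ 1) (tensorPoly T) =
    4 ^ n * ∑ κ, evalAt (shiftPoint 0 κ 1) (laplacian (tensorPoly T)) := by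
  have h1 : ∑ ε : Fin n → ZMod 4, evalAt (torusPoint ε) (tensorPoly T) =
      ∑ α, ∑ β, ∑ γ, ∑ δ, T α β γ δ * ∑ ε : Fin n → ZMod 4, (unitRoot (ε α) * unitRoot (ε β) *
        (starRingEnd ℂ) (unitRoot (ε γ)) * (starRingEnd ℂ) (unitRoot (ε δ))) := by
    simp only [evalAt_tensorPoly, torusPoint, Finset.mul_sum]
    rw [Finset.sum_comm]
    refine Finset.sum_congr rfl fun α _ => ?_
    rw [Finset.sum_comm]
    refine Finset.sum_congr rfl fun β _ => ?_
    rw [Finset.sum_comm]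
    refine Finset.sum_congr rfl fun γ _ => ?_
    rw [Finset.sum_comm]
  have h2 : ∑ κ, evalAt (shiftPoint 0 κ 1) (tensorPoly T) =
      ∑ α, ∑ β, ∑ γ, ∑ δ, T α β γ δ * ∑ κ, kron κ α * kron κ β * kron κ γ * kron κ δ := by
    simp only [evalAt_tensorPoly, shiftPoint_apply, Finset.mul_sum, PiLp.zero_apply, zero_add,
      one_mul, conj_kron]
    rw [Finset.sum_comm]
    refine Finset.sum_congr rfl fun α _ => ?_
    rw [Finset.sum_comm]
    refine Finset.sum_congr rfl fun β _ => ?_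
    rw [Finset.sum_comm]
    refine Finset.sum_congr rfl fun γ _ => ?_
    rw [Finset.sum_comm]
  have hkk : ∀ i j : Fin n, ∑ κ, kron κ i * kron κ j = kron i j := by
    intro i j
    rw [Finset.sum_eq_single i]
    · simp [kron]
    · intro κ _ hκ
      simp [kron, hκ]
    · simp
  have h3 : ∑ κ, evalAt (shiftPoint 0 κ 1) (laplacian (tensorPoly T)) =
      ∑ α, ∑ β, ∑ γ, ∑ δ, T α β γ δ * (2 * (kron α γ * kron β δ + kron α δ * kron β γ)) := by
    have h : ∀ α β γ δ : Fin n, 2 * (kron α γ * kron β δ + kron α δ * kron β γ) =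
        ∑ κ, ∑ κ', (kron κ' α * kron κ β + kron κ' β * kron κ α) *
          (kron κ' γ * kron κ δ + kron κ' δ * kron κ γ) := by
      intro α β γ δ
      simp only [← hkk α γ, ← hkk β δ, ← hkk α δ, ← hkk β γ, Finset.sum_mul_sum]
      rw [← Finset.sum_add_distrib]
      simp only [← Finset.sum_add_distrib]
      rw [two_mul]
      nth_rewrite 2 [Finset.sum_comm]
      simp only [← Finset.sum_add_distrib]
      refine Finset.sum_congr rfl fun κ _ => Finset.sum_congr rfl fun κ' _ => ?_
      ring
    simp only [evalAt_laplacian_tensorPoly, shiftPoint_apply, PiLp.zero_apply, zero_add,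
      one_mul, conj_kron, h, Finset.mul_sum]
    rw [Finset.sum_congr rfl fun κ _ => Finset.sum_comm, Finset.sum_comm]
    refine Finset.sum_congr rfl fun α _ => ?_
    rw [Finset.sum_congr rfl fun κ _ => Finset.sum_comm, Finset.sum_comm]
    refine Finset.sum_congr rfl fun β _ => ?_
    rw [Finset.sum_congr rfl fun κ _ => Finset.sum_comm, Finset.sum_comm]
    refine Finset.sum_congr rfl fun γ _ => ?_
    rw [Finset.sum_congr rfl fun κ _ => Finset.sum_comm, Finset.sum_comm]
  rw [h1, h2, h3]
  simp only [Finset.mul_sum, ← Finset.sum_add_distrib, sum_unitRoot]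
  refine Finset.sum_congr rfl fun α _ => Finset.sum_congr rfl fun β _ =>
    Finset.sum_congr rfl fun γ _ => Finset.sum_congr rfl fun δ _ => ?_
  simp only [← Finset.mul_sum]
  ring

/-- A nonnegative trace-free polynomial of bidegree `(2, 2)` vanishes. -/
theorem re_evalAt_eq_zero_of_laplacian_eq_zero {Q : MvPolynomial (Vars n) ℂ}
    (hQ : ∀ m ∈ Q.support, ∑ i : Fin n, m (Sum.inl i) = 2 ∧
      ∑ i : Fin n, m (Sum.inr (Sum.inl i)) = 2 ∧ m (Sum.inr (Sum.inr ())) = 0)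
    (hlap : laplacian Q = 0) (hpos : ∀ z : EuclideanSpace ℂ (Fin n), 0 ≤ (evalAt (z, 0) Q).re)
    (z : EuclideanSpace ℂ (Fin n)) : (evalAt (z, 0) Q).re = 0 := by
  classical
  obtain ⟨T, rfl⟩ := exists_tensor hQ
  have hl0 : ∀ x : Param n, evalAt x (laplacian (tensorPoly T)) = 0 := by
    simp [hlap, evalAt]
  have hp : ∀ z κ ζ, 0 ≤ (evalAt (shiftPoint z κ ζ) (tensorPoly T)).re := fun z κ ζ => hpos _
  -- Trace-freeness makes the right-hand side of `sum_torusPoint` zero. The left-hand side is a sum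
  -- of nonnegative terms, so the polynomial vanishes at every unit vector.
  have hunit : ∀ κ, (evalAt (shiftPoint 0 κ 1) (tensorPoly T)).re = 0 := by
    have h := congrArg Complex.re (sum_torusPoint T)
    simp only [hl0, Finset.sum_const_zero, mul_zero, Complex.zero_re, Complex.add_re] at h
    have h4 : (2 * 4 ^ n : ℂ) = ((2 * 4 ^ n : ℝ) : ℂ) := by push_cast; ring
    rw [h4, Complex.re_ofReal_mul, show (2 : ℂ) = ((2 : ℝ) : ℂ) by norm_num, Complex.re_ofReal_mul,
      Complex.re_sum, Complex.re_sum] at h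
    have h5 : 0 ≤ ∑ ε : Fin n → ZMod 4, (evalAt (torusPoint ε) (tensorPoly T)).re :=
      Finset.sum_nonneg fun ε _ => hpos _
    have h6 : 0 ≤ ∑ κ, (evalAt (shiftPoint 0 κ 1) (tensorPoly T)).re :=
      Finset.sum_nonneg fun κ _ => hp _ _ _
    have h7 : ∑ κ, (evalAt (shiftPoint 0 κ 1) (tensorPoly T)).re = 0 := by
      have : (0 : ℝ) < 4 ^ n := by positivity
      nlinarith
    intro κ
    exact (Finset.sum_eq_zero_iff_of_nonneg fun κ _ => hp 0 κ 1).1 h7 κ (Finset.mem_univ κ)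
  -- If the polynomial vanishes at `z`, the right-hand side of `sum_shiftPoint` is zero, so each
  -- nonnegative summand on the left vanishes: the zero set is stable under real and imaginary moves
  -- along every coordinate axis.
  have hmove : ∀ z, (evalAt (z, 0) (tensorPoly T)).re = 0 → ∀ (r : ℝ) κ,
      (evalAt (shiftPoint z κ r) (tensorPoly T)).re = 0 ∧
      (evalAt (shiftPoint z κ (r * Complex.I)) (tensorPoly T)).re = 0 := by
    intro z hz r κ
    have h := congrArg Complex.re (sum_shiftPoint T z r)
    have h4 : (4 * n : ℂ) = ((4 * n : ℝ) : ℂ) := by push_cast; ring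
    have h5 : (4 * r ^ 4 : ℂ) = ((4 * r ^ 4 : ℝ) : ℂ) := by push_cast; ring
    rw [hl0, mul_zero, add_zero, h4, h5, Complex.add_re, Complex.re_ofReal_mul,
      Complex.re_ofReal_mul, hz, mul_zero, zero_add, Complex.re_sum, Complex.re_sum,
      Finset.sum_eq_zero fun κ _ => hunit κ, mul_zero, Finset.sum_eq_zero_iff_of_nonneg] at h
    · have := h κ (Finset.mem_univ κ)
      simp only [Complex.add_re] at this
      have h1 := hp z κ r
      have h2 := hp z κ (r * Complex.I)
      have h3 := hp z κ (-r)
      have h4 := hp z κ (-(r * Complex.I))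
      constructor <;> linarith
    · intro κ _
      simp only [Complex.add_re]
      have h1 := hp z κ r
      have h2 := hp z κ (r * Complex.I)
      have h3 := hp z κ (-r)
      have h4 := hp z κ (-(r * Complex.I))
      linarith
  -- Every point is reached from the origin one coordinate at a time, by a real and then an
  -- imaginary move.
  have hsum : ∀ s : Finset (Fin n),
      (evalAt (∑ κ ∈ s, z κ • EuclideanSpace.single κ 1, 0) (tensorPoly T)).re = 0 := by
    intro s
    induction s using Finset.induction_on with
    | empty => simp [evalAt_tensorPoly]
    | insert κ s hκ ih =>
      have h1 := (hmove _ ih (z κ).re κ).1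
      have h2 := (hmove _ h1 (z κ).im κ).2
      rw [Finset.sum_insert hκ]
      convert h2 using 3
      rw [shiftPoint]
      congr 1
      conv_lhs => rw [← Complex.re_add_im (z κ)]
      rw [add_smul]
      abel
  have := hsum Finset.univ
  convert this using 4
  ext i
  simp [Finset.sum_apply, Pi.single_apply]

end BoundaryJets

/-! ### One-sided holomorphic expansions and jets of normal forms. -/

namespace BoundaryJets

open Asymptotics Filter MvPolynomial

variable {n : ℕ}

section HolomorphicTaylor

theorem multilinear_expansion {E F : Type*} [AddCommGroup E] [Module ℂ E] [AddCommGroup F]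
    [Module ℂ F] {j : ℕ} (L : MultilinearMap ℂ (fun _ : Fin j => E) F) (p q : E) :
    ∃ W : ℕ → F, ∀ ζ τ : ℂ, L (fun _ => ζ • p + τ • q) =
      ∑ a ∈ Finset.range (j + 1), (ζ ^ a * τ ^ (j - a)) • W a := by
  classical
  refine ⟨fun a => ∑ s : Finset (Fin j) with s.card = a,
    L (s.piecewise (fun _ => p) fun _ => q), fun ζ τ => ?_⟩
  have h1 := L.map_add_univ (fun _ => ζ • p) (fun _ => τ • q)
  have h2 : (fun _ : Fin j => ζ • p + τ • q) = (fun _ => ζ • p) + fun _ => τ • q := rfl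
  rw [h2, h1, ← Finset.sum_fiberwise_of_maps_to (s := Finset.univ)
    (t := Finset.range (j + 1)) (g := Finset.card)
    (fun s _ => Finset.mem_range.2 (Nat.lt_succ_of_le (by simpa using s.card_le_univ)))]
  refine Finset.sum_congr rfl fun a _ => ?_
  rw [Finset.smul_sum]
  refine Finset.sum_congr rfl fun s hs => ?_
  have hs' : s.card = a := (Finset.mem_filter.1 hs).2
  have h3 : s.piecewise (fun _ => ζ • p) (fun _ => τ • q) =
      fun i => (s.piecewise (fun _ => ζ) (fun _ => τ) i) •
        (s.piecewise (fun _ => p) (fun _ => q) i) := by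
    ext i
    by_cases hi : i ∈ s <;> simp [hi]
  rw [h3, L.map_smul_univ, Finset.prod_piecewise]
  simp only [Finset.prod_const, Finset.univ_inter]
  rw [hs', ← Finset.compl_eq_univ_sdiff, Finset.card_compl, Fintype.card_fin, hs']

theorem isBigO_pow_mul_pow {l : Filter ℝ} (hl : l ≤ 𝓝 0) {ζ τ : ℝ → ℂ}
    (hζ : ζ =O[l] fun t => t) (hτ : τ =O[l] fun t => t ^ 2) {a b k : ℕ} (h : k ≤ a + 2 * b) :
    (fun t => ζ t ^ a * τ t ^ b) =O[l] fun t => t ^ k := by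
  refine ((hζ.pow a).mul (hτ.pow b)).trans ?_
  refine IsBigO.of_bound 1 ?_
  have h1 : ∀ᶠ t : ℝ in l, |t| < 1 := hl (by
    have := (continuous_abs (G := ℝ)).tendsto 0
    rw [abs_zero] at this
    exact this.eventually_lt_const one_pos)
  filter_upwards [h1] with t ht
  rw [one_mul, ← pow_mul, ← pow_add, norm_pow, norm_pow, Real.norm_eq_abs]
  exact pow_le_pow_of_le_one (abs_nonneg t) ht.le h

/-- The expansion, up to weight five, of a map of order three which is holomorphic on a set
accumulating at `0`, along a complex line in the directions of `z`. -/
theorem holomorphic_expansion {R : Space n → Space n} {O : Set (Space n)} (hO : IsOpen O)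
    (h0 : (0 : Space n) ∈ closure O) (hR : ContDiffAt ℝ ∞ R 0) (hRO : DifferentiableOn ℂ R O)
    (hord : IsBigO 3 R) (z : EuclideanSpace ℂ (Fin n)) :
    ∃ V₃₀ V₄₀ V₅₀ V₂₁ V₃₁ V₁₂ : Space n, ∀ (l : Filter ℝ) (ζ τ : ℝ → ℂ), l ≤ 𝓝 0 →
      (ζ =O[l] fun t => t) → (τ =O[l] fun t => t ^ 2) →
      (fun t => R (ζ t • z, τ t) - (ζ t ^ 3 • V₃₀ + ζ t ^ 4 • V₄₀ + ζ t ^ 5 • V₅₀ +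
        (ζ t ^ 2 * τ t) • V₂₁ + (ζ t ^ 3 * τ t) • V₃₁ + (ζ t * τ t ^ 2) • V₁₂)) =O[l]
        fun t => t ^ 6 := by
  -- The real derivatives at `0`, regarded as complex multilinear maps. This is what allows the
  -- complex scalars `ζ`, `τ` to be pulled out, so that no conjugates of them appear.
  set L : ∀ j : ℕ, MultilinearMap ℂ (fun _ : Fin j => Space n) (Space n) := fun j =>
    { toFun := fun m => iteratedFDeriv ℝ j R 0 m
      map_update_add' := by
        intro _ m i x y
        convert! (iteratedFDeriv ℝ j R 0).toMultilinearMap.map_update_add m i x y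
      map_update_smul' := by
        intro _ m i c x
        convert! iteratedFDeriv_map_update_smul hO h0 hRO hR j m i c x } with hL
  choose W hW using fun j => multilinear_expansion (L j) ((z, 0) : Space n) ((0, 1) : Space n)
  -- `W j a` is the coefficient of `ζ ^ a τ ^ (j - a)` in the derivative of order `j`, divided here
  -- by `j!`. The retained terms are those with `3 ≤ j ≤ 5` and weight `a + 2 (j - a) ≤ 5`. They
  -- depend on `z` alone, so the same vectors serve all curves `ζ`, `τ`.
  refine ⟨(1 / 6 : ℝ) • W 3 3, (1 / 24 : ℝ) • W 4 4, (1 / 120 : ℝ) • W 5 5, (1 / 6 : ℝ) • W 3 2,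
    (1 / 24 : ℝ) • W 4 3, (1 / 6 : ℝ) • W 3 1, fun l ζ τ hl hζ hτ => ?_⟩
  have htaylor := taylor_isBigO 5 (by exact_mod_cast contDiffAt_infty.1 hR 6)
  have hXeq : ∀ t, ((ζ t • z, τ t) : Space n) = ζ t • ((z, 0) : Space n) + τ t • (0, 1) := by
    intro t; simp
  have hτ1 : τ =O[l] fun t => t := by
    have := isBigO_pow_mul_pow hl hζ hτ (a := 0) (b := 1) (k := 1) (by norm_num)
    simpa using this
  have hX : (fun t => ((ζ t • z, τ t) : Space n)) =O[l] fun t => t := by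
    simp only [hXeq]
    have h1 := hζ.smul (isBigO_refl (fun _ : ℝ => ((z, 0) : Space n)) l)
    have h2 := hτ1.smul (isBigO_refl (fun _ : ℝ => ((0, 1) : Space n)) l)
    have h3 : ∀ v : Space n, (fun t : ℝ => t • v) =O[l] fun t => t := fun v =>
      IsBigO.of_bound ‖v‖ (Eventually.of_forall fun t => by rw [norm_smul, mul_comm])
    exact (h1.trans (h3 _)).add (h2.trans (h3 _))
  have hid : Tendsto (fun t : ℝ => t) l (𝓝 0) := hl
  have hX0 : Tendsto (fun t => ((ζ t • z, τ t) : Space n)) l (𝓝 0) := hX.trans_tendsto hid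
  have h1 := (htaylor.comp_tendsto hX0).trans
    ((hX.norm_left.pow 6 : (fun t => ‖((ζ t • z, τ t) : Space n)‖ ^ (5 + 1)) =O[l] fun t => t ^ 6))
  have hterm : ∀ (a b : ℕ) (v : Space n), 6 ≤ a + 2 * b →
      (fun t => (ζ t ^ a * τ t ^ b) • v) =O[l] fun t => t ^ 6 := by
    intro a b v h
    refine ((isBigO_pow_mul_pow hl hζ hτ h).smul (isBigO_refl (fun _ : ℝ => v) l)).trans ?_
    exact IsBigO.of_bound ‖v‖ (Eventually.of_forall fun t => by rw [norm_smul, mul_comm])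
  -- All remaining terms of degree three to five have weight at least six and are absorbed into the
  -- error.
  have h2 := (((((h1.add (hterm 0 3 ((1 / 6 : ℝ) • W 3 0) (by norm_num))).add
    (hterm 2 2 ((1 / 24 : ℝ) • W 4 2) (by norm_num))).add
    (hterm 1 3 ((1 / 24 : ℝ) • W 4 1) (by norm_num))).add
    (hterm 0 4 ((1 / 24 : ℝ) • W 4 0) (by norm_num))).add
    (((hterm 4 1 ((1 / 120 : ℝ) • W 5 4) (by norm_num)).add
    (hterm 3 2 ((1 / 120 : ℝ) • W 5 3) (by norm_num))).add
    (hterm 2 3 ((1 / 120 : ℝ) • W 5 2) (by norm_num)))).add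
    ((hterm 1 4 ((1 / 120 : ℝ) • W 5 1) (by norm_num)).add
    (hterm 0 5 ((1 / 120 : ℝ) • W 5 0) (by norm_num)))
  refine h2.congr_left fun t => ?_
  have hW' : ∀ j, iteratedFDeriv ℝ j R 0 (fun _ => ((ζ t • z, τ t) : Space n)) =
      ∑ a ∈ Finset.range (j + 1), (ζ t ^ a * τ t ^ (j - a)) • W j a := by
    intro j
    rw [← hW j (ζ t) (τ t), hXeq]
    rfl
  have hz : ∀ j < 3, iteratedFDeriv ℝ j R 0 (fun _ => ((ζ t • z, τ t) : Space n)) = 0 := by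
    intro j hj
    rw [hord j hj]
    simp
  simp only [Function.comp, Finset.sum_range_succ (n := 5), Finset.sum_range_succ (n := 4),
    Finset.sum_range_succ (n := 3), Finset.sum_range_succ (n := 2), Finset.sum_range_succ (n := 1),
    Finset.sum_range_one, hz 0 (by norm_num), hz 1 (by norm_num), hz 2 (by norm_num), hW' 3, hW' 4,
    hW' 5, Nat.factorial, smul_zero, zero_add, Nat.reduceSub, Nat.reduceAdd,
    pow_zero, mul_one, one_mul, pow_one, one_div]
  module

end HolomorphicTaylor

section Jets

/-- The part of weight at most five of the Taylor expansion of a function in normal form. -/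
structure IsNormalFormJet (φ : Param n → ℝ) (P₄ P₅ : MvPolynomial (Vars n) ℂ) : Prop where
  smooth : ContDiffAt ℝ ∞ φ 0
  approx : Approx 5 (fun x => (φ x : ℂ)) (P₄ + P₅)
  supp₄ : ∀ m ∈ P₄.support, ∑ i : Fin n, m (Sum.inl i) = 2 ∧
    ∑ i : Fin n, m (Sum.inr (Sum.inl i)) = 2 ∧ m (Sum.inr (Sum.inr ())) = 0
  supp₅ : ∀ m ∈ P₅.support, (∑ i : Fin n, m (Sum.inl i) = 3 ∧
    ∑ i : Fin n, m (Sum.inr (Sum.inl i)) = 2 ∨ ∑ i : Fin n, m (Sum.inl i) = 2 ∧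
    ∑ i : Fin n, m (Sum.inr (Sum.inl i)) = 3) ∧ m (Sum.inr (Sum.inr ())) = 0
  trace₄ : laplacian P₄ = 0
  trace₅ : laplacian (laplacian (bidegreePart 3 2 P₅)) = 0

theorem HasNormalForm.contDiffAt {N : ℕ∞} {D : Set (Space n)} {φ : Param n → ℝ}
    (h : HasNormalForm N D φ) : ContDiffAt ℝ ∞ φ 0 := by
  obtain ⟨⟨V, hV, h0, hφ⟩, -, -⟩ := h
  exact hφ.contDiffAt (hV.mem_nhds h0)

/-- With degree at least two in both `z` and `z̄`, counting weights excludes weights below four,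
leaves only bidegree `(2, 2)` in weight four and `(3, 2)`, `(2, 3)` in weight five, and leaves no
room for `u`. The bound `5 ≤ N` provides the trace conditions in these two weights. -/
theorem HasNormalForm.exists_jet {N : ℕ∞} (hN : 5 ≤ N) {D : Set (Space n)} {φ : Param n → ℝ}
    (h : HasNormalForm N D φ) : ∃ P₄ P₅, IsNormalFormJet φ P₄ P₅ := by
  obtain ⟨P, hhom, heval, hsupp, htr⟩ := h.2.2
  have hw : ∀ μ, ∀ m ∈ (P μ).support, (∑ i : Fin n, m (Sum.inl i)) +
      ((∑ i : Fin n, m (Sum.inr (Sum.inl i))) + m (Sum.inr (Sum.inr ())) * 2) = μ := by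
    intro μ m hm
    rw [← weight_weight, hhom μ (mem_support_iff.1 hm)]
  have hzero : ∀ μ < 4, P μ = 0 := by
    intro μ hμ
    rw [← support_eq_empty, Finset.eq_empty_iff_forall_notMem]
    intro m hm
    have h1 := hw μ m hm
    have h2 := hsupp μ m hm
    omega
  have h4 : ∀ m ∈ (P 4).support, ∑ i : Fin n, m (Sum.inl i) = 2 ∧
      ∑ i : Fin n, m (Sum.inr (Sum.inl i)) = 2 ∧ m (Sum.inr (Sum.inr ())) = 0 := by
    intro m hm
    have h1 := hw 4 m hm
    have h2 := hsupp 4 m hm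
    omega
  have h44 : bidegreePart 2 2 (P 4) = P 4 := by
    refine IsWeightedHomogeneous.weightedHomogeneousComponent_same ?_
    intro m hm
    obtain ⟨h1, h2, -⟩ := h4 m (mem_support_iff.2 hm)
    rw [weight_bidegree, weight_holDegree, weight_antiholDegree, h1, h2]
  have hN4 : ((4 : ℕ) : ℕ∞) ≤ N := le_trans (by norm_num) hN
  refine ⟨P 4, P 5, h.contDiffAt, ?_, h4, ?_, ?_, ?_⟩
  · have := approx_of_weightedPart (k := 5) h.contDiffAt fun μ _ x => heval μ x
    simpa [Finset.sum_range_succ, hzero] using this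
  · intro m hm
    have h1 := hw 5 m hm
    have h2 := hsupp 5 m hm
    omega
  · have := (htr 4 hN4).1
    rwa [trace_eq_zero_iff two_ne_zero two_ne_zero, h44] at this
  · have := (htr 5 (by exact_mod_cast hN)).2.1
    rwa [trace_trace_eq_zero_iff two_ne_zero one_ne_zero three_ne_zero two_ne_zero] at this

theorem evalAt_eq_of_support {P : MvPolynomial (Vars n) ℂ}
    (hP : ∀ m ∈ P.support, m (Sum.inr (Sum.inr ())) = 0) (z : EuclideanSpace ℂ (Fin n))
    (u u' : ℝ) : evalAt (z, u) P = evalAt (z, u') P := by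
  rw [evalAt_eq, evalAt_eq, eval_eq', eval_eq']
  refine Finset.sum_congr rfl fun m hm => ?_
  congr 1
  refine Finset.prod_congr rfl fun v _ => ?_
  rcases v with i | i | i
  · rfl
  · rfl
  · rw [show m (Sum.inr (Sum.inr i)) = 0 from hP m hm, pow_zero, pow_zero]

theorem evalAt_rotate {j k : ℕ} {P : MvPolynomial (Vars n) ℂ}
    (hP : P.IsWeightedHomogeneous bidegree (j, k)) (η : ℂ) (z : EuclideanSpace ℂ (Fin n)) (u : ℝ) :
    evalAt (η • z, u) P = η ^ j * (starRingEnd ℂ) η ^ k * evalAt (z, u) P := by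
  rw [evalAt_eq, evalAt_eq, eval_eq', eval_eq', Finset.mul_sum]
  refine Finset.sum_congr rfl fun m hm => ?_
  have h := hP (mem_support_iff.1 hm)
  rw [weight_bidegree, Prod.mk.injEq, weight_holDegree, weight_antiholDegree] at h
  rw [← h.1, ← h.2, ← Finset.prod_pow_eq_pow_sum, ← Finset.prod_pow_eq_pow_sum]
  simp only [Fintype.prod_sum_type, varValue, Sum.elim_inl, Sum.elim_inr, PiLp.smul_apply,
    smul_eq_mul, mul_pow, map_mul, Finset.prod_mul_distrib]
  ring

end Jets

end BoundaryJets

/-! ### Boundary points, defining functions and the nonnegativity of the pulled-back defining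
function. -/

namespace BoundaryJets

open Asymptotics Filter MvPolynomial

variable {n : ℕ}

theorem IsNormalFormJet.isBigO {φ : Param n → ℝ} {P₄ P₅ : MvPolynomial (Vars n) ℂ}
    (h : IsNormalFormJet φ P₄ P₅) : φ =O[𝓝 0] fun x => gauge x ^ 4 := by
  have h4 : P₄ ∈ orderIdeal weight 4 := fun m hm => by
    have := h.supp₄ m (mem_support_iff.2 hm)
    rw [weight_weight]
    omega
  have h5 : P₅ ∈ orderIdeal weight 4 := fun m hm => by
    have := h.supp₅ m (mem_support_iff.2 hm)
    rw [weight_weight]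
    omega
  have h1 := (h.approx.trans (isBigO_gauge_pow (show 4 ≤ 5 + 1 by norm_num))).add
    (evalAt_isBigO (Ideal.add_mem _ h4 h5))
  have h2 : (fun x => (φ x : ℂ)) =O[𝓝 0] fun x => gauge x ^ 4 := by
    refine h1.congr_left fun x => ?_
    ring
  simpa using h2.norm_left

theorem IsNormalFormJet.map_zero {φ : Param n → ℝ} {P₄ P₅ : MvPolynomial (Vars n) ℂ}
    (h : IsNormalFormJet φ P₄ P₅) : φ 0 = 0 := by
  have := h.isBigO.eq_zero_imp.self_of_nhds
  simpa [gauge] using this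

theorem continuousAt_boundaryPoint {φ : Param n → ℝ} {x : Param n} (h : ContinuousAt φ x) :
    ContinuousAt (boundaryPoint φ) x := by
  unfold boundaryPoint
  fun_prop

theorem contDiffAt_boundaryPoint {φ : Param n → ℝ} (h : ContDiffAt ℝ ∞ φ 0) :
    ContDiffAt ℝ ∞ (boundaryPoint φ) 0 := by
  unfold boundaryPoint
  refine contDiffAt_fst.prodMk ?_
  refine (Complex.ofRealCLM.contDiff.contDiffAt.comp _ contDiffAt_snd).add
    (contDiffAt_const.mul (Complex.ofRealCLM.contDiff.contDiffAt.comp _ ?_))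
  exact (contDiffAt_fst.norm_sq ℝ).add h

theorem boundaryPoint_zero {φ : Param n → ℝ} (h : φ 0 = 0) : boundaryPoint φ 0 = 0 := by
  simp [boundaryPoint, h]

theorem contDiffAt_definingFunction {φ : Param n → ℝ} (h : ContDiffAt ℝ ∞ φ 0) :
    ContDiffAt ℝ ∞ (definingFunction φ) 0 := by
  unfold definingFunction
  have h1 : ContDiffAt ℝ ∞ (fun Z : Space n => Z.2.im) 0 :=
    Complex.imCLM.contDiff.contDiffAt.comp _ contDiffAt_snd
  have h2 : ContDiffAt ℝ ∞ (fun Z : Space n => (Z.1, Z.2.re)) 0 :=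
    contDiffAt_fst.prodMk (Complex.reCLM.contDiff.contDiffAt.comp _ contDiffAt_snd)
  exact (h1.sub (contDiffAt_fst.norm_sq ℝ)).sub (ContDiffAt.comp (0 : Space n) (show ContDiffAt ℝ ∞ φ (0, (0 : ℂ).re) from h) h2)

theorem definingFunction_boundaryPoint (φ : Param n → ℝ) (x : Param n) :
    definingFunction φ (boundaryPoint φ x) = 0 := by
  simp [definingFunction, boundaryPoint, -Complex.ofReal_add, -Complex.ofReal_pow]

theorem definingFunction_zero {φ : Param n → ℝ} (h : φ 0 = 0) : definingFunction φ 0 = 0 := by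
  have := definingFunction_boundaryPoint φ 0
  rwa [boundaryPoint_zero h] at this

theorem contDiffAt_germ {D D' : Set (Space n)} {F : Space n → Space n}
    (hF : IsBoundaryGerm D D' 0 0 F) : ContDiffAt ℝ ∞ F 0 := by
  obtain ⟨-, U, hU, h0, hs, -, -⟩ := hF
  exact hs.contDiffAt (hU.mem_nhds h0)

theorem eventually_mem_iff_definingFunction {N : ℕ∞} {D : Set (Space n)} {φ : Param n → ℝ}
    (hD : HasNormalForm N D φ) : ∀ᶠ Z in 𝓝 (0 : Space n), Z ∈ D ↔ 0 < definingFunction φ Z := by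
  filter_upwards [hD.2.1] with Z hZ
  rw [hZ, definingFunction]
  constructor <;> intro h <;> linarith

theorem eventually_continuousAt {E F : Type*} [NormedAddCommGroup E] [NormedSpace ℝ E]
    [NormedAddCommGroup F] [NormedSpace ℝ F] {f : E → F} (h : ContDiffAt ℝ ∞ f 0) :
    ∀ᶠ x in 𝓝 (0 : E), ContinuousAt f x :=
  ((contDiffAt_infty.1 h 1).eventually (by simp)).mono fun _ hx => hx.continuousAt

/-- The vertical translate `(z, w + i ε)`. -/
noncomputable def liftPoint (Z : Space n) (ε : ℝ) : Space n := (Z.1, Z.2 + Complex.I * ε)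

theorem definingFunction_liftPoint (φ : Param n → ℝ) (Z : Space n) (ε : ℝ) :
    definingFunction φ (liftPoint Z ε) = definingFunction φ Z + ε := by
  simp [definingFunction, liftPoint]
  ring

theorem tendsto_liftPoint (Z : Space n) : Tendsto (liftPoint Z) (𝓝 0) (𝓝 Z) := by
  have h : Continuous (liftPoint Z) := by unfold liftPoint; fun_prop
  have := h.tendsto 0
  simpa [liftPoint] using this

/-- An open set accumulating at `0` on which the germ is holomorphic. -/
theorem exists_open_holomorphic {N : ℕ∞} {D D' : Set (Space n)} {φ : Param n → ℝ}
    (hD : HasNormalForm N D φ) (hφ0 : φ 0 = 0) {F : Space n → Space n}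
    (hF : IsBoundaryGerm D D' 0 0 F) :
    ∃ O : Set (Space n), IsOpen O ∧ (0 : Space n) ∈ closure O ∧ DifferentiableOn ℂ F O := by
  obtain ⟨-, U, hU, hU0, -, hd, -⟩ := hF
  have hev := ((show ∀ᶠ Z in 𝓝 (0 : Space n), Z ∈ U from hU.mem_nhds hU0).and
    (eventually_mem_iff_definingFunction hD)).and
    (eventually_continuousAt (contDiffAt_definingFunction hD.contDiffAt))
  obtain ⟨W, hW, hWo, hW0⟩ := eventually_nhds_iff.1 hev
  refine ⟨W ∩ definingFunction φ ⁻¹' Set.Ioi 0, ?_, ?_, ?_⟩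
  · exact ContinuousOn.isOpen_inter_preimage
      (fun Z hZ => (hW Z hZ).2.continuousWithinAt) hWo isOpen_Ioi
  · rw [mem_closure_iff_frequently]
    have h1 := (tendsto_liftPoint (0 : Space n)).mono_left (nhdsWithin_le_nhds (s := Set.Ioi 0))
    refine h1.frequently (Eventually.frequently ?_)
    filter_upwards [h1.eventually (hWo.mem_nhds hW0), self_mem_nhdsWithin] with ε hε hpos
    refine ⟨hε, ?_⟩
    rw [Set.mem_preimage, definingFunction_liftPoint, definingFunction_zero hφ0, zero_add]
    exact hpos
  · exact hd.mono fun Z hZ => ⟨(hW Z hZ.1).1.1, (hW Z hZ.1).1.2.2 hZ.2⟩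

/-- The image of the boundary of `D` lies in the closure of `D'`. -/
theorem eventually_definingFunction_nonneg {N : ℕ∞} {D D' : Set (Space n)} {φ φ' : Param n → ℝ}
    (hD : HasNormalForm N D φ) (hD' : HasNormalForm N D' φ') (hφ0 : φ 0 = 0)
    {F : Space n → Space n} (hF : IsBoundaryGerm D D' 0 0 F) :
    ∀ᶠ x in 𝓝 (0 : Param n), 0 ≤ definingFunction φ' (F (boundaryPoint φ x)) := by
  have hFs := contDiffAt_germ hF
  obtain ⟨hF0, U, hU, hU0, -, -, hm⟩ := hF
  have hFt : Tendsto F (𝓝 0) (𝓝 0) := by simpa [ContinuousAt, hF0] using hFs.continuousAt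
  have hev : ∀ᶠ Z in 𝓝 (0 : Space n), Z ∈ U ∧ (Z ∈ D ↔ 0 < definingFunction φ Z) ∧
      (F Z ∈ D' ↔ 0 < definingFunction φ' (F Z)) :=
    (show ∀ᶠ Z in 𝓝 (0 : Space n), Z ∈ U from hU.mem_nhds hU0).and
      ((eventually_mem_iff_definingFunction hD).and
        (hFt.eventually (eventually_mem_iff_definingFunction hD')))
  have hγ : Tendsto (boundaryPoint φ) (𝓝 0) (𝓝 0) := by
    simpa [ContinuousAt, boundaryPoint_zero hφ0] using
      continuousAt_boundaryPoint hD.contDiffAt.continuousAt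
  filter_upwards [hγ.eventually hev.eventually_nhds,
    hγ.eventually (eventually_continuousAt hFs),
    hγ.eventually (hFt.eventually
      (eventually_continuousAt (contDiffAt_definingFunction hD'.contDiffAt)))] with x h1 h2 h3
  -- For small `ε > 0` the vertical translate of a boundary point lies in `D`, so the defining
  -- function of `D'` is positive at its image. Letting `ε → 0` leaves a weak inequality.
  have hl := (tendsto_liftPoint (boundaryPoint φ x)).mono_left
    (nhdsWithin_le_nhds (s := Set.Ioi 0))
  refine ge_of_tendsto ((h3.tendsto.comp h2.tendsto).comp hl) ?_
  filter_upwards [hl.eventually h1, self_mem_nhdsWithin] with ε hε hpos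
  refine (hε.2.2.1 (hm ⟨hε.1, hε.2.1.2 ?_⟩)).le
  rw [definingFunction_liftPoint, definingFunction_boundaryPoint, zero_add]
  exact hpos

theorem isBigO_of_continuousAt {E : Type*} [NormedAddCommGroup E] {g : ℝ → E}
    (hg : ContinuousAt g 0) : g =O[𝓝[>] 0] fun _ => (1 : ℝ) :=
  (hg.tendsto.mono_left nhdsWithin_le_nhds).isBigO_one ℝ

theorem isBigO_smul_pow {E : Type*} [NormedAddCommGroup E] [NormedSpace ℂ E] {δ : ℝ → ℂ}
    {g : ℝ → E} {j k : ℕ} (hδ : δ =O[𝓝[>] 0] fun t => t ^ j) (hg : ContinuousAt g 0)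
    (h : k ≤ j) : (fun t => δ t • g t) =O[𝓝[>] 0] fun t => t ^ k := by
  have h1 := hδ.smul (isBigO_of_continuousAt hg)
  simp only [smul_eq_mul, mul_one] at h1
  refine h1.trans (IsBigO.of_bound 1 ?_)
  filter_upwards [self_mem_nhdsWithin, nhdsWithin_le_nhds (Iio_mem_nhds zero_lt_one)] with t h1 h2
  have h1 : 0 < t := h1
  rw [one_mul, norm_pow, norm_pow, Real.norm_eq_abs, abs_of_pos h1]
  exact pow_le_pow_of_le_one h1.le (show t < 1 from h2).le h

theorem isBigO_ofReal_pow (j : ℕ) : (fun t : ℝ => (t : ℂ) ^ j) =O[𝓝[>] 0] fun t => t ^ j :=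
  IsBigO.of_bound 1 (Eventually.of_forall fun t => by simp)

/-- The values of a homogeneous polynomial along two curves which are close to each other. -/
theorem evalAt_curve_isBigO {μ : ℕ} {P : MvPolynomial (Vars n) ℂ}
    (hP : P.IsWeightedHomogeneous weight μ)
    (hu : ∀ m ∈ P.support, m (Sum.inr (Sum.inr ())) = 0) {y : ℝ → Param n}
    {z : EuclideanSpace ℂ (Fin n)}
    (hy : (fun t => (y t).1 - (t : ℂ) • z) =O[𝓝[>] 0] fun t => t ^ 3) :
    (fun t => evalAt (y t) P - (t : ℂ) ^ μ * evalAt (z, 0) P) =O[𝓝[>] 0] fun t => t ^ (μ + 2) := by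
  -- Division by `t` moves the comparison to a neighborhood of the fixed point `(z, 0)`, where
  -- differentiability of `P` converts an error `O(t²)` in the argument into one in the value.
  -- Homogeneity restores the factor `t ^ μ`, and the `u`-coordinate is irrelevant because `P` does
  -- not contain it.
  have hx : (fun t : ℝ => (t⁻¹ : ℝ) • (y t).1 - z) =O[𝓝[>] 0] fun t => t ^ 2 := by
    refine (((isBigO_refl (fun t : ℝ => t⁻¹) (𝓝[>] 0)).smul hy).congr' ?_ ?_)
    · filter_upwards [self_mem_nhdsWithin] with t ht
      have ht : t ≠ 0 := (show (0 : ℝ) < t from ht).ne'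
      rw [smul_sub, ← Complex.coe_smul, ← Complex.coe_smul, smul_smul, ← Complex.ofReal_mul,
        inv_mul_cancel₀ ht, Complex.ofReal_one, one_smul]
    · filter_upwards [self_mem_nhdsWithin] with t ht
      have ht : t ≠ 0 := (show (0 : ℝ) < t from ht).ne'
      rw [smul_eq_mul]
      field_simp
  have hlim : Tendsto (fun t : ℝ => (((t⁻¹ : ℝ) • (y t).1, (0 : ℝ)) : Param n)) (𝓝[>] 0)
      (𝓝 (z, 0)) := by
    have h1 : Tendsto (fun t : ℝ => t ^ 2) (𝓝[>] 0) (𝓝 0) := by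
      have := (continuous_pow (M := ℝ) 2).tendsto 0
      simp only [ne_eq, OfNat.ofNat_ne_zero, not_false_eq_true, zero_pow] at this
      exact this.mono_left nhdsWithin_le_nhds
    have h2 := (hx.trans_tendsto h1).add_const z
    simp only [sub_add_cancel, zero_add] at h2
    exact h2.prodMk_nhds tendsto_const_nhds
  have hdiff : DifferentiableAt ℝ (fun x : Param n => evalAt x P) (z, 0) :=
    ((contDiff_evalAt P).differentiable (by simp)) _
  have h1 := hdiff.isBigO_sub.comp_tendsto hlim
  have h2 : (fun t => evalAt ((t⁻¹ : ℝ) • (y t).1, (0 : ℝ)) P - evalAt (z, 0) P) =O[𝓝[>] 0]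
      fun t : ℝ => t ^ 2 := by
    refine IsBigO.trans h1 ((IsBigO.of_bound 1 (Eventually.of_forall fun t => ?_)).trans hx)
    simp [Prod.norm_def]
  refine ((isBigO_ofReal_pow μ).mul h2).congr' ?_ ?_
  · filter_upwards [self_mem_nhdsWithin] with t ht
    have ht : t ≠ 0 := (show (0 : ℝ) < t from ht).ne'
    rw [mul_sub, ← evalAt_dilate hP, dilate, smul_smul, mul_inv_cancel₀ ht, one_smul,
      evalAt_eq_of_support hu _ _ (y t).2]
  · exact Eventually.of_forall fun t => (pow_add t μ 2).symm

end BoundaryJets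

/-! ### The expansion along the image of the boundary. -/

namespace BoundaryJets

open Asymptotics Filter MvPolynomial

variable {n : ℕ}

theorem IsNormalFormJet.homogeneous₄ {φ : Param n → ℝ} {P₄ P₅ : MvPolynomial (Vars n) ℂ}
    (h : IsNormalFormJet φ P₄ P₅) : P₄.IsWeightedHomogeneous weight 4 := fun m hm => by
  have := h.supp₄ m (mem_support_iff.2 hm)
  rw [weight_weight]
  omega

theorem IsNormalFormJet.homogeneous₅ {φ : Param n → ℝ} {P₄ P₅ : MvPolynomial (Vars n) ℂ}
    (h : IsNormalFormJet φ P₄ P₅) : P₅.IsWeightedHomogeneous weight 5 := fun m hm => by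
  have := h.supp₅ m (mem_support_iff.2 hm)
  rw [weight_weight]
  omega

theorem IsNormalFormJet.bidegree₄ {φ : Param n → ℝ} {P₄ P₅ : MvPolynomial (Vars n) ℂ}
    (h : IsNormalFormJet φ P₄ P₅) : P₄.IsWeightedHomogeneous bidegree (2, 2) := fun m hm => by
  obtain ⟨h1, h2, -⟩ := h.supp₄ m (mem_support_iff.2 hm)
  rw [weight_bidegree, weight_holDegree, weight_antiholDegree, h1, h2]

theorem unimodular_mul_conj {η : ℂ} (hη : ‖η‖ = 1) : η * (starRingEnd ℂ) η = 1 := by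
  rw [Complex.mul_conj, Complex.normSq_eq_norm_sq, hη]
  norm_num

theorem IsNormalFormJet.evalAt_rotate₄ {φ : Param n → ℝ} {P₄ P₅ : MvPolynomial (Vars n) ℂ}
    (h : IsNormalFormJet φ P₄ P₅) {η : ℂ} (hη : ‖η‖ = 1) (z : EuclideanSpace ℂ (Fin n)) :
    evalAt (η • z, 0) P₄ = evalAt (z, 0) P₄ := by
  rw [evalAt_rotate h.bidegree₄, ← mul_pow, unimodular_mul_conj hη, one_pow, one_mul]

theorem IsNormalFormJet.dilate_isBigO {φ : Param n → ℝ} {P₄ P₅ : MvPolynomial (Vars n) ℂ}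
    (h : IsNormalFormJet φ P₄ P₅) (z : EuclideanSpace ℂ (Fin n)) (u : ℝ) :
    (fun t : ℝ => (φ (dilate t (z, u)) : ℂ) -
      ((t : ℂ) ^ 4 * evalAt (z, 0) P₄ + (t : ℂ) ^ 5 * evalAt (z, 0) P₅)) =O[𝓝[>] 0]
      fun t => t ^ 6 := by
  have h1 := (IsBigO.comp_tendsto h.approx (tendsto_dilate (z, u))).mono
    (nhdsWithin_le_nhds (s := Set.Ioi 0))
  refine (h1.congr_left fun t => ?_).trans (IsBigO.of_bound (gauge (z, u) ^ 6)
    (Eventually.of_forall fun t => ?_))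
  · simp only [Function.comp]
    rw [evalAt, map_add]
    change _ - (evalAt _ _ + evalAt _ _) = _
    rw [evalAt_dilate h.homogeneous₄, evalAt_dilate h.homogeneous₅,
      evalAt_eq_of_support (fun m hm => (h.supp₄ m hm).2.2) z u 0,
      evalAt_eq_of_support (fun m hm => (h.supp₅ m hm).2) z u 0]
  · simp only [Function.comp, gauge_dilate]
    rw [Real.norm_of_nonneg (by have := gauge_nonneg (z, u); positivity), mul_pow]
    simp [mul_comm]

/-- The expansion up to weight five of the defining function along the image of the boundary. -/
theorem germ_expansion {φ φ' : Param n → ℝ} {P₄ P₅ P₄' P₅' : MvPolynomial (Vars n) ℂ}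
    (J : IsNormalFormJet φ P₄ P₅) (J' : IsNormalFormJet φ' P₄' P₅') {F : Space n → Space n}
    (hF : ContDiffAt ℝ ∞ F 0) {O : Set (Space n)} (hO : IsOpen O) (h0 : (0 : Space n) ∈ closure O)
    (hFO : DifferentiableOn ℂ F O) (B : EuclideanSpace ℂ (Fin n) →L[ℂ] EuclideanSpace ℂ (Fin n))
    (a : EuclideanSpace ℂ (Fin n)) (c : ℂ)
    (hsec : IsBigO 3 (fun Z : Space n =>
      F Z - (Z + (Z.2 • B Z.1 + Z.2 ^ 2 • a, c * Z.2 ^ 2))))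
    (z : EuclideanSpace ℂ (Fin n)) :
    ∃ A₃₀ A₄₀ A₅₀ A₂₁ A₃₁ A₁₂ C₃₀ C₄₀ C₂₁ : ℂ, ∀ (u : ℝ) (η w₀ : ℂ), ‖η‖ = 1 →
      w₀ = u + Complex.I * ((‖z‖ ^ 2 : ℝ) : ℂ) →
      (fun t : ℝ => definingFunction φ' (F (boundaryPoint φ (dilate t (η • z, u)))) -
        (t ^ 3 * (η ^ 3 * A₃₀).im +
         t ^ 4 * ((evalAt (z, 0) P₄).re - (evalAt (z, 0) P₄').re +
          (c * w₀ ^ 2 + η ^ 4 * A₄₀ + η ^ 2 * w₀ * A₂₁).im -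
          2 * (w₀ * inner ℂ z (B z) + η ^ 2 * C₃₀).re) +
         t ^ 5 * ((evalAt (η • z, 0) P₅).re - (evalAt (η • z, 0) P₅').re +
          (η ^ 5 * A₅₀ + η ^ 3 * w₀ * A₃₁ + η * w₀ ^ 2 * A₁₂).im -
          2 * ((starRingEnd ℂ) η * w₀ ^ 2 * inner ℂ z a + η ^ 3 * C₄₀ + η * w₀ * C₂₁).re))) =O[𝓝[>] 0]
        fun t => t ^ 6 := by
  set R : Space n → Space n := fun Z => F Z - (Z + (Z.2 • B Z.1 + Z.2 ^ 2 • a, c * Z.2 ^ 2)) with hR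
  have hpoly : ContDiff ℂ ∞ fun Z : Space n => Z + (Z.2 • B Z.1 + Z.2 ^ 2 • a, c * Z.2 ^ 2) := by
    have h1 : ContDiff ℂ ∞ fun Z : Space n => B Z.1 := B.contDiff.comp contDiff_fst
    fun_prop
  have hRs : ContDiffAt ℝ ∞ R 0 := hF.sub (hpoly.restrict_scalars ℝ).contDiffAt
  have hRO : DifferentiableOn ℂ R O :=
    hFO.sub (hpoly.differentiable (by simp)).differentiableOn
  obtain ⟨V₃₀, V₄₀, V₅₀, V₂₁, V₃₁, V₁₂, hV⟩ := holomorphic_expansion hO h0 hRs hRO hsec z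
  -- The `A`'s come from the `w`-component of the cubic remainder, the `C`'s from pairing its
  -- `z`-component with `z` in `‖F^z‖²`. None of them depends on `u` or `η`, which later permits
  -- comparison of frequencies and of powers of `u`.
  refine ⟨V₃₀.2, V₄₀.2, V₅₀.2, V₂₁.2, V₃₁.2, V₁₂.2, inner ℂ z V₃₀.1, inner ℂ z V₄₀.1,
    inner ℂ z V₂₁.1, fun u η w₀ hη hw₀ => ?_⟩
  have hηη := unimodular_mul_conj hη
  set p₄ := evalAt (z, 0) P₄ with hp₄
  set p₄' := evalAt (z, 0) P₄' with hp₄'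
  set p₅ := evalAt (η • z, 0) P₅ with hp₅
  set p₅' := evalAt (η • z, 0) P₅' with hp₅'
  -- the boundary curve
  set φt : ℝ → ℝ := fun t => φ (dilate t (η • z, u)) with hφt
  set δ : ℝ → ℂ := fun t => Complex.I * (φt t : ℂ) with hδ
  set ζ : ℝ → ℂ := fun t => (t : ℂ) * η with hζ
  set τ : ℝ → ℂ := fun t => (t : ℂ) ^ 2 * w₀ + δ t with hτ
  have hγ : ∀ t, boundaryPoint φ (dilate t (η • z, u)) = (ζ t • z, τ t) := by
    intro t
    refine Prod.ext ?_ ?_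
    · simp only [boundaryPoint, dilate, hζ]
      rw [mul_smul, Complex.coe_smul]
    · simp only [boundaryPoint, hτ, hδ, hφt, hw₀]
      simp only [dilate, norm_smul, hη, one_mul, Real.norm_eq_abs, mul_pow, sq_abs]
      push_cast
      ring
  have hφ6 : (fun t => (φt t : ℂ) - ((t : ℂ) ^ 4 * p₄ + (t : ℂ) ^ 5 * p₅)) =O[𝓝[>] 0]
      fun t => t ^ 6 := by
    have := J.dilate_isBigO (η • z) u
    rwa [J.evalAt_rotate₄ hη] at this
  have hpow : ∀ {j k : ℕ}, k ≤ j → (fun t : ℝ => t ^ j) =O[𝓝[>] 0] fun t => t ^ k := by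
    intro j k h
    have := isBigO_smul_pow (g := fun _ : ℝ => (1 : ℂ)) (isBigO_ofReal_pow j) continuousAt_const h
    refine IsBigO.congr_left this.norm_left (fun t => ?_) |>.of_norm_left
    simp
  have hφ4 : (fun t => (φt t : ℂ)) =O[𝓝[>] 0] fun t => t ^ 4 := by
    have h1 : (fun t : ℝ => (t : ℂ) ^ 4 • (p₄ + t * p₅)) =O[𝓝[>] 0] fun t => t ^ 4 :=
      isBigO_smul_pow (isBigO_ofReal_pow 4) (by fun_prop) le_rfl
    refine ((hφ6.trans (hpow (by norm_num))).add h1).congr_left fun t => ?_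
    rw [smul_eq_mul]; ring
  have hδ4 : δ =O[𝓝[>] 0] fun t => t ^ 4 := hφ4.const_mul_left _
  have hδ6 : (fun t => δ t - Complex.I * ((t : ℂ) ^ 4 * p₄ + (t : ℂ) ^ 5 * p₅)) =O[𝓝[>] 0]
      fun t => t ^ 6 := by
    refine (hφ6.const_mul_left Complex.I).congr_left fun t => ?_
    simp only [hδ]; ring
  have hδδ : (fun t => δ t * δ t) =O[𝓝[>] 0] fun t => t ^ 8 :=
    (hδ4.mul hδ4).congr_right fun t => by ring
  have hδt : (fun t => δ t * (t : ℂ)) =O[𝓝[>] 0] fun t => t ^ 5 :=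
    (hδ4.mul (isBigO_ofReal_pow 1)).congr (fun t => by ring) fun t => by ring
  have hδtt : (fun t => δ t * (t : ℂ) ^ 2) =O[𝓝[>] 0] fun t => t ^ 6 :=
    (hδ4.mul (isBigO_ofReal_pow 2)).congr (fun t => by ring) fun t => by ring
  have hζO : ζ =O[𝓝[>] 0] fun t => t :=
    IsBigO.of_bound 1 (Eventually.of_forall fun t => by simp [hζ, hη])
  have hτO : τ =O[𝓝[>] 0] fun t => t ^ 2 := by
    refine IsBigO.add ?_ (hδ4.trans (hpow (by norm_num)))
    simpa using isBigO_smul_pow (g := fun _ => w₀) (isBigO_ofReal_pow 2) continuousAt_const le_rfl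
  have hrem := hV (𝓝[>] 0) ζ τ nhdsWithin_le_nhds hζO hτO
  have hrem1 := (isBigO_fst_prod'.trans hrem :)
  have hrem2 := (isBigO_snd_prod'.trans hrem :)
  set G : ℝ → Space n := fun t => F (ζ t • z, τ t) with hG
  have hGR : ∀ t, G t = (ζ t • z + (τ t • ζ t • B z + τ t ^ 2 • a) + (R (ζ t • z, τ t)).1,
      τ t + c * τ t ^ 2 + (R (ζ t • z, τ t)).2) := by
    intro t
    refine Prod.ext ?_ ?_
    · simp [hG, hR]
    · simp [hG, hR]
  -- the approximants
  set w₃ := η ^ 3 * V₃₀.2 with hw₃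
  set w₄ := Complex.I * p₄ + c * w₀ ^ 2 + η ^ 4 * V₄₀.2 + η ^ 2 * w₀ * V₂₁.2 with hw₄
  set w₅ := Complex.I * p₅ + η ^ 5 * V₅₀.2 + η ^ 3 * w₀ * V₃₁.2 + η * w₀ ^ 2 * V₁₂.2 with hw₅
  set z₃ := (η * w₀) • B z + η ^ 3 • V₃₀.1 with hz₃
  set z₄ := w₀ ^ 2 • a + η ^ 4 • V₄₀.1 + (η ^ 2 * w₀) • V₂₁.1 with hz₄
  have hw : (fun t : ℝ => (G t).2 - ((t : ℂ) ^ 2 * w₀ + (t : ℂ) ^ 3 * w₃ + (t : ℂ) ^ 4 * w₄ +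
      (t : ℂ) ^ 5 * w₅)) =O[𝓝[>] 0] fun t => t ^ 6 := by
    -- The contribution `δ` of `φ` enters `τ` linearly and is kept there. In the terms of order at
    -- least two it occurs only multiplied by `t²` or by another `δ`, hence beyond weight five.
    have h1 : (fun t : ℝ => (δ t * (t : ℂ) ^ 2) • (2 * c * w₀ + η ^ 2 * V₂₁.2 + t * (η ^ 3 * V₃₁.2 +
        2 * η * w₀ * V₁₂.2))) =O[𝓝[>] 0] fun t => t ^ 6 :=
      isBigO_smul_pow hδtt (by fun_prop) le_rfl
    have h2 : (fun t : ℝ => (δ t * δ t) • (c + t * (η * V₁₂.2))) =O[𝓝[>] 0] fun t => t ^ 6 :=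
      isBigO_smul_pow hδδ (by fun_prop) (by norm_num)
    refine (((hrem2.add hδ6).add h1).add h2).congr_left fun t => ?_
    rw [hGR]
    simp only [Prod.snd_sub, Prod.snd_add, Prod.smul_snd, smul_eq_mul, hw₃, hw₄, hw₅, hζ, hτ]
    ring
  -- An error `O(t⁵)` suffices for the `z`-component: in the squared norm it is paired with a vector
  -- of size `O(t)`.
  have hz : (fun t : ℝ => (G t).1 - (((t : ℂ) * η) • z + (t : ℂ) ^ 3 • (z₃ + (t : ℂ) • z₄)))
      =O[𝓝[>] 0] fun t => t ^ 5 := by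
    have h1 : (fun t : ℝ => (δ t * (t : ℂ)) • (η • B z + (t : ℂ) • ((2 * w₀) • a + η ^ 2 • V₂₁.1) +
        (t : ℂ) ^ 2 • (η ^ 3 • V₃₁.1 + (2 * η * w₀) • V₁₂.1))) =O[𝓝[>] 0] fun t => t ^ 5 :=
      isBigO_smul_pow hδt (by fun_prop) le_rfl
    have h2 : (fun t : ℝ => (δ t * δ t) • (a + ((t : ℂ) * η) • V₁₂.1)) =O[𝓝[>] 0] fun t => t ^ 5 :=
      isBigO_smul_pow hδδ (by fun_prop) (by norm_num)
    have h3 : (fun t : ℝ => (t : ℂ) ^ 5 • (η ^ 5 • V₅₀.1 + (η ^ 3 * w₀) • V₃₁.1 +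
        (η * w₀ ^ 2) • V₁₂.1)) =O[𝓝[>] 0] fun t => t ^ 5 :=
      isBigO_smul_pow (isBigO_ofReal_pow 5) continuousAt_const le_rfl
    refine ((((hrem1.trans (hpow (by norm_num))).add h1).add h2).add h3).congr_left fun t => ?_
    rw [hGR]
    simp only [Prod.fst_sub, Prod.fst_add, Prod.smul_fst, hz₃, hz₄, hζ, hτ]
    module
  -- the contribution of `φ'`
  have hz3 : (fun t : ℝ => (G t).1 - (t : ℂ) • (η • z)) =O[𝓝[>] 0] fun t => t ^ 3 := by
    have h1 : (fun t : ℝ => (t : ℂ) ^ 3 • (z₃ + (t : ℂ) • z₄)) =O[𝓝[>] 0] fun t => t ^ 3 :=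
      isBigO_smul_pow (isBigO_ofReal_pow 3) (by fun_prop) le_rfl
    refine ((hz.trans (hpow (by norm_num))).add h1).congr_left fun t => ?_
    module
  have hz1 : (fun t : ℝ => (G t).1) =O[𝓝[>] 0] fun t => t := by
    have h1 : (fun t : ℝ => (t : ℂ) ^ 1 • (η • z)) =O[𝓝[>] 0] fun t => t ^ 1 :=
      isBigO_smul_pow (isBigO_ofReal_pow 1) (by fun_prop) le_rfl
    refine ((hz3.trans (hpow (show 1 ≤ 3 by norm_num))).add h1).congr (fun t => ?_)
      (fun t => pow_one t)
    module
  have hw2 : (fun t : ℝ => (G t).2) =O[𝓝[>] 0] fun t => t ^ 2 := by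
    have h1 : (fun t : ℝ => (t : ℂ) ^ 2 • (w₀ + t * w₃ + t ^ 2 * w₄ + t ^ 3 * w₅)) =O[𝓝[>] 0]
        fun t => t ^ 2 :=
      isBigO_smul_pow (isBigO_ofReal_pow 2) (by fun_prop) le_rfl
    refine ((hw.trans (hpow (show 2 ≤ 6 by norm_num))).add h1).congr_left fun t => ?_
    rw [smul_eq_mul]
    ring
  set y : ℝ → Param n := fun t => ((G t).1, (G t).2.re) with hy
  have hgauge : (fun t => gauge (y t)) =O[𝓝[>] 0] fun t => t := by
    obtain ⟨C₁, h1⟩ := hz1.bound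
    obtain ⟨C₂, h2⟩ := hw2.bound
    refine IsBigO.of_bound (max |C₁| (|C₂| + 1)) ?_
    filter_upwards [h1, h2] with t h1 h2
    rw [Real.norm_of_nonneg (gauge_nonneg _)]
    refine gauge_le_of (by positivity) (h1.trans ?_) ?_
    · gcongr
      exact (le_abs_self _).trans (le_max_left _ _)
    · refine (Complex.abs_re_le_norm _).trans (h2.trans ?_)
      rw [mul_pow, norm_pow]
      gcongr
      have h3 : |C₂| + 1 ≤ max |C₁| (|C₂| + 1) := le_max_right _ _
      have h4 : 0 ≤ |C₂| := abs_nonneg _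
      have h5 := le_abs_self C₂
      nlinarith
  have hid : Tendsto (fun t : ℝ => t) (𝓝[>] 0) (𝓝 0) := nhdsWithin_le_nhds
  have hid2 : Tendsto (fun t : ℝ => t ^ 2) (𝓝[>] 0) (𝓝 0) := by
    simpa using hid.pow 2
  have hy0 : Tendsto y (𝓝[>] 0) (𝓝 0) := by
    have h1 := hz1.trans_tendsto hid
    have h2 := (Complex.continuous_re.tendsto _).comp (hw2.trans_tendsto hid2)
    exact h1.prodMk_nhds h2
  have hφ' : (fun t => (φ' (y t) : ℂ) - ((t : ℂ) ^ 4 * p₄' + (t : ℂ) ^ 5 * p₅')) =O[𝓝[>] 0]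
      fun t => t ^ 6 := by
    have h1 := (IsBigO.comp_tendsto J'.approx hy0).trans (hgauge.pow 6)
    have h2 := evalAt_curve_isBigO (y := y) J'.homogeneous₄
      (fun m hm => (J'.supp₄ m hm).2.2) hz3
    have h3 := (evalAt_curve_isBigO (y := y) J'.homogeneous₅
      (fun m hm => (J'.supp₅ m hm).2) hz3).trans (hpow (show 6 ≤ 5 + 2 by norm_num))
    rw [J'.evalAt_rotate₄ hη] at h2
    refine ((h1.add h2).add h3).congr_left fun t => ?_
    have : evalAt (y t) (P₄' + P₅') = evalAt (y t) P₄' + evalAt (y t) P₅' := by simp [evalAt]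
    simp only [Function.comp, this]
    ring
  -- the norm
  set d : ℝ → EuclideanSpace ℂ (Fin n) := fun t =>
    (G t).1 - (((t : ℂ) * η) • z + (t : ℂ) ^ 3 • (z₃ + (t : ℂ) • z₄)) with hd
  set zt : ℝ → EuclideanSpace ℂ (Fin n) := fun t =>
    ((t : ℂ) * η) • z + (t : ℂ) ^ 3 • (z₃ + (t : ℂ) • z₄) with hzt
  have hzt1 : zt =O[𝓝[>] 0] fun t => t := by
    refine (hz1.sub (hz.trans (hpow (show 1 ≤ 5 by norm_num) |>.congr_right pow_one))).congr_left
      fun t => ?_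
    simp only [hzt, hd, sub_sub_cancel]
  have hinner : (fun t => (inner ℂ (zt t) (d t)).re) =O[𝓝[>] 0] fun t => t ^ 6 := by
    refine IsBigO.trans (IsBigO.of_bound 1 (Eventually.of_forall fun t => ?_))
      ((hzt1.norm_left.mul hz.norm_left).congr_right fun t => show t * t ^ 5 = t ^ 6 by ring)
    rw [one_mul, Real.norm_eq_abs, Real.norm_of_nonneg (by positivity)]
    exact (Complex.abs_re_le_norm _).trans (norm_inner_le_norm _ _)
  have hdd : (fun t => ‖d t‖ ^ 2) =O[𝓝[>] 0] fun t => t ^ 6 :=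
    (hz.norm_left.pow 2).trans ((hpow (show 6 ≤ 10 by norm_num)).congr_left fun t => by ring)
  have h34 : (fun t : ℝ => t ^ 6 * ‖z₃ + (t : ℂ) • z₄‖ ^ 2) =O[𝓝[>] 0] fun t => t ^ 6 := by
    have hc : ContinuousAt (fun t : ℝ => ‖z₃ + (t : ℂ) • z₄‖ ^ 2) 0 := by fun_prop
    simpa using (isBigO_refl (fun t : ℝ => t ^ 6) (𝓝[>] 0)).mul (isBigO_of_continuousAt hc)
  have him := IsBigO.trans (Complex.imCLM.isBigO_comp _ _) hw
  have hre := IsBigO.trans (Complex.reCLM.isBigO_comp _ _) hφ'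
  refine ((((him.sub hre).sub (hinner.const_mul_left 2)).sub hdd).sub h34).congr_left fun t => ?_
  rw [hγ]
  have hGt : definingFunction φ' (F (ζ t • z, τ t)) = (G t).2.im - ‖(G t).1‖ ^ 2 - φ' (y t) := rfl
  have hG1 : (G t).1 = zt t + d t := by simp only [hzt, hd]; abel
  have hn1 : ‖(G t).1‖ ^ 2 = ‖zt t‖ ^ 2 + 2 * (inner ℂ (zt t) (d t)).re + ‖d t‖ ^ 2 := by
    rw [hG1, @norm_add_sq ℂ]
    rfl
  have hn2 : ‖zt t‖ ^ 2 = t ^ 2 * ‖z‖ ^ 2 + 2 * (t ^ 4 * ((starRingEnd ℂ) η *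
      (inner ℂ z z₃ + t * inner ℂ z z₄)).re) + t ^ 6 * ‖z₃ + (t : ℂ) • z₄‖ ^ 2 := by
    simp only [hzt]
    rw [@norm_add_sq ℂ, norm_smul, norm_smul, norm_mul, hη, inner_smul_left, inner_smul_right,
      inner_add_right, inner_smul_right]
    have : (starRingEnd ℂ) ((t : ℂ) * η) * ((t : ℂ) ^ 3 * (inner ℂ z z₃ + t * inner ℂ z z₄)) =
        ((t ^ 4 : ℝ) : ℂ) * ((starRingEnd ℂ) η * (inner ℂ z z₃ + t * inner ℂ z z₄)) := by
      rw [map_mul, Complex.conj_ofReal]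
      push_cast
      ring
    rw [this, RCLike.re_eq_complex_re, Complex.re_ofReal_mul]
    simp only [Complex.norm_real, norm_pow, Real.norm_eq_abs, mul_one, mul_pow, sq_abs]
    rw [← pow_mul, show 3 * 2 = 2 * 3 by norm_num, pow_mul, sq_abs]
    ring
  -- Pairing with the leading term `η z` lowers each frequency by one. Hence the `B` term becomes
  -- independent of `η`, while the `a` term acquires the frequency `-1`.
  have hi3 : (starRingEnd ℂ) η * inner ℂ z z₃ = w₀ * inner ℂ z (B z) + η ^ 2 * inner ℂ z V₃₀.1 := by
    simp only [hz₃, inner_add_right, inner_smul_right]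
    linear_combination (w₀ * inner ℂ z (B z) + η ^ 2 * inner ℂ z V₃₀.1) * hηη
  have hi4 : (starRingEnd ℂ) η * inner ℂ z z₄ = (starRingEnd ℂ) η * w₀ ^ 2 * inner ℂ z a +
      η ^ 3 * inner ℂ z V₄₀.1 + η * w₀ * inner ℂ z V₂₁.1 := by
    simp only [hz₄, inner_add_right, inner_smul_right]
    linear_combination (η ^ 3 * inner ℂ z V₄₀.1 + η * w₀ * inner ℂ z V₂₁.1) * hηη
  have hi : (starRingEnd ℂ) η * (inner ℂ z z₃ + t * inner ℂ z z₄) =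
      (w₀ * inner ℂ z (B z) + η ^ 2 * inner ℂ z V₃₀.1) + (t : ℂ) * ((starRingEnd ℂ) η * w₀ ^ 2 *
        inner ℂ z a + η ^ 3 * inner ℂ z V₄₀.1 + η * w₀ * inner ℂ z V₂₁.1) := by
    rw [← hi3, ← hi4]; ring
  have hw₀im : w₀.im = ‖z‖ ^ 2 := by
    rw [hw₀, Complex.add_im, Complex.ofReal_im, zero_add, Complex.im_mul_ofReal, Complex.I_im,
      one_mul]
  have hw₄im : w₄.im = p₄.re + (c * w₀ ^ 2 + η ^ 4 * V₄₀.2 + η ^ 2 * w₀ * V₂₁.2).im := by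
    rw [hw₄, add_assoc, add_assoc, Complex.add_im, Complex.I_mul_im, ← add_assoc]
  have hw₅im : w₅.im = p₅.re + (η ^ 5 * V₅₀.2 + η ^ 3 * w₀ * V₃₁.2 + η * w₀ ^ 2 * V₁₂.2).im := by
    rw [hw₅, add_assoc, add_assoc, Complex.add_im, Complex.I_mul_im, ← add_assoc]
  rw [hGt, hn1, hn2, hi]
  simp only [Complex.imCLM_apply, Complex.reCLM_apply, Complex.sub_im, Complex.sub_re,
    Complex.add_im (_ + _ + _) _, Complex.add_im (_ + _) (_ * w₄),
    Complex.add_im (_ * w₀) (_ * w₃), ← Complex.ofReal_pow, Complex.im_ofReal_mul,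
    Complex.re_ofReal_mul, Complex.add_re (_ * p₄') _, hw₀im, hw₄im, hw₅im, Complex.ofReal_re,
    Complex.add_re (_ + _) ((t : ℂ) * _)]
  ring

end BoundaryJets

/-! ### Leading weighted parts, and separation of frequencies in `η` and powers of `u`. -/

namespace BoundaryJets

open Asymptotics Filter MvPolynomial

variable {n : ℕ}

theorem contDiffAt_comp_dilate {f : Param n → ℝ} (hf : ContDiffAt ℝ ∞ f 0) (x : Param n) :
    ContDiffAt ℝ ∞ (fun t : ℝ => f (dilate t x)) 0 :=
  ContDiffAt.comp (0 : ℝ) (by rwa [dilate_zero]) (contDiff_dilate x).contDiffAt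

theorem weightedPart_eq_of_isBigO {f : Param n → ℝ} (hf : ContDiffAt ℝ ∞ f 0) {x : Param n}
    {d : ℕ → ℝ} {k : ℕ} (h : (fun t : ℝ => f (dilate t x) - ∑ j ∈ Finset.range (k + 1),
      t ^ j • d j) =O[𝓝[>] 0] fun t => t ^ (k + 1)) {μ : ℕ} (hμ : μ ≤ k) :
    weightedPart f μ x = d μ := by
  have h1 := iteratedDeriv_eq_of_isBigO k (contDiffAt_comp_dilate hf x) h μ hμ
  have h2 : (μ.factorial : ℝ) ≠ 0 := by positivity
  rw [weightedPart]
  change iteratedDeriv μ (fun t => f (dilate t x)) 0 / _ = _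
  rw [h1, smul_eq_mul]
  field_simp

theorem weightedPart_isBigO {f : Param n → ℝ} (hf : ContDiffAt ℝ ∞ f 0) (x : Param n) (k : ℕ) :
    (fun t : ℝ => f (dilate t x) - ∑ j ∈ Finset.range (k + 1), t ^ j * weightedPart f j x)
      =O[𝓝[>] 0] fun t => t ^ (k + 1) := by
  have h0 := contDiffAt_infty.1 (contDiffAt_comp_dilate hf x) (k + 1)
  have h1 := (taylor_isBigO (F := ℝ) (f := fun t : ℝ => f (dilate t x)) k (by exact_mod_cast h0)).mono (nhdsWithin_le_nhds (s := Set.Ioi 0))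
  refine (h1.trans (IsBigO.of_bound 1 (Eventually.of_forall fun t => ?_))).congr_left fun t => ?_
  · simp
  · congr 1
    refine Finset.sum_congr rfl fun j _ => ?_
    rw [weightedPart, iteratedDeriv_eq_iteratedFDeriv]
    have : (fun _ : Fin j => t) = fun i : Fin j => t • (1 : ℝ) := by simp
    rw [this, ContinuousMultilinearMap.map_smul_univ]
    simp only [Finset.prod_const, Finset.card_univ, Fintype.card_fin, smul_eq_mul]
    change _ = t ^ j * (iteratedFDeriv ℝ j (fun t => f (dilate t x)) 0 _ / _)
    ring

theorem nonneg_of_isBigO {q : ℝ → ℝ} (hq : ∀ᶠ t in 𝓝[>] 0, 0 ≤ q t) {k : ℕ} {e : ℝ}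
    (h : (fun t => q t - t ^ k * e) =O[𝓝[>] 0] fun t => t ^ (k + 1)) : 0 ≤ e := by
  obtain ⟨C, hC⟩ := h.bound
  have h1 : ∀ᶠ t : ℝ in 𝓝[>] 0, -(C * t) ≤ e := by
    filter_upwards [hq, hC, self_mem_nhdsWithin] with t h1 h2 h3
    have h3 : 0 < t := h3
    rw [Real.norm_eq_abs, Real.norm_of_nonneg (by positivity)] at h2
    have h4 := (abs_le.1 h2).2
    have h5 : 0 < t ^ k := by positivity
    have h6 : t ^ k * (-(C * t)) ≤ t ^ k * e := by
      rw [pow_succ] at h4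
      nlinarith
    exact le_of_mul_le_mul_left h6 h5
  have h2 : Tendsto (fun t : ℝ => -(C * t)) (𝓝[>] 0) (𝓝 0) := by
    have : Continuous fun t : ℝ => -(C * t) := by fun_prop
    simpa using (this.tendsto 0).mono_left nhdsWithin_le_nhds
  exact le_of_tendsto h2 h1

/-- Along a weighted dilation of `x`, the component of weight `k` dominates `f` once all lower ones
vanish. -/
theorem weightedPart_nonneg {f : Param n → ℝ} (hf : ContDiffAt ℝ ∞ f 0)
    (hpos : ∀ᶠ x in 𝓝 0, 0 ≤ f x) {x : Param n} {k : ℕ} (h : ∀ j < k, weightedPart f j x = 0) :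
    0 ≤ weightedPart f k x := by
  refine nonneg_of_isBigO (k := k)
    (((tendsto_dilate x).mono_left nhdsWithin_le_nhds).eventually hpos)
    ((weightedPart_isBigO hf x k).congr_left fun t => ?_)
  rw [Finset.sum_range_succ, Finset.sum_eq_zero, zero_add]
  intro j hj
  rw [h j (Finset.mem_range.1 hj), mul_zero]

theorem contDiffAt_definingFunction_comp {φ φ' : Param n → ℝ} (hφ : ContDiffAt ℝ ∞ φ 0)
    (hφ' : ContDiffAt ℝ ∞ φ' 0) (h0 : φ 0 = 0) {F : Space n → Space n} (hF : ContDiffAt ℝ ∞ F 0)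
    (hF0 : F 0 = 0) :
    ContDiffAt ℝ ∞ (fun x => definingFunction φ' (F (boundaryPoint φ x))) 0 := by
  refine ContDiffAt.comp (0 : Param n) (g := definingFunction φ') ?_ (ContDiffAt.comp (0 : Param n) (g := F) ?_
    (contDiffAt_boundaryPoint hφ))
  · rw [boundaryPoint_zero h0, hF0]
    exact contDiffAt_definingFunction hφ'
  · rwa [boundaryPoint_zero h0]

theorem IsNormalFormJet.im_evalAt₄ {φ : Param n → ℝ} {P₄ P₅ : MvPolynomial (Vars n) ℂ}
    (h : IsNormalFormJet φ P₄ P₅) (x : Param n) : (evalAt x P₄).im = 0 := by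
  have h1 := weightedPart_eq_evalAt h.smooth h.approx (μ := 4) (by norm_num) x
  rw [map_add, weightedHomogeneousComponent_of_mem h.homogeneous₄,
    weightedHomogeneousComponent_of_mem h.homogeneous₅] at h1
  simp only [if_true, show ¬ (4 = 5) by norm_num, if_false, add_zero] at h1
  rw [← h1, Complex.ofReal_im]

theorem IsNormalFormJet.im_evalAt₅ {φ : Param n → ℝ} {P₄ P₅ : MvPolynomial (Vars n) ℂ}
    (h : IsNormalFormJet φ P₄ P₅) (x : Param n) : (evalAt x P₅).im = 0 := by
  have h1 := weightedPart_eq_evalAt h.smooth h.approx (μ := 5) (by norm_num) x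
  rw [map_add, weightedHomogeneousComponent_of_mem h.homogeneous₄,
    weightedHomogeneousComponent_of_mem h.homogeneous₅] at h1
  simp only [if_true, show ¬ (5 = 4) by norm_num, if_false, zero_add] at h1
  rw [← h1, Complex.ofReal_im]

theorem exists_unimodular_sq_eq_I : ∃ κ : ℂ, ‖κ‖ = 1 ∧ κ ^ 2 = Complex.I := by
  obtain ⟨κ, hκ⟩ := IsAlgClosed.exists_pow_nat_eq Complex.I (n := 2) (by norm_num)
  refine ⟨κ, ?_, hκ⟩
  have h1 : ‖κ‖ ^ 2 = 1 := by rw [← norm_pow, hκ, Complex.norm_I]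
  exact (pow_eq_one_iff_of_nonneg (norm_nonneg κ) two_ne_zero).1 h1

/-- Since `κ² = i`, the four rotations multiply `η²` by `1, i, -1, -i` and `η⁴` by `1, -1, 1, -1`.
Both lists sum to zero. -/
theorem sum_even_frequencies {κ : ℂ} (hκ : κ ^ 2 = Complex.I) (η A B : ℂ) (L : ℝ) :
    (L + (η ^ 4 * A + η ^ 2 * B).re) + (L + ((κ * η) ^ 4 * A + (κ * η) ^ 2 * B).re) +
    (L + ((Complex.I * η) ^ 4 * A + (Complex.I * η) ^ 2 * B).re) +
    (L + ((Complex.I * κ * η) ^ 4 * A + (Complex.I * κ * η) ^ 2 * B).re) = 4 * L := by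
  have h4 : κ ^ 4 = -1 := by
    rw [show 4 = 2 * 2 by norm_num, pow_mul, hκ, Complex.I_sq]
  simp only [mul_pow, hκ, h4, Complex.I_sq, Complex.I_pow_four]
  simp only [Complex.add_re, Complex.mul_re, Complex.mul_im, Complex.neg_re, Complex.neg_im,
    Complex.one_re, Complex.one_im, Complex.I_re, Complex.I_im]
  ring

/-- The real part has the frequencies `±1, ±3, ±5`. Modulo `8` none of the others is congruent to
`1`, so a discrete Fourier transform over the eighth roots of unity isolates `Z`. As the expression
is odd, the four samples `1, κ, κ², κ³` with `κ⁴ = -1` are enough. -/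
theorem coeff_eq_zero_of_odd_frequencies {X Y Z : ℂ}
    (h : ∀ η : ℂ, ‖η‖ = 1 → (η ^ 5 * X + η ^ 3 * Y + η * Z).re = 0) : Z = 0 := by
  obtain ⟨κ, hκ1, hκ⟩ := exists_unimodular_sq_eq_I
  have h4 : κ ^ 4 = -1 := by
    rw [show 4 = 2 * 2 by norm_num, pow_mul, hκ, Complex.I_sq]
  set σ := starRingEnd ℂ
  have hre : ∀ w : ℂ, w.re = 0 → w + σ w = 0 := fun w hw => by
    rw [Complex.add_conj, hw]; simp
  have hκσ : σ κ = -κ ^ 3 := by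
    have h1 : κ * σ κ = 1 := unimodular_mul_conj hκ1
    linear_combination (-κ ^ 3) * h1 + σ κ * h4
  have h0 := hre _ (h 1 (by simp))
  have h1 := hre _ (h κ hκ1)
  have h2 := hre _ (h (κ ^ 2) (by simp [hκ1]))
  have h3 := hre _ (h (κ ^ 3) (by simp [hκ1]))
  simp only [map_add, map_mul, map_pow, hκσ, one_pow, one_mul] at h0 h1 h2 h3
  have red : ∀ j k : ℕ, κ ^ (4 * j + k) = (-1) ^ j * κ ^ k := fun j k => by rw [pow_add, pow_mul, h4]
  have p5 : κ ^ 5 = -κ := by rw [red 1 1]; ring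
  have p6 : κ ^ 6 = -κ ^ 2 := by rw [red 1 2]; ring
  have p9 : κ ^ 9 = κ := by rw [red 2 1]; ring
  have p10 : κ ^ 10 = κ ^ 2 := by rw [red 2 2]; ring
  have p15 : κ ^ 15 = -κ ^ 3 := by rw [red 3 3]; ring
  have p18 : κ ^ 18 = κ ^ 2 := by rw [red 4 2]; ring
  have p27 : κ ^ 27 = κ ^ 3 := by rw [red 6 3]; ring
  have p30 : κ ^ 30 = -κ ^ 2 := by rw [red 7 2]; ring
  have p45 : κ ^ 45 = -κ := by rw [red 11 1]; ring
  have n1 : -κ * X + κ ^ 3 * Y + κ * Z + κ ^ 3 * σ X - κ * σ Y - κ ^ 3 * σ Z = 0 := by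
    linear_combination h1 - X * p5 + σ X * p15 + σ Y * p9
  have n2 : κ ^ 2 * (X - Y + Z - σ X + σ Y - σ Z) = 0 := by
    linear_combination h2 - X * p10 - Y * p6 - σ X * p30 - σ Y * p18 - σ Z * p6
  have n3 : -κ ^ 3 * X + κ * Y + κ ^ 3 * Z + κ * σ X - κ ^ 3 * σ Y - κ * σ Z = 0 := by
    linear_combination h3 - X * p15 - Y * p9 + σ X * p45 + σ Y * p27 + σ Z * p9
  -- The weights `1, -κ³, -κ², -κ` of the samples are `κ⁰, κ⁻¹, κ⁻², κ⁻³`, the Fourier coefficient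
  -- at frequency one.
  linear_combination (1 / 4) * (h0 - κ ^ 3 * n1 - κ ^ 2 * n2 - κ * n3) -
    (1 / 4) * (X + (1 - κ ^ 2) * Y - 3 * Z + (1 - κ ^ 2) * σ X + σ Y + (1 + κ ^ 2) * σ Z) * h4

/-- The weighted Taylor coefficients up to weight five along the image of the boundary. -/
theorem germ_weightedPart {φ φ' : Param n → ℝ} {P₄ P₅ P₄' P₅' : MvPolynomial (Vars n) ℂ}
    (J : IsNormalFormJet φ P₄ P₅) (J' : IsNormalFormJet φ' P₄' P₅') {F : Space n → Space n}
    (hF : ContDiffAt ℝ ∞ F 0) (hF0 : F 0 = 0) {O : Set (Space n)} (hO : IsOpen O)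
    (h0 : (0 : Space n) ∈ closure O) (hFO : DifferentiableOn ℂ F O)
    {B : EuclideanSpace ℂ (Fin n) →L[ℂ] EuclideanSpace ℂ (Fin n)}
    {a : EuclideanSpace ℂ (Fin n)} {c : ℂ}
    (hsec : IsBigO 3 (fun Z : Space n =>
      F Z - (Z + (Z.2 • B Z.1 + Z.2 ^ 2 • a, c * Z.2 ^ 2))))
    (z : EuclideanSpace ℂ (Fin n)) :
    ∃ A₃₀ A₄₀ A₅₀ A₂₁ A₃₁ A₁₂ C₃₀ C₄₀ C₂₁ : ℂ, ∀ (u : ℝ) (η w₀ : ℂ), ‖η‖ = 1 →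
      w₀ = u + Complex.I * ((‖z‖ ^ 2 : ℝ) : ℂ) →
      let W := fun μ => weightedPart
        (fun x => definingFunction φ' (F (boundaryPoint φ x))) μ (η • z, u)
      (∀ μ < 3, W μ = 0) ∧ W 3 = (η ^ 3 * A₃₀).im ∧
      W 4 = ((evalAt (z, 0) P₄).re - (evalAt (z, 0) P₄').re +
        (c * w₀ ^ 2 + η ^ 4 * A₄₀ + η ^ 2 * w₀ * A₂₁).im -
        2 * (w₀ * inner ℂ z (B z) + η ^ 2 * C₃₀).re) ∧
      W 5 = ((evalAt (η • z, 0) P₅).re - (evalAt (η • z, 0) P₅').re +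
        (η ^ 5 * A₅₀ + η ^ 3 * w₀ * A₃₁ + η * w₀ ^ 2 * A₁₂).im -
        2 * ((starRingEnd ℂ) η * w₀ ^ 2 * inner ℂ z a + η ^ 3 * C₄₀ + η * w₀ * C₂₁).re) := by
  obtain ⟨A₃₀, A₄₀, A₅₀, A₂₁, A₃₁, A₁₂, C₃₀, C₄₀, C₂₁, h⟩ :=
    germ_expansion J J' hF hO h0 hFO B a c hsec z
  refine ⟨A₃₀, A₄₀, A₅₀, A₂₁, A₃₁, A₁₂, C₃₀, C₄₀, C₂₁, fun u η w₀ hη hw₀ => ?_⟩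
  have h1 := h u η w₀ hη hw₀
  set e₃ := (η ^ 3 * A₃₀).im
  set e₄ := ((evalAt (z, 0) P₄).re - (evalAt (z, 0) P₄').re +
        (c * w₀ ^ 2 + η ^ 4 * A₄₀ + η ^ 2 * w₀ * A₂₁).im -
        2 * (w₀ * inner ℂ z (B z) + η ^ 2 * C₃₀).re)
  set e₅ := ((evalAt (η • z, 0) P₅).re - (evalAt (η • z, 0) P₅').re +
        (η ^ 5 * A₅₀ + η ^ 3 * w₀ * A₃₁ + η * w₀ ^ 2 * A₁₂).im -
        2 * ((starRingEnd ℂ) η * w₀ ^ 2 * inner ℂ z a + η ^ 3 * C₄₀ + η * w₀ * C₂₁).re)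
  have h2 : ∀ μ ≤ 5, weightedPart (fun x => definingFunction φ' (F (boundaryPoint φ x))) μ
      (η • z, u) = if μ = 3 then e₃ else if μ = 4 then e₄ else if μ = 5 then e₅ else 0 :=
    fun μ hμ => weightedPart_eq_of_isBigO
      (contDiffAt_definingFunction_comp J.smooth J'.smooth J.map_zero hF hF0)
      (d := fun μ => if μ = 3 then e₃ else if μ = 4 then e₄ else if μ = 5 then e₅ else 0)
      (h1.congr_left fun t => by simp [Finset.sum_range_succ]) hμ
  refine ⟨fun μ hμ => ?_, ?_, ?_, ?_⟩
  · refine (h2 μ (by omega)).trans ?_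
    rw [if_neg (by omega), if_neg (by omega), if_neg (by omega)]
  · simpa using h2 3 (by norm_num)
  · simpa using h2 4 (by norm_num)
  · simpa using h2 5 (by norm_num)

theorem inner_map_eq_sum (z : EuclideanSpace ℂ (Fin n))
    (B : EuclideanSpace ℂ (Fin n) →L[ℂ] EuclideanSpace ℂ (Fin n)) :
    inner ℂ z (B z) = ∑ i, ∑ j, B (EuclideanSpace.single j 1) i * (z j * (starRingEnd ℂ) (z i)) := by
  have hz : z = ∑ j, z j • EuclideanSpace.single j (1 : ℂ) := by
    ext i
    simp [Finset.sum_apply, Pi.single_apply]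
  conv_lhs => rw [hz, map_sum, ← hz]
  simp only [PiLp.inner_apply, map_smul, WithLp.ofLp_sum, Finset.sum_apply, PiLp.smul_apply,
    RCLike.inner_apply, smul_eq_mul, Finset.sum_mul]
  refine Finset.sum_congr rfl fun i _ => Finset.sum_congr rfl fun j _ => ?_
  ring

/-- The matrix is `i (B - B*)`, whose Hermitian form is `-2 Im` of the form of `B`. This brings the
imaginary part into the range of the trace lemmas. -/
theorem evalAt_hermitianPoly (B : EuclideanSpace ℂ (Fin n) →L[ℂ] EuclideanSpace ℂ (Fin n))
    (x : Param n) :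
    evalAt x (hermitianPoly fun i j => Complex.I * (B (EuclideanSpace.single j 1) i -
      (starRingEnd ℂ) (B (EuclideanSpace.single i 1) j))) =
      ((-2 * (inner ℂ x.1 (B x.1)).im : ℝ) : ℂ) := by
  have h1 : ∀ w : ℂ, ((-2 * w.im : ℝ) : ℂ) = Complex.I * (w - (starRingEnd ℂ) w) := fun w => by
    apply Complex.ext
    · simp
      ring
    · simp
  rw [h1, inner_map_eq_sum, map_sum]
  simp only [map_sum, map_mul, Complex.conj_conj]
  conv_rhs => rw [Finset.sum_comm (f := fun i j => (starRingEnd ℂ) (B (EuclideanSpace.single j 1) i) * _)]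
  rw [← Finset.sum_sub_distrib, Finset.mul_sum]
  simp only [hermitianPoly, evalAt, map_sum, map_mul, eval_C, eval_X, Sum.elim_inl, Sum.elim_inr]
  refine Finset.sum_congr rfl fun i _ => ?_
  rw [← Finset.sum_sub_distrib, Finset.mul_sum]
  refine Finset.sum_congr rfl fun j _ => ?_
  ring

theorem quadratic_coeff_eq_zero {p q r : ℝ} (h : ∀ u : ℝ, p + q * u + r * u ^ 2 = 0) :
    p = 0 ∧ q = 0 ∧ r = 0 := by
  have h0 := h 0
  have h1 := h 1
  have h2 := h (-1)
  refine ⟨by linarith, by linarith, by linarith⟩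

theorem coeff_eq_zero_of_quadratic_nonneg {p q : ℝ} (h : ∀ u : ℝ, 0 ≤ p + q * u) : q = 0 := by
  by_contra hq
  have h1 := h (-(p + 1) / q)
  rw [mul_div_cancel₀ _ hq] at h1
  linarith

theorem mean_weightedPart₄ (ψ : ℝ) {s u : ℝ} {w₀ : ℂ} (hw₀ : w₀ = u + Complex.I * (s : ℂ))
    (b c : ℂ) : ψ + (c * w₀ ^ 2).im - 2 * (w₀ * b).re =
      (ψ - c.im * s ^ 2 + 2 * s * b.im) + (2 * s * c.re - 2 * b.re) * u + c.im * u ^ 2 := by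
  rw [hw₀]
  simp only [pow_two, Complex.add_re, Complex.add_im, Complex.mul_re, Complex.mul_im, Complex.I_re,
    Complex.I_im, Complex.ofReal_re, Complex.ofReal_im]
  ring

theorem weightedPart₄_eq (w₀ c A₄₀ A₂₁ b C₃₀ η : ℂ) (ψ : ℝ) :
    ψ + (c * w₀ ^ 2 + η ^ 4 * A₄₀ + η ^ 2 * w₀ * A₂₁).im - 2 * (w₀ * b + η ^ 2 * C₃₀).re =
      (ψ + (c * w₀ ^ 2).im - 2 * (w₀ * b).re) +
        (η ^ 4 * (-Complex.I * A₄₀) + η ^ 2 * (-Complex.I * w₀ * A₂₁ - 2 * C₃₀)).re := by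
  have h1 : ∀ w : ℂ, w.im = (-Complex.I * w).re := fun w => by simp
  have h2 : ∀ w : ℂ, 2 * w.re = (2 * w).re := fun w => by simp
  rw [h1, h2, h2, h1]
  simp only [← Complex.add_re, ← Complex.sub_re, add_sub_assoc, add_assoc]
  congr 2
  ring

end BoundaryJets

/-! ### Weights three and four: consequences for `B` and `c`. -/

namespace BoundaryJets

open Asymptotics Filter MvPolynomial

variable {n : ℕ}

/-- The local data of a boundary germ whose expansion starts with the identity and the quadratic
terms `w B z`, `w² a`, `c w²`. -/
structure IsNormalizedGerm (φ φ' : Param n → ℝ) (F : Space n → Space n)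
    (B : EuclideanSpace ℂ (Fin n) →L[ℂ] EuclideanSpace ℂ (Fin n))
    (a : EuclideanSpace ℂ (Fin n)) (c : ℂ) : Prop where
  exists_jet : ∃ P₄ P₅, IsNormalFormJet φ P₄ P₅
  exists_jet' : ∃ P₄ P₅, IsNormalFormJet φ' P₄ P₅
  contDiffAt : ContDiffAt ℝ ∞ F 0
  map_zero : F 0 = 0
  exists_open : ∃ O : Set (Space n), IsOpen O ∧ (0 : Space n) ∈ closure O ∧ DifferentiableOn ℂ F O
  second_order : IsBigO 3 (fun Z : Space n =>
      F Z - (Z + (Z.2 • B Z.1 + Z.2 ^ 2 • a, c * Z.2 ^ 2)))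
  nonneg : ∀ᶠ x in 𝓝 (0 : Param n), 0 ≤ definingFunction φ' (F (boundaryPoint φ x))

theorem IsBoundaryGerm.isNormalizedGerm {N : ℕ∞} (hN : 5 ≤ N) {D D' : Set (Space n)}
    {φ φ' : Param n → ℝ} (hD : HasNormalForm N D φ) (hD' : HasNormalForm N D' φ')
    {F : Space n → Space n} (hF : IsBoundaryGerm D D' 0 0 F)
    {B : EuclideanSpace ℂ (Fin n) →L[ℂ] EuclideanSpace ℂ (Fin n)}
    {a : EuclideanSpace ℂ (Fin n)} {c : ℂ} (hsec : IsBigO 3 (fun Z : Space n =>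
      F Z - (Z + (Z.2 • B Z.1 + Z.2 ^ 2 • a, c * Z.2 ^ 2)))) :
    IsNormalizedGerm φ φ' F B a c := by
  obtain ⟨P₄, P₅, J⟩ := hD.exists_jet hN
  exact ⟨⟨P₄, P₅, J⟩, hD'.exists_jet hN, contDiffAt_germ hF, hF.1,
    exists_open_holomorphic hD J.map_zero hF, hsec,
    eventually_definingFunction_nonneg hD hD' J.map_zero hF⟩

namespace IsNormalizedGerm

variable {φ φ' : Param n → ℝ} {F : Space n → Space n}
  {B : EuclideanSpace ℂ (Fin n) →L[ℂ] EuclideanSpace ℂ (Fin n)}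
  {a : EuclideanSpace ℂ (Fin n)} {c : ℂ}

theorem contDiffAt_comp (h : IsNormalizedGerm φ φ' F B a c) :
    ContDiffAt ℝ ∞ (fun x => definingFunction φ' (F (boundaryPoint φ x))) 0 := by
  obtain ⟨P₄, P₅, J⟩ := h.exists_jet
  obtain ⟨P₄', P₅', J'⟩ := h.exists_jet'
  exact contDiffAt_definingFunction_comp J.smooth J'.smooth J.map_zero h.contDiffAt h.map_zero

theorem exists_weightedPart (h : IsNormalizedGerm φ φ' F B a c)
    {P₄ P₅ P₄' P₅' : MvPolynomial (Vars n) ℂ}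
    (J : IsNormalFormJet φ P₄ P₅) (J' : IsNormalFormJet φ' P₄' P₅')
    (z : EuclideanSpace ℂ (Fin n)) :
    ∃ A₃₀ A₄₀ A₅₀ A₂₁ A₃₁ A₁₂ C₃₀ C₄₀ C₂₁ : ℂ, ∀ (u : ℝ) (η w₀ : ℂ), ‖η‖ = 1 →
      w₀ = u + Complex.I * ((‖z‖ ^ 2 : ℝ) : ℂ) →
      let W := fun μ => weightedPart
        (fun x => definingFunction φ' (F (boundaryPoint φ x))) μ (η • z, u)
      (∀ μ < 3, W μ = 0) ∧ W 3 = (η ^ 3 * A₃₀).im ∧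
      W 4 = ((evalAt (z, 0) P₄).re - (evalAt (z, 0) P₄').re +
        (c * w₀ ^ 2 + η ^ 4 * A₄₀ + η ^ 2 * w₀ * A₂₁).im -
        2 * (w₀ * inner ℂ z (B z) + η ^ 2 * C₃₀).re) ∧
      W 5 = ((evalAt (η • z, 0) P₅).re - (evalAt (η • z, 0) P₅').re +
        (η ^ 5 * A₅₀ + η ^ 3 * w₀ * A₃₁ + η * w₀ ^ 2 * A₁₂).im -
        2 * ((starRingEnd ℂ) η * w₀ ^ 2 * inner ℂ z a + η ^ 3 * C₄₀ + η * w₀ * C₂₁).re) := by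
  obtain ⟨O, hO, h0, hFO⟩ := h.exists_open
  exact germ_weightedPart J J' h.contDiffAt h.map_zero hO h0 hFO h.second_order z

/-- The mean of the weight four part over rotations of `z`. -/
theorem exists_mean (h : IsNormalizedGerm φ φ' F B a c)
    {P₄ P₅ P₄' P₅' : MvPolynomial (Vars n) ℂ}
    (J : IsNormalFormJet φ P₄ P₅) (J' : IsNormalFormJet φ' P₄' P₅')
    (z : EuclideanSpace ℂ (Fin n)) (u : ℝ) : ∃ κ : ℂ, ‖κ‖ = 1 ∧
    let W := fun η : ℂ => weightedPart
        (fun x => definingFunction φ' (F (boundaryPoint φ x))) 4 (η • z, u)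
    W 1 + W κ + W Complex.I + W (Complex.I * κ) =
      4 * (((evalAt (z, 0) (P₄ - P₄')).re - c.im * (‖z‖ ^ 2) ^ 2 +
          2 * ‖z‖ ^ 2 * (inner ℂ z (B z) : ℂ).im) +
        (2 * ‖z‖ ^ 2 * c.re - 2 * (inner ℂ z (B z) : ℂ).re) * u + c.im * u ^ 2) := by
  obtain ⟨A₃₀, A₄₀, A₅₀, A₂₁, A₃₁, A₁₂, C₃₀, C₄₀, C₂₁, hW⟩ := h.exists_weightedPart J J' z
  obtain ⟨κ, hκ1, hκ⟩ := exists_unimodular_sq_eq_I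
  refine ⟨κ, hκ1, ?_⟩
  have h1 := fun η hη => ((hW u η _ hη rfl).2.2.1).trans (weightedPart₄_eq _ _ _ _ _ _ _ _)
  intro W
  have h2 := sum_even_frequencies hκ 1 (-Complex.I * A₄₀)
    (-Complex.I * (u + Complex.I * ((‖z‖ ^ 2 : ℝ) : ℂ)) * A₂₁ - 2 * C₃₀)
    ((evalAt (z, 0) P₄).re - (evalAt (z, 0) P₄').re +
      (c * (u + Complex.I * ((‖z‖ ^ 2 : ℝ) : ℂ)) ^ 2).im -
      2 * ((u + Complex.I * ((‖z‖ ^ 2 : ℝ) : ℂ)) * inner ℂ z (B z)).re)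
  simp only [mul_one] at h2
  have k1 : W 1 = _ := h1 1 (by simp)
  have k2 : W κ = _ := h1 κ hκ1
  have k3 : W Complex.I = _ := h1 Complex.I (by simp)
  have k4 : W (Complex.I * κ) = _ := h1 (Complex.I * κ) (by simp [hκ1])
  rw [k1, k2, k3, k4, h2, mean_weightedPart₄ _ rfl, show evalAt (z, (0 : ℝ)) (P₄ - P₄') = evalAt (z, 0) P₄ -
    evalAt (z, 0) P₄' from map_sub _ _ _, Complex.sub_re]

/-- The rotational mean of the weight four part is a polynomial in `u` that vanishes identically.
Its coefficients give `Im c = 0` and equate the trace-free `P₄ - P₄'` with `‖z‖²` times the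
Hermitian form `-2 Im (inner ℂ z (B z))`, which must then be zero. -/
theorem im_inner_eq_zero (h : IsNormalizedGerm φ φ' F B a c)
    (h4 : ∀ x, weightedPart (fun x => definingFunction φ' (F (boundaryPoint φ x))) 4 x = 0)
    (z : EuclideanSpace ℂ (Fin n)) : (inner ℂ z (B z) : ℂ).im = 0 := by
  obtain ⟨P₄, P₅, J⟩ := h.exists_jet
  obtain ⟨P₄', P₅', J'⟩ := h.exists_jet'
  have h1 : ∀ z : EuclideanSpace ℂ (Fin n),
      (evalAt (z, 0) (P₄ - P₄')).re = ‖z‖ ^ 2 * (-2 * (inner ℂ z (B z) : ℂ).im) := by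
    intro z
    have h2 := quadratic_coeff_eq_zero fun u => by
      obtain ⟨κ, -, h3⟩ := h.exists_mean J J' z u
      simp only [h4, add_zero, zero_eq_mul] at h3
      exact h3.resolve_left (by norm_num)
    have h3 := h2.1
    rw [h2.2.2] at h3
    linarith
  have h2 : P₄ - P₄' = normSq n * hermitianPoly fun i j => Complex.I *
      (B (EuclideanSpace.single j 1) i - (starRingEnd ℂ) (B (EuclideanSpace.single i 1) j)) := by
    rw [← sub_eq_zero]
    refine eq_zero_of_evalAt_eq_zero fun x => ?_
    have e1 : ∀ P Q : MvPolynomial (Vars n) ℂ, evalAt x (P - Q) = evalAt x P - evalAt x Q :=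
      fun P Q => map_sub _ _ _
    have e2 : ∀ P Q : MvPolynomial (Vars n) ℂ, evalAt x (P * Q) = evalAt x P * evalAt x Q :=
      fun P Q => map_mul _ _ _
    rw [e1, e2, evalAt_hermitianPoly, evalAt_normSq, sub_eq_zero, ← Complex.ofReal_mul, ← h1]
    apply Complex.ext
    · rw [e1, Complex.ofReal_re, show evalAt (x.1, (0 : ℝ)) (P₄ - P₄') = evalAt (x.1, 0) P₄ -
        evalAt (x.1, 0) P₄' from map_sub _ _ _,
        evalAt_eq_of_support (fun m hm => (J.supp₄ m hm).2.2) x.1 0 x.2,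
        evalAt_eq_of_support (fun m hm => (J'.supp₄ m hm).2.2) x.1 0 x.2]
    · rw [e1, Complex.sub_im, J.im_evalAt₄, J'.im_evalAt₄, Complex.ofReal_im, sub_zero]
  have h3 := hermitianPoly_eq_zero (n := n) (by
    rw [← h2, map_sub, J.trace₄, J'.trace₄, sub_zero])
  have h4 := evalAt_hermitianPoly B (z, 0)
  rw [h3, show evalAt (z, (0 : ℝ)) (0 : MvPolynomial (Vars n) ℂ) = 0 by
    simp [evalAt]] at h4
  have h5 : -2 * (inner ℂ z (B z) : ℂ).im = 0 := by exact_mod_cast h4.symm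
  linarith

/-- Here the inequality `f ≥ 0` does the work: averaging preserves it, and a nonnegative trace-free
polynomial leaves no freedom. This yields the tangency and the shape of `B` and `c` together. -/
theorem vanishes_of_im_inner_eq_zero (hn : 1 ≤ n) (h : IsNormalizedGerm φ φ' F B a c)
    (him : ∀ z, (inner ℂ z (B z) : ℂ).im = 0) :
    VanishesToWeightedOrder 4 (fun x => definingFunction φ' (F (boundaryPoint φ x))) ∧
      c.im = 0 ∧ ∀ z, (inner ℂ z (B z) : ℂ) = c * ((‖z‖ ^ 2 : ℝ) : ℂ) := by
  obtain ⟨P₄, P₅, J⟩ := h.exists_jet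
  obtain ⟨P₄', P₅', J'⟩ := h.exists_jet'
  set f := fun x => definingFunction φ' (F (boundaryPoint φ x)) with hf
  have hsm : ContDiffAt ℝ ∞ f 0 := h.contDiffAt_comp
  have w0 : ∀ x, ∀ μ < 3, weightedPart f μ x = 0 := by
    intro x μ hμ
    obtain ⟨A₃₀, A₄₀, A₅₀, A₂₁, A₃₁, A₁₂, C₃₀, C₄₀, C₂₁, hW⟩ := h.exists_weightedPart J J' x.1
    have := (hW x.2 1 _ (by simp) rfl).1 μ hμ
    simpa only [one_smul] using this
  -- The lowest possible part is nonnegative, but in weight three it changes sign under `z ↦ -z`.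
  have w3 : ∀ x, weightedPart f 3 x = 0 := by
    intro x
    obtain ⟨A₃₀, A₄₀, A₅₀, A₂₁, A₃₁, A₁₂, C₃₀, C₄₀, C₂₁, hW⟩ := h.exists_weightedPart J J' x.1
    have h1 := (hW x.2 1 _ (by simp) rfl).2.1
    have h2 : weightedPart f 3 ((-1 : ℂ) • x.1, x.2) = _ := (hW x.2 (-1) _ (by simp) rfl).2.1
    simp only [one_smul] at h1
    have h3 := weightedPart_nonneg hsm h.nonneg (w0 x)
    have h4 := weightedPart_nonneg hsm h.nonneg (w0 ((-1 : ℂ) • x.1, x.2))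
    rw [h2] at h4
    change weightedPart f 3 x = _ at h1
    rw [show (-1 : ℂ) ^ 3 * A₃₀ = -((1 : ℂ) ^ 3 * A₃₀) by ring, Complex.neg_im] at h4
    linarith
  have w4 : ∀ x, 0 ≤ weightedPart f 4 x := fun x => weightedPart_nonneg hsm h.nonneg fun μ hμ => by
    rcases Nat.lt_succ_iff_lt_or_eq.1 hμ with h1 | rfl
    · exact w0 x μ h1
    · exact w3 x
  have hL : ∀ (z : EuclideanSpace ℂ (Fin n)) (u : ℝ), 0 ≤ ((evalAt (z, 0) (P₄ - P₄')).re -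
      c.im * (‖z‖ ^ 2) ^ 2 + 2 * ‖z‖ ^ 2 * (inner ℂ z (B z) : ℂ).im) +
        (2 * ‖z‖ ^ 2 * c.re - 2 * (inner ℂ z (B z) : ℂ).re) * u + c.im * u ^ 2 := by
    intro z u
    obtain ⟨κ, -, h3⟩ := h.exists_mean J J' z u
    have := w4 ((1 : ℂ) • z, u)
    have := w4 (κ • z, u)
    have := w4 (Complex.I • z, u)
    have := w4 ((Complex.I * κ) • z, u)
    simp only at h3
    linarith
  simp only [him, mul_zero, add_zero] at hL
  have hpc : ∀ z : EuclideanSpace ℂ (Fin n),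
      c.im * (‖z‖ ^ 2) ^ 2 ≤ (evalAt (z, 0) (P₄ - P₄')).re := fun z => by
    have := hL z 0
    simp only [mul_zero, add_zero, ne_eq, OfNat.ofNat_ne_zero, not_false_eq_true, zero_pow] at this
    linarith
  have hsupp : ∀ m ∈ (P₄ - P₄').support, ∑ i : Fin n, m (Sum.inl i) = 2 ∧
      ∑ i : Fin n, m (Sum.inr (Sum.inl i)) = 2 ∧ m (Sum.inr (Sum.inr ())) = 0 := by
    classical
    intro m hm
    rcases Finset.mem_union.1 (support_sub _ _ _ hm) with h1 | h1
    · exact J.supp₄ m h1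
    · exact J'.supp₄ m h1
  have hev0 : (evalAt ((0 : EuclideanSpace ℂ (Fin n)), (0 : ℝ)) (P₄ - P₄')).re = 0 := by
    have h1 : (P₄ - P₄').IsWeightedHomogeneous weight 4 :=
      (weightedHomogeneousSubmodule ℂ weight 4).sub_mem J.homogeneous₄ J'.homogeneous₄
    have h2 := evalAt_dilate h1 0 (0, 0)
    rw [dilate_zero] at h2
    change (evalAt 0 _).re = 0
    rw [h2]
    simp
  -- At `z = 0`, `u = 1` only the coefficient of `u²` survives.
  have hc0 : 0 ≤ c.im := by
    have := hL 0 1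
    rw [hev0] at this
    simpa using this
  have hψ : ∀ z : EuclideanSpace ℂ (Fin n), (evalAt (z, 0) (P₄ - P₄')).re = 0 :=
    re_evalAt_eq_zero_of_laplacian_eq_zero hsupp (by rw [map_sub, J.trace₄, J'.trace₄, sub_zero])
      fun z => le_trans (by positivity) (hpc z)
  -- A unit vector exists because `n ≥ 1`; there the bound `Im c · ‖z‖⁴ ≤ 0` reads `Im c ≤ 0`.
  have hc : c.im = 0 := by
    refine le_antisymm ?_ hc0
    have := hpc (EuclideanSpace.single ⟨0, hn⟩ 1)
    rw [hψ] at this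
    simpa using this
  have hre : ∀ z : EuclideanSpace ℂ (Fin n), (inner ℂ z (B z) : ℂ).re = ‖z‖ ^ 2 * c.re := by
    intro z
    have h1 := coeff_eq_zero_of_quadratic_nonneg (p := 0)
      (q := 2 * ‖z‖ ^ 2 * c.re - 2 * (inner ℂ z (B z) : ℂ).re) fun u => by
        have := hL z u
        rw [hψ, hc] at this
        linarith
    linarith
  refine ⟨fun μ hμ x => ?_, hc, fun z => ?_⟩
  · rcases Nat.lt_succ_iff_lt_or_eq.1 (Nat.lt_succ_of_le hμ) with h1 | rfl
    · rcases Nat.lt_succ_iff_lt_or_eq.1 h1 with h2 | rfl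
      · exact w0 x μ h2
      · exact w3 x
    -- The four rotated values are nonnegative and sum to zero, so the value at `x` itself, rotation
    -- by `1`, is zero.
    · obtain ⟨κ, -, h3⟩ := h.exists_mean J J' x.1 x.2
      rw [hψ, hc, hre, him] at h3
      have h5 := w4 ((1 : ℂ) • x.1, x.2)
      have h6 := w4 (κ • x.1, x.2)
      have h7 := w4 (Complex.I • x.1, x.2)
      have h8 := w4 ((Complex.I * κ) • x.1, x.2)
      simp only [one_smul] at h3 h5
      change _ = (0 : ℝ) 
      change 0 ≤ weightedPart f 4 x at h5
      have h9 : weightedPart f 4 (x.1, x.2) = weightedPart f 4 x := rfl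
      rw [h9] at h3
      nlinarith
  · apply Complex.ext
    · rw [hre, Complex.re_mul_ofReal, mul_comm]
    · rw [him, Complex.im_mul_ofReal, hc, zero_mul]

end IsNormalizedGerm

end BoundaryJets

/-! ### Weight five: vanishing of `a`, and the form of `B`. -/

namespace BoundaryJets

open Asymptotics Filter MvPolynomial

variable {n : ℕ}

theorem mem_support_bidegreePart {j k : ℕ} {P : MvPolynomial (Vars n) ℂ} {m : Vars n →₀ ℕ}
    (hm : m ∈ (bidegreePart j k P).support) : m ∈ P.support := by
  classical
  rw [mem_support_iff, bidegreePart, coeff_weightedHomogeneousComponent] at hm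
  rw [mem_support_iff]
  intro h
  rw [h, ite_self] at hm
  exact hm rfl

theorem bidegreePart_isWeightedHomogeneous (j k : ℕ) (P : MvPolynomial (Vars n) ℂ) :
    (bidegreePart j k P).IsWeightedHomogeneous bidegree (j, k) :=
  weightedHomogeneousComponent_isWeightedHomogeneous _ _

theorem IsNormalFormJet.eq_add₅ {φ : Param n → ℝ} {P₄ P₅ : MvPolynomial (Vars n) ℂ}
    (h : IsNormalFormJet φ P₄ P₅) : P₅ = bidegreePart 3 2 P₅ + bidegreePart 2 3 P₅ := by
  classical
  ext m
  rw [coeff_add, bidegreePart, bidegreePart, coeff_weightedHomogeneousComponent,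
    coeff_weightedHomogeneousComponent]
  by_cases hm : coeff m P₅ = 0
  · simp [hm]
  · have h1 := h.supp₅ m (mem_support_iff.2 hm)
    rw [weight_bidegree, weight_holDegree, weight_antiholDegree]
    rcases h1.1 with h2 | h2 <;> simp [h2.1, h2.2]

theorem IsNormalFormJet.evalAt_rotate₅ {φ : Param n → ℝ} {P₄ P₅ : MvPolynomial (Vars n) ℂ}
    (h : IsNormalFormJet φ P₄ P₅) {η : ℂ} (hη : ‖η‖ = 1) (z : EuclideanSpace ℂ (Fin n)) :
    evalAt (η • z, 0) P₅ = η * evalAt (z, 0) (bidegreePart 3 2 P₅) +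
      (starRingEnd ℂ) η * evalAt (z, 0) (bidegreePart 2 3 P₅) := by
  have h1 := unimodular_mul_conj hη
  conv_lhs => rw [h.eq_add₅, show evalAt (η • z, (0 : ℝ)) (bidegreePart 3 2 P₅ + bidegreePart 2 3 P₅)
    = evalAt (η • z, 0) (bidegreePart 3 2 P₅) + evalAt (η • z, 0) (bidegreePart 2 3 P₅)
    from map_add _ _ _, evalAt_rotate (bidegreePart_isWeightedHomogeneous 3 2 P₅),
    evalAt_rotate (bidegreePart_isWeightedHomogeneous 2 3 P₅)]
  linear_combination (η * evalAt (z, 0) (bidegreePart 3 2 P₅) + (starRingEnd ℂ) η *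
    evalAt (z, 0) (bidegreePart 2 3 P₅)) * (η * (starRingEnd ℂ) η + 1) * h1

/-- `P₅` is real-valued. Testing this at `z` and at `i z` compares the imaginary parts and the real
parts of the two bidegree components. -/
theorem IsNormalFormJet.evalAt_bidegreePart_conj {φ : Param n → ℝ}
    {P₄ P₅ : MvPolynomial (Vars n) ℂ} (h : IsNormalFormJet φ P₄ P₅)
    (z : EuclideanSpace ℂ (Fin n)) :
    (starRingEnd ℂ) (evalAt (z, 0) (bidegreePart 2 3 P₅)) =
      evalAt (z, 0) (bidegreePart 3 2 P₅) := by
  have h1 := h.im_evalAt₅ ((1 : ℂ) • z, 0)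
  have h2 := h.im_evalAt₅ (Complex.I • z, 0)
  rw [h.evalAt_rotate₅ (by simp)] at h1 h2
  simp at h1 h2
  apply Complex.ext
  · rw [Complex.conj_re]; linarith
  · rw [Complex.conj_im]; linarith

theorem IsNormalFormJet.re_evalAt_rotate₅ {φ : Param n → ℝ} {P₄ P₅ : MvPolynomial (Vars n) ℂ}
    (h : IsNormalFormJet φ P₄ P₅) {η : ℂ} (hη : ‖η‖ = 1) (z : EuclideanSpace ℂ (Fin n)) :
    (evalAt (η • z, 0) P₅).re = (2 * η * evalAt (z, 0) (bidegreePart 3 2 P₅)).re := by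
  rw [h.evalAt_rotate₅ hη, Complex.add_re, ← h.evalAt_bidegreePart_conj,
    ← Complex.conj_re ((starRingEnd ℂ) η * _), map_mul, Complex.conj_conj, ← Complex.add_re]
  congr 1
  ring

theorem weightedPart₅_eq (p p' η w₀ A₅₀ A₃₁ A₁₂ α C₄₀ C₂₁ : ℂ) :
    (2 * η * p).re - (2 * η * p').re + (η ^ 5 * A₅₀ + η ^ 3 * w₀ * A₃₁ + η * w₀ ^ 2 * A₁₂).im -
      2 * ((starRingEnd ℂ) η * w₀ ^ 2 * α + η ^ 3 * C₄₀ + η * w₀ * C₂₁).re =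
    (η ^ 5 * (-Complex.I * A₅₀) + η ^ 3 * (-Complex.I * w₀ * A₃₁ - 2 * C₄₀) +
      η * (2 * (p - p') - Complex.I * w₀ ^ 2 * A₁₂ -
        2 * (starRingEnd ℂ) (w₀ ^ 2 * α) - 2 * w₀ * C₂₁)).re := by
  have h1 : ∀ w : ℂ, w.im = (-Complex.I * w).re := fun w => by simp
  have h2 : ∀ w : ℂ, 2 * w.re = (2 * w).re := fun w => by simp
  have h3 : ((starRingEnd ℂ) η * w₀ ^ 2 * α).re = (η * (starRingEnd ℂ) (w₀ ^ 2 * α)).re := by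
    rw [← Complex.conj_re, mul_assoc, map_mul, Complex.conj_conj]
  rw [Complex.add_re, Complex.add_re, h3, ← Complex.add_re, ← Complex.add_re, h1, h2,
    ← Complex.sub_re, ← Complex.add_re, ← Complex.sub_re]
  congr 1
  ring

theorem quadratic_coeff_eq_zero_complex {p q r : ℂ} (h : ∀ u : ℝ, p + q * u + r * u ^ 2 = 0) :
    p = 0 ∧ q = 0 ∧ r = 0 := by
  have h0 := h 0
  have h1 := h 1
  have h2 := h (-1)
  push_cast at h0 h1 h2
  refine ⟨by linear_combination h0, by linear_combination (h1 - h2) / 2,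
    by linear_combination (h1 + h2) / 2 - h0⟩

theorem evalAt_linearPoly (a : EuclideanSpace ℂ (Fin n)) (x : Param n) :
    evalAt x (linearPoly fun i => (starRingEnd ℂ) (a i)) = (starRingEnd ℂ) (inner ℂ x.1 a : ℂ) := by
  rw [inner_conj_symm]
  simp [evalAt, linearPoly, PiLp.inner_apply, mul_comm]

namespace IsNormalizedGerm

variable {φ φ' : Param n → ℝ} {F : Space n → Space n}
  {B : EuclideanSpace ℂ (Fin n) →L[ℂ] EuclideanSpace ℂ (Fin n)}
  {a : EuclideanSpace ℂ (Fin n)} {c : ℂ}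

/-- The weight five part is nonnegative, as all lower parts vanish, and odd in `z`, so it is zero.
Its frequency-one coefficient is a polynomial of degree two in `u` whose three coefficients
determine the unknowns `A₁₂` and `C₂₁` and then the difference of the `(3, 2)` parts. -/
theorem evalAt_bidegreePart_sub (hn : 1 ≤ n) (h : IsNormalizedGerm φ φ' F B a c)
    (him : ∀ z, (inner ℂ z (B z) : ℂ).im = 0)
    {P₄ P₅ P₄' P₅' : MvPolynomial (Vars n) ℂ}
    (J : IsNormalFormJet φ P₄ P₅) (J' : IsNormalFormJet φ' P₄' P₅')
    (z : EuclideanSpace ℂ (Fin n)) :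
    evalAt (z, 0) (bidegreePart 3 2 P₅) - evalAt (z, 0) (bidegreePart 3 2 P₅') =
      -4 * ((‖z‖ ^ 2 : ℝ) : ℂ) ^ 2 * (starRingEnd ℂ) (inner ℂ z a : ℂ) := by
  obtain ⟨A₃₀, A₄₀, A₅₀, A₂₁, A₃₁, A₁₂, C₃₀, C₄₀, C₂₁, hW⟩ := h.exists_weightedPart J J' z
  have hv := (h.vanishes_of_im_inner_eq_zero hn him).1
  set f := fun x => definingFunction φ' (F (boundaryPoint φ x)) with hf
  have hpos : ∀ x, 0 ≤ weightedPart f 5 x := fun x =>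
    weightedPart_nonneg h.contDiffAt_comp h.nonneg fun μ hμ => hv μ (by omega) x
  have hZ : ∀ u : ℝ, 2 * (evalAt (z, 0) (bidegreePart 3 2 P₅) -
      evalAt (z, 0) (bidegreePart 3 2 P₅')) -
      Complex.I * (u + Complex.I * ((‖z‖ ^ 2 : ℝ) : ℂ)) ^ 2 * A₁₂ -
        2 * (starRingEnd ℂ) ((u + Complex.I * ((‖z‖ ^ 2 : ℝ) : ℂ)) ^ 2 * inner ℂ z a) -
        2 * (u + Complex.I * ((‖z‖ ^ 2 : ℝ) : ℂ)) * C₂₁ = 0 := by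
    intro u
    have hw : ∀ η : ℂ, ‖η‖ = 1 → weightedPart f 5 (η • z, u) = _ := fun η hη => by
      have := (hW u η _ hη rfl).2.2.2
      simp only [J.re_evalAt_rotate₅ hη, J'.re_evalAt_rotate₅ hη] at this
      exact this.trans (weightedPart₅_eq _ _ _ _ _ _ _ _ _ _)
    refine coeff_eq_zero_of_odd_frequencies (X := -Complex.I * A₅₀)
      (Y := -Complex.I * (u + Complex.I * ((‖z‖ ^ 2 : ℝ) : ℂ)) * A₃₁ - 2 * C₄₀) fun η hη => ?_
    have h1 := hpos (η • z, u)
    have h2 := hpos ((-η) • z, u)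
    rw [hw _ (by simpa using hη)] at h1 h2
    have e : ∀ X Y Z : ℂ, (-η) ^ 5 * X + (-η) ^ 3 * Y + (-η) * Z =
      -(η ^ 5 * X + η ^ 3 * Y + η * Z) := fun X Y Z => by ring
    rw [e, Complex.neg_re] at h2
    linarith
  set s : ℂ := ((‖z‖ ^ 2 : ℝ) : ℂ) with hs
  have hσs : (starRingEnd ℂ) s = s := Complex.conj_ofReal _
  set β := (starRingEnd ℂ) (inner ℂ z a : ℂ)
  set q := evalAt (z, 0) (bidegreePart 3 2 P₅) - evalAt (z, 0) (bidegreePart 3 2 P₅')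
  -- `A₁₂` and `C₂₁` do not depend on `u`, so the coefficients of `1`, `u`, `u²` may be set to zero
  -- separately.
  obtain ⟨h1, h2, h3⟩ := quadratic_coeff_eq_zero_complex
    (p := 2 * q + Complex.I * s ^ 2 * A₁₂ + 2 * s ^ 2 * β - 2 * Complex.I * s * C₂₁)
    (q := 2 * s * A₁₂ + 4 * Complex.I * s * β - 2 * C₂₁) (r := -Complex.I * A₁₂ - 2 * β) fun u => by
      have h1 := hZ u
      simp only [map_mul, map_pow, map_add, Complex.conj_ofReal, Complex.conj_I, hσs] at h1
      linear_combination h1 + (2 * s * u * A₁₂ + Complex.I * s ^ 2 * A₁₂ + 2 * s ^ 2 * β) *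
        Complex.I_sq
  have h4 : A₁₂ = 2 * Complex.I * β := by
    linear_combination Complex.I * h3 + A₁₂ * Complex.I_sq
  have h5 : C₂₁ = 4 * Complex.I * s * β := by
    rw [h4] at h2
    linear_combination -h2 / 2
  rw [h4, h5] at h1
  linear_combination h1 / 2 + (3 * s ^ 2 * β) * Complex.I_sq

/-- Both `(3, 2)` parts have vanishing double trace, whereas the double trace of `‖z‖⁴` times a
linear form is a nonzero multiple of that form. -/
theorem translation_eq_zero (hn : 1 ≤ n) (h : IsNormalizedGerm φ φ' F B a c)
    (him : ∀ z, (inner ℂ z (B z) : ℂ).im = 0) : a = 0 := by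
  obtain ⟨P₄, P₅, J⟩ := h.exists_jet
  obtain ⟨P₄', P₅', J'⟩ := h.exists_jet'
  have h1 : bidegreePart 3 2 P₅ - bidegreePart 3 2 P₅' =
      C (-4) * (normSq n * (normSq n * linearPoly fun i => (starRingEnd ℂ) (a i))) := by
    rw [← sub_eq_zero]
    refine eq_zero_of_evalAt_eq_zero fun x => ?_
    have e1 : ∀ P Q : MvPolynomial (Vars n) ℂ, evalAt x (P - Q) = evalAt x P - evalAt x Q :=
      fun P Q => map_sub _ _ _
    have e2 : ∀ P Q : MvPolynomial (Vars n) ℂ, evalAt x (P * Q) = evalAt x P * evalAt x Q :=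
      fun P Q => map_mul _ _ _
    have h2 := h.evalAt_bidegreePart_sub hn him J J' x.1
    rw [evalAt_eq_of_support (fun m hm => (J.supp₅ m (mem_support_bidegreePart hm)).2) x.1 0 x.2,
      evalAt_eq_of_support (fun m hm => (J'.supp₅ m (mem_support_bidegreePart hm)).2) x.1 0 x.2]
      at h2
    rw [e1, e1, e2, e2, e2, evalAt_linearPoly, evalAt_normSq, show evalAt x (C (-4)) = -4 by
      simp [evalAt], h2]
    ring
  have h2 : laplacian (laplacian (normSq n * (normSq n * linearPoly fun i =>
      (starRingEnd ℂ) (a i)))) = 0 := by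
    have h3 := congrArg (fun P => laplacian (laplacian P)) h1
    simp only [map_sub, J.trace₅, J'.trace₅, laplacian_C_mul, sub_zero] at h3
    refine (mul_eq_zero.1 h3.symm).resolve_left ?_
    rw [C_eq_zero]
    norm_num
  have h3 := eq_zero_of_linearPoly_eq_zero (linearPoly_eq_zero h2)
  ext i
  simpa using congrFun h3 i

/-- Over `ℂ` an operator is determined by its quadratic form, and that of `B` is `c ‖z‖²`. -/
theorem linear_part_eq (hn : 1 ≤ n) (h : IsNormalizedGerm φ φ' F B a c)
    (him : ∀ z, (inner ℂ z (B z) : ℂ).im = 0) (z : EuclideanSpace ℂ (Fin n)) : B z = c • z := by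
  have h1 := (h.vanishes_of_im_inner_eq_zero hn him).2.2
  have h2 : (B : EuclideanSpace ℂ (Fin n) →ₗ[ℂ] EuclideanSpace ℂ (Fin n)) - c • LinearMap.id = 0 := by
    rw [← inner_map_self_eq_zero]
    intro z
    rw [← inner_conj_symm]
    simp [inner_sub_right, inner_smul_right, h1]
  have h3 := LinearMap.congr_fun h2 z
  simpa [sub_eq_zero] using h3

end IsNormalizedGerm

end BoundaryJets

/-! ### Invariance under coordinate changes: flat germs are tangent. -/

namespace BoundaryJets

open Asymptotics Filter MvPolynomial

variable {n : ℕ}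

theorem contDiffAt_of_differentiableOn {E F : Type*} [NormedAddCommGroup E] [NormedSpace ℂ E]
    [FiniteDimensional ℂ E] [NormedAddCommGroup F] [NormedSpace ℂ F] [FiniteDimensional ℂ F]
    {f : E → F} {U : Set E} (hU : IsOpen U) {x : E} (hx : x ∈ U) (hf : DifferentiableOn ℂ f U) :
    ContDiffAt ℝ ∞ f x :=
  ((contDiffOn_of_differentiableOn hU hf).contDiffAt (hU.mem_nhds hx)).restrict_scalars ℝ

theorem IsLocalCoordinates.symm_zero {h : OpenPartialHomeomorph (Space n) (Space n)}
    (hh : IsLocalCoordinates h 0) : h.symm 0 = 0 := by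
  have := h.left_inv hh.1
  rwa [hh.2.1] at this

theorem IsLocalCoordinates.zero_mem_target {h : OpenPartialHomeomorph (Space n) (Space n)}
    (hh : IsLocalCoordinates h 0) : (0 : Space n) ∈ h.target := by
  have := h.map_source hh.1
  rwa [hh.2.1] at this

theorem mem_image_source_inter_iff {h : OpenPartialHomeomorph (Space n) (Space n)}
    {D : Set (Space n)} {Z : Space n} (hZ : Z ∈ h.source) :
    h Z ∈ h '' (h.source ∩ D) ↔ Z ∈ D := by
  constructor
  · rintro ⟨Y, ⟨hY, hYD⟩, he⟩
    rwa [← h.injOn hY hZ he]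
  · exact fun hD => ⟨Z, ⟨hZ, hD⟩, rfl⟩

/-- One inequality holds because `k` maps `D` into `D'`. If the value were positive, the image would
lie in `D'`, and the boundary point itself would lie in `D`. -/
theorem eventually_definingFunction_eq_zero {N : ℕ∞} {D D' : Set (Space n)} {φ φ' : Param n → ℝ}
    (hD : HasNormalForm N D φ) (hD' : HasNormalForm N D' φ') (hφ0 : φ 0 = 0)
    {k : Space n → Space n} {W : Set (Space n)} (hW : IsOpen W) (h0 : (0 : Space n) ∈ W)
    (hk : DifferentiableOn ℂ k W) (hk0 : k 0 = 0) (hiff : ∀ Z ∈ W, Z ∈ D ↔ k Z ∈ D') :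
    ∀ᶠ x in 𝓝 (0 : Param n), definingFunction φ' (k (boundaryPoint φ x)) = 0 := by
  have hks := contDiffAt_of_differentiableOn hW h0 hk
  have h1 := eventually_definingFunction_nonneg hD hD' hφ0 (F := k)
    ⟨hk0, W, hW, h0, fun Z hZ => (contDiffAt_of_differentiableOn hW hZ hk).contDiffWithinAt,
      hk.mono Set.inter_subset_left, fun Z hZ => (hiff Z hZ.1).1 hZ.2⟩
  have hγ : Tendsto (boundaryPoint φ) (𝓝 0) (𝓝 0) := by
    have := (contDiffAt_boundaryPoint hD.contDiffAt).continuousAt.tendsto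
    rwa [boundaryPoint_zero hφ0] at this
  have hk' : Tendsto k (𝓝 0) (𝓝 0) := by
    have := hks.continuousAt.tendsto
    rwa [hk0] at this
  filter_upwards [h1, hγ.eventually (hW.mem_nhds h0),
    hγ.eventually (eventually_mem_iff_definingFunction hD),
    (hk'.comp hγ).eventually (eventually_mem_iff_definingFunction hD')] with x hx hxW hxD hxD'
  refine le_antisymm (not_lt.1 fun hlt => ?_) hx
  have h2 := hxD.1 ((hiff _ hxW).2 (hxD'.2 hlt))
  rw [definingFunction_boundaryPoint] at h2
  exact lt_irrefl _ h2

theorem norm_sub_boundaryPoint (φ : Param n → ℝ) (Z : Space n) :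
    ‖Z - boundaryPoint φ (Z.1, Z.2.re)‖ = |definingFunction φ Z| := by
  have h1 : Z - boundaryPoint φ (Z.1, Z.2.re) =
      (0, Complex.I * ((definingFunction φ Z : ℝ) : ℂ)) := by
    refine Prod.ext (by simp [boundaryPoint]) ?_
    apply Complex.ext
    · simp [boundaryPoint, -Complex.ofReal_add, -Complex.ofReal_pow]
    · simp [boundaryPoint, definingFunction, -Complex.ofReal_add, -Complex.ofReal_pow,
        -Complex.ofReal_sub]
      ring
  rw [h1, Prod.norm_def]
  simp

theorem boundaryPoint_eq_of_definingFunction_eq_zero {φ : Param n → ℝ} {Z : Space n}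
    (h : definingFunction φ Z = 0) : boundaryPoint φ (Z.1, Z.2.re) = Z := by
  have h1 := norm_sub_boundaryPoint φ Z
  rw [h, abs_zero, norm_eq_zero, sub_eq_zero] at h1
  exact h1.symm

theorem gauge_pow_four_isBigO : (fun x : Param n => gauge x ^ 4) =O[𝓝 0] fun x => ‖x‖ ^ 2 := by
  have h1 : Tendsto (fun x : Param n => ‖x‖) (𝓝 0) (𝓝 0) := by
    simpa using (continuous_norm (E := Param n)).tendsto 0
  refine IsBigO.of_bound 1 ?_
  filter_upwards [h1.eventually_lt_const one_pos] with x hx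
  have h2 : gauge x ≤ √‖x‖ := by
    refine gauge_le_of (Real.sqrt_nonneg _) (Real.le_sqrt_of_sq_le ?_) ?_
    · have := norm_fst_le x
      nlinarith [norm_nonneg x.1]
    · rw [Real.sq_sqrt (norm_nonneg _)]
      exact norm_snd_le x
  rw [one_mul, Real.norm_of_nonneg (by have := gauge_nonneg x; positivity),
    Real.norm_of_nonneg (by positivity)]
  calc gauge x ^ 4 ≤ √‖x‖ ^ 4 := pow_le_pow_left₀ (gauge_nonneg _) h2 4
    _ = ‖x‖ ^ 2 := by
      rw [show 4 = 2 * 2 by norm_num, pow_mul, Real.sq_sqrt (norm_nonneg _)]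

theorem boundaryPoint_isBigO {φ : Param n → ℝ} (h : φ =O[𝓝 0] fun x => gauge x ^ 4) :
    (fun x => (boundaryPoint φ x).2) =O[𝓝 0] fun x => gauge x ^ 2 := by
  have h1 : (fun x : Param n => (x.2 : ℂ)) =O[𝓝 0] fun x => gauge x ^ 2 :=
    IsBigO.of_bound 1 (Eventually.of_forall fun x => by
      rw [Complex.norm_real, one_mul, Real.norm_eq_abs, Real.norm_of_nonneg (by positivity)]
      exact abs_snd_le_gauge_sq x)
  have h2 : (fun x : Param n => ‖x.1‖ ^ 2) =O[𝓝 0] fun x => gauge x ^ 2 :=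
    IsBigO.of_bound 1 (Eventually.of_forall fun x => by
      rw [one_mul, Real.norm_of_nonneg (by positivity), Real.norm_of_nonneg (by positivity)]
      exact pow_le_pow_left₀ (norm_nonneg _) (norm_fst_le_gauge x) 2)
  have h3 := h2.add (h.trans (isBigO_gauge_pow (show 2 ≤ 4 by norm_num)))
  exact h1.add ((IsBigO.trans (Complex.ofRealCLM.isBigO_comp _ _) h3).const_mul_left Complex.I)

theorem norm_boundaryPoint_isBigO {φ : Param n → ℝ} (h : φ =O[𝓝 0] fun x => gauge x ^ 4) :
    boundaryPoint φ =O[𝓝 0] gauge := by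
  refine IsBigO.prod_left (f' := fun x : Param n => (boundaryPoint φ x).1)
    (g' := fun x => (boundaryPoint φ x).2) ?_ ?_
  · exact IsBigO.of_bound 1 (Eventually.of_forall fun x => by
      rw [one_mul, Real.norm_of_nonneg (gauge_nonneg x)]
      exact norm_fst_le_gauge x)
  · simpa using (boundaryPoint_isBigO h).trans (isBigO_gauge_pow (show 1 ≤ 2 by norm_num))

theorem isBigO_sub_fderiv {f : Space n → Space n} {W : Set (Space n)} (hW : IsOpen W)
    (h0 : (0 : Space n) ∈ W) (hf : DifferentiableOn ℂ f W) (hf0 : f 0 = 0) :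
    (fun Z => f Z - fderiv ℂ f 0 Z) =O[𝓝 0] fun Z => ‖Z‖ ^ 2 := by
  have h1 := contDiffAt_infty.1 (contDiffAt_of_differentiableOn hW h0 hf) 2
  have h2 := taylor_isBigO (f := f) 1 (by exact_mod_cast h1)
  have h3 : fderiv ℝ f 0 = (fderiv ℂ f 0).restrictScalars ℝ :=
    (hf.differentiableAt (hW.mem_nhds h0)).fderiv_restrictScalars ℝ
  refine h2.congr_left fun Z => ?_
  simp [Finset.sum_range_succ, hf0, iteratedFDeriv_one_apply, h3]

/-- A local biholomorphism between two sets in normal form preserves the weighted filtration. -/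
theorem gauge_comp_isBigO {φ φ' : Param n → ℝ} (hφ : φ =O[𝓝 0] fun x => gauge x ^ 4)
    (hφ' : φ' =O[𝓝 0] fun x => gauge x ^ 4)
    {k : Space n → Space n} {W : Set (Space n)} (hW : IsOpen W) (h0 : (0 : Space n) ∈ W)
    (hk : DifferentiableOn ℂ k W) (hk0 : k 0 = 0)
    (hb : ∀ᶠ x in 𝓝 (0 : Param n), definingFunction φ' (k (boundaryPoint φ x)) = 0) :
    (fun x => gauge ((k (boundaryPoint φ x)).1, (k (boundaryPoint φ x)).2.re)) =O[𝓝 0] gauge := by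
  set y : Param n → Param n := fun x => ((k (boundaryPoint φ x)).1, (k (boundaryPoint φ x)).2.re)
  set L := fderiv ℂ k 0 with hL
  have hγ1 := norm_boundaryPoint_isBigO hφ
  have hγ : Tendsto (boundaryPoint φ) (𝓝 0) (𝓝 0) := hγ1.trans_tendsto tendsto_gauge
  have hR : (fun x => k (boundaryPoint φ x) - L (boundaryPoint φ x)) =O[𝓝 0]
      fun x => gauge x ^ 2 :=
    ((isBigO_sub_fderiv hW h0 hk hk0).comp_tendsto hγ).trans (hγ1.norm_left.pow 2)
  have hkγ : (fun x => k (boundaryPoint φ x)) =O[𝓝 0] gauge := by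
    refine ((hR.trans (isBigO_gauge_pow (show 1 ≤ 2 by norm_num))).add
      ((L.isBigO_comp _ _).trans (hγ1.trans (IsBigO.of_bound 1
        (Eventually.of_forall fun x => by simp))))).congr (fun x => ?_) fun x => pow_one _
    abel
  have hy1 : (fun x => (y x).1) =O[𝓝 0] gauge :=
    (isBigO_fst_prod' (f' := fun x => k (boundaryPoint φ x))).trans hkγ
  have hy2 : (fun x => (y x).2) =O[𝓝 0] gauge :=
    IsBigO.trans (Complex.reCLM.isBigO_comp _ _) (isBigO_snd_prod'.trans hkγ)
  have hy : y =O[𝓝 0] gauge := hy1.prod_left hy2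
  have hy0 : Tendsto y (𝓝 0) (𝓝 0) := hy.trans_tendsto tendsto_gauge
  -- the image has tangent space `Im w = 0`
  have hφy : (fun x => φ' (y x)) =O[𝓝 0] fun x => gauge x ^ 2 := by
    exact ((hφ'.trans gauge_pow_four_isBigO).comp_tendsto hy0).trans (hy.norm_left.pow 2)
  have him : (fun x => (k (boundaryPoint φ x)).2.im) =O[𝓝 0] fun x => gauge x ^ 2 := by
    refine ((hy1.norm_left.pow 2).add hφy).congr' ?_ EventuallyEq.rfl
    filter_upwards [hb] with x hx
    rw [definingFunction] at hx
    change ‖(k (boundaryPoint φ x)).1‖ ^ 2 + φ' ((k (boundaryPoint φ x)).1, (k (boundaryPoint φ x)).2.re) = _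
    linarith
  have hRw : (fun x => (k (boundaryPoint φ x)).2 - (L (boundaryPoint φ x)).2) =O[𝓝 0]
      fun x => gauge x ^ 2 :=
    (isBigO_snd_prod' (f' := fun x => k (boundaryPoint φ x) - L (boundaryPoint φ x))).trans hR
  have hsplit : ∀ x : Param n, (L (boundaryPoint φ x)).2 = (L (x.1, 0)).2 +
      (boundaryPoint φ x).2 * (L (0, 1)).2 := by
    intro x
    have h1 : boundaryPoint φ x = (x.1, 0) + (boundaryPoint φ x).2 • ((0, 1) : Space n) :=
      Prod.ext (by simp [boundaryPoint]) (by simp)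
    conv_lhs => rw [h1, map_add, map_smul]
    simp
  have hw' : (fun x => (boundaryPoint φ x).2 * (L (0, 1)).2) =O[𝓝 0] fun x => gauge x ^ 2 := by
    simpa [mul_comm] using (boundaryPoint_isBigO hφ).const_mul_left (L (0, 1)).2
  have hRw' : (fun x => (k (boundaryPoint φ x)).2 - (L (x.1, 0)).2) =O[𝓝 0]
      fun x => gauge x ^ 2 := by
    refine (hRw.add hw').congr_left fun x => ?_
    rw [hsplit]; ring
  have himL : (fun x : Param n => (L (x.1, 0)).2.im) =O[𝓝 0] fun x => gauge x ^ 2 := by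
    refine (him.sub (IsBigO.trans (Complex.imCLM.isBigO_comp _ _) hRw')).congr_left fun x => ?_
    simp
  -- On the image hypersurface `Im w` is quadratically small in the gauge, whereas `L` applied to
  -- `(z, 0)` is homogeneous of degree one, so this imaginary part vanishes.
  have himL0 : ∀ z : EuclideanSpace ℂ (Fin n), (L (z, 0)).2.im = 0 := by
    intro z
    have h1 := (himL.comp_tendsto (tendsto_dilate (z, 0))).mono
      (nhdsWithin_le_nhds (s := Set.Ioi 0))
    refine coeff_eq_zero_of_isBigO (d := fun j => if j = 1 then (L (z, 0)).2.im else 0) 2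
      ((h1.trans (IsBigO.of_bound (gauge (z, 0) ^ 2) (Eventually.of_forall fun t => ?_))).congr_left
        fun t => ?_) 1 (by norm_num) |> fun h => by simpa using h
    · simp only [Function.comp, gauge_dilate]
      rw [mul_pow, norm_mul, norm_pow, norm_pow]
      simp [mul_comm]
    · have h2 : ((dilate t (z, 0)).1, (0 : ℂ)) = (t : ℂ) • ((z, 0) : Space n) := by
        refine Prod.ext ?_ (by simp)
        simp [dilate]
      simp only [Function.comp, h2, map_smul, Prod.smul_snd, smul_eq_mul, Complex.im_ofReal_mul]
      simp
  -- A complex linear form with vanishing imaginary part is zero, as seen by testing at `i z`. Thus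
  -- the `w`-component of `k` has no linear term in `z` and keeps weight two.
  have hL0 : ∀ z : EuclideanSpace ℂ (Fin n), (L (z, 0)).2 = 0 := by
    intro z
    have h1 := himL0 (Complex.I • z)
    have h2 : ((Complex.I • z, 0) : Space n) = Complex.I • ((z, 0) : Space n) := by simp
    rw [h2, map_smul, Prod.smul_snd, smul_eq_mul, Complex.I_mul_im] at h1
    exact Complex.ext h1 (himL0 z)
  have hkw : (fun x => (k (boundaryPoint φ x)).2) =O[𝓝 0] fun x => gauge x ^ 2 :=
    hRw'.congr_left fun x => by rw [hL0, sub_zero]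
  obtain ⟨C₁, h1⟩ := hy1.bound
  obtain ⟨C₂, h2⟩ := hkw.bound
  refine IsBigO.of_bound (max |C₁| (|C₂| + 1)) ?_
  filter_upwards [h1, h2] with x h1 h2
  rw [Real.norm_of_nonneg (gauge_nonneg _)] at h1 ⊢
  rw [Real.norm_of_nonneg (pow_nonneg (gauge_nonneg _) 2)] at h2
  have hg := gauge_nonneg x
  rw [Real.norm_of_nonneg hg]
  refine gauge_le_of (by positivity) (h1.trans ?_) ?_
  · gcongr
    exact (le_abs_self _).trans (le_max_left _ _)
  · refine (Complex.abs_re_le_norm _).trans (h2.trans ?_)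
    rw [mul_pow]
    gcongr
    have h3 : |C₂| + 1 ≤ max |C₁| (|C₂| + 1) := le_max_right _ _
    have h4 : 0 ≤ |C₂| := abs_nonneg _
    have h5 := le_abs_self C₂
    nlinarith

/-- The defining functions of a set and of its image under local coordinates are comparable. -/
theorem exists_abs_definingFunction_le {N : ℕ∞} {D : Set (Space n)}
    {g : OpenPartialHomeomorph (Space n) (Space n)} (hg : IsLocalCoordinates g 0)
    {φ φ₁ : Param n → ℝ} (hD : HasNormalForm N D φ)
    (hD₁ : HasNormalForm N (g '' (g.source ∩ D)) φ₁) (hφ₁0 : φ₁ 0 = 0) :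
    ∃ K : ℝ, ∀ᶠ Z in 𝓝 (0 : Space n),
      |definingFunction φ Z| ≤ K * |definingFunction φ₁ (g Z)| := by
  have hsm := contDiffAt_of_differentiableOn g.open_target hg.zero_mem_target hg.2.2.2
  have h1 : ContDiffAt ℝ ∞ (fun Q => definingFunction φ (g.symm Q)) 0 :=
    ContDiffAt.comp (0 : Space n) (g := definingFunction φ)
      (by rw [hg.symm_zero]; exact contDiffAt_definingFunction hD.contDiffAt) hsm
  -- The function `ρ ∘ g⁻¹` is Lipschitz and vanishes on the image hypersurface, and the vertical
  -- distance of `g Z` from that hypersurface is the absolute value of the other defining function.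
  obtain ⟨K, t, ht, hK⟩ := (contDiffAt_infty.1 h1 1).exists_lipschitzOnWith
  have hb := eventually_definingFunction_eq_zero hD₁ hD hφ₁0 g.open_target hg.zero_mem_target
    hg.2.2.2 hg.symm_zero fun Z hZ => by
      conv_lhs => rw [← g.right_inv hZ]
      exact mem_image_source_inter_iff (g.map_target hZ)
  have hgc : Tendsto g (𝓝 0) (𝓝 0) := by
    have := (g.continuousAt hg.1).tendsto
    rwa [hg.2.1] at this
  have hp : Tendsto (fun Z : Space n => ((g Z).1, (g Z).2.re)) (𝓝 0) (𝓝 0) := by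
    have : Continuous fun Q : Space n => (Q.1, Q.2.re) := by fun_prop
    exact (this.tendsto 0).comp hgc
  have hγ : Tendsto (boundaryPoint φ₁) (𝓝 0) (𝓝 0) := by
    have := (contDiffAt_boundaryPoint hD₁.contDiffAt).continuousAt.tendsto
    rwa [boundaryPoint_zero hφ₁0] at this
  refine ⟨K, ?_⟩
  filter_upwards [hgc.eventually ht, (hγ.comp hp).eventually ht, hp.eventually hb,
    g.open_source.mem_nhds hg.1] with Z h1 h2 h3 h4
  have h5 := hK.dist_le_mul _ h1 _ h2
  simp only [Function.comp] at h5
  rw [g.left_inv h4, h3, dist_eq_norm, dist_eq_norm, norm_sub_boundaryPoint, sub_zero] at h5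
  exact h5

theorem conjugate_isBoundaryGerm {D D' : Set (Space n)} {F : Space n → Space n}
    (hF : IsBoundaryGerm D D' 0 0 F) {h g : OpenPartialHomeomorph (Space n) (Space n)}
    (hh : IsLocalCoordinates h 0) (hg : IsLocalCoordinates g 0) :
    IsBoundaryGerm (h '' (h.source ∩ D)) (g '' (g.source ∩ D')) 0 0
      (fun Z => g (F (h.symm Z))) := by
  obtain ⟨hF0, U, hU, h0U, hFs, hFh, hFm⟩ := hF
  refine ⟨by simp only [hh.symm_zero, hF0, hg.2.1], h.target ∩ h.symm ⁻¹' (U ∩ F ⁻¹' g.source),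
    h.symm.isOpen_inter_preimage (hFs.continuousOn.isOpen_inter_preimage hU g.open_source),
    ⟨hh.zero_mem_target, ?_⟩, ?_, ?_, ?_⟩
  · rw [Set.mem_preimage, hh.symm_zero]
    exact ⟨h0U, by rw [Set.mem_preimage, hF0]; exact hg.1⟩
  · intro Z hZ
    have h1 := contDiffAt_of_differentiableOn h.open_target hZ.1 hh.2.2.2
    have h2 := hFs.contDiffAt (hU.mem_nhds hZ.2.1)
    have h3 := contDiffAt_of_differentiableOn g.open_source hZ.2.2 hg.2.2.1
    exact (ContDiffAt.comp Z h3 (ContDiffAt.comp Z h2 h1)).contDiffWithinAt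
  · have hm : Set.MapsTo h.symm (h.target ∩ h.symm ⁻¹' (U ∩ F ⁻¹' g.source) ∩
        h '' (h.source ∩ D)) (U ∩ D) := by
      rintro Z ⟨⟨hZ, hZU, -⟩, Y, ⟨hY, hYD⟩, rfl⟩
      rw [h.left_inv hY] at hZU ⊢
      exact ⟨hZU, hYD⟩
    refine hg.2.2.1.comp (hFh.comp (hh.2.2.2.mono fun Z hZ => hZ.1.1) hm) fun Z hZ => hZ.1.2.2
  · rintro Z ⟨⟨hZ, hZU, hZg⟩, Y, ⟨hY, hYD⟩, rfl⟩
    simp only [Set.mem_preimage, h.left_inv hY] at hZU hZg ⊢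
    exact ⟨F Y, ⟨hZg, hFm ⟨hZU, hYD⟩⟩, rfl⟩

/-- In the flat coordinates the second order data `B`, `a`, `c` are zero, so
`vanishes_of_im_inner_eq_zero` applies trivially and the defining function is of order `gauge ^ 5`
along the image. Since `h` does not increase the order of the gauge along the boundary and the
defining functions are comparable under `g`, the estimate transfers. -/
theorem imageTangent_of_isFlat (hn : 1 ≤ n) {N : ℕ∞} (hN : 5 ≤ N) {D D' : Set (Space n)}
    {φ φ' : Param n → ℝ} (hD : HasNormalForm N D φ) (hD' : HasNormalForm N D' φ')
    {F : Space n → Space n} (hF : IsBoundaryGerm D D' 0 0 F) (hflat : IsFlat N 2 D D' 0 0 F) :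
    ImageTangentToOrder 4 φ φ' F := by
  obtain ⟨h, g, hh, hg, ⟨φ₁, hD₁⟩, ⟨φ₁', hD₁'⟩, hsec⟩ := hflat
  obtain ⟨_, _, J⟩ := hD.exists_jet hN
  obtain ⟨_, _, J'⟩ := hD'.exists_jet hN
  obtain ⟨_, _, J₁⟩ := hD₁.exists_jet hN
  obtain ⟨_, _, J₁'⟩ := hD₁'.exists_jet hN
  have hG : IsNormalizedGerm φ₁ φ₁' (fun Z => g (F (h.symm Z))) 0 0 0 :=
    (conjugate_isBoundaryGerm hF hh hg).isNormalizedGerm hN hD₁ hD₁' (by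
      simpa [show ((0 : EuclideanSpace ℂ (Fin n)), (0 : ℂ)) = 0 from rfl] using hsec)
  have h1 := isBigO_gauge_of_vanishes hG.contDiffAt_comp
    (hG.vanishes_of_im_inner_eq_zero hn fun z => by simp).1
  have hb := eventually_definingFunction_eq_zero hD hD₁ J.map_zero h.open_source hh.1 hh.2.2.1
    hh.2.1 fun Z hZ => (mem_image_source_inter_iff hZ).symm
  have hgauge := gauge_comp_isBigO J.isBigO J₁.isBigO h.open_source hh.1 hh.2.2.1 hh.2.1 hb
  set y : Param n → Param n := fun x => ((h (boundaryPoint φ x)).1, (h (boundaryPoint φ x)).2.re)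
  have hγ : Tendsto (boundaryPoint φ) (𝓝 0) (𝓝 0) :=
    (norm_boundaryPoint_isBigO J.isBigO).trans_tendsto tendsto_gauge
  have hy0 : Tendsto y (𝓝 0) (𝓝 0) := by
    have h2 : Tendsto h (𝓝 0) (𝓝 0) := by
      have := (h.continuousAt hh.1).tendsto
      rwa [hh.2.1] at this
    have h3 : Continuous fun Q : Space n => (Q.1, Q.2.re) := by fun_prop
    exact (h3.tendsto 0).comp (h2.comp hγ)
  have h2 := (h1.comp_tendsto hy0).trans (hgauge.pow 5)
  obtain ⟨K, hK⟩ := exists_abs_definingFunction_le hg hD' hD₁' J₁'.map_zero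
  have hFγ : Tendsto (fun x => F (boundaryPoint φ x)) (𝓝 0) (𝓝 0) := by
    have h3 := (contDiffAt_germ hF).continuousAt.tendsto
    rw [hF.1] at h3
    exact h3.comp hγ
  have h3 : (fun x => definingFunction φ' (F (boundaryPoint φ x))) =O[𝓝 0]
      fun x => gauge x ^ (4 + 1) := by
    refine IsBigO.trans (IsBigO.of_bound K ?_) h2
    filter_upwards [hFγ.eventually hK, hb, hγ.eventually (h.open_source.mem_nhds hh.1)]
      with x hx hx1 hx2
    simp only [Function.comp, y]
    rwa [boundaryPoint_eq_of_definingFunction_eq_zero hx1, h.left_inv hx2]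
  intro μ hμ x
  exact weightedPart_eq_zero_of_isBigO (contDiffAt_definingFunction_comp J.smooth J'.smooth
    J.map_zero (contDiffAt_germ hF) hF.1) h3 hμ x

end BoundaryJets

/-! ### A smooth implicit function theorem that also controls sides. -/

namespace BoundaryJets

open Asymptotics Filter

theorem exists_implicit_of_fderiv_eq_one {E : Type*} [NormedAddCommGroup E] [NormedSpace ℝ E]
    [CompleteSpace E] {H : E × ℝ → ℝ} {W : Set (E × ℝ)} (hW : IsOpen W) (h0 : (0 : E × ℝ) ∈ W)
    (hH : ContDiffOn ℝ ∞ H W) (hH0 : H 0 = 0) (hd : fderiv ℝ H 0 = ContinuousLinearMap.snd ℝ E ℝ) :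
    ∃ ψ : E → ℝ, (∃ V : Set E, IsOpen V ∧ (0 : E) ∈ V ∧ ContDiffOn ℝ ∞ ψ V) ∧ ψ 0 = 0 ∧
      (∀ᶠ x in 𝓝 0, H (x, ψ x) = 0) ∧ ∀ᶠ p : E × ℝ in 𝓝 0, 0 < H p ↔ ψ p.1 < p.2 := by
  have hHat : ∀ p ∈ W, ContDiffAt ℝ ∞ H p := fun p hp => hH.contDiffAt (hW.mem_nhds hp)
  set Φ : E × ℝ → E × ℝ := fun p => (p.1, H p) with hΦ
  have hΦat : ∀ p ∈ W, ContDiffAt ℝ ∞ Φ p := fun p hp => contDiffAt_fst.prodMk (hHat p hp)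
  -- This is stated for every functional with `L (0, 1) ≠ 0`: the inverse map must be smooth at all
  -- points near `0`, not just at `0`, so the derivative has to be inverted there too.
  have hequiv : ∀ L : E × ℝ →L[ℝ] ℝ, L (0, 1) ≠ 0 →
      ∃ e : (E × ℝ) ≃L[ℝ] (E × ℝ),
        (e : E × ℝ →L[ℝ] E × ℝ) = (ContinuousLinearMap.fst ℝ E ℝ).prod L := by
    intro L hL
    refine ⟨ContinuousLinearEquiv.equivOfInverse ((ContinuousLinearMap.fst ℝ E ℝ).prod L)
      ((ContinuousLinearMap.fst ℝ E ℝ).prod ((L (0, 1))⁻¹ • (ContinuousLinearMap.snd ℝ E ℝ -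
        (L.comp ((ContinuousLinearMap.inl ℝ E ℝ).comp (ContinuousLinearMap.fst ℝ E ℝ)))))) ?_ ?_,
      rfl⟩
    · intro p
      have h1 : L p = L (p.1, 0) + p.2 * L (0, 1) := by
        have : p = (p.1, 0) + p.2 • ((0, 1) : E × ℝ) := by ext <;> simp
        conv_lhs => rw [this, map_add, map_smul, smul_eq_mul]
      refine Prod.ext rfl ?_
      simp only [ContinuousLinearMap.prod_apply, _root_.smul_apply,
        _root_.sub_apply, ContinuousLinearMap.comp_apply,
        ContinuousLinearMap.coe_fst', ContinuousLinearMap.coe_snd',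
        ContinuousLinearMap.inl_apply, smul_eq_mul]
      rw [h1]
      field_simp
      ring
    · intro p
      have h1 : ∀ x s, L (x, s) = L (x, 0) + s * L (0, 1) := by
        intro x s
        have : (x, s) = (x, 0) + s • ((0, 1) : E × ℝ) := by ext <;> simp
        conv_lhs => rw [this, map_add, map_smul, smul_eq_mul]
      refine Prod.ext rfl ?_
      simp only [ContinuousLinearMap.prod_apply, _root_.smul_apply,
        _root_.sub_apply, ContinuousLinearMap.comp_apply,
        ContinuousLinearMap.coe_fst', ContinuousLinearMap.coe_snd',
        ContinuousLinearMap.inl_apply, smul_eq_mul]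
      rw [h1]
      field_simp
      ring
  have hΦd : ∀ p ∈ W, HasFDerivAt Φ ((ContinuousLinearMap.fst ℝ E ℝ).prod (fderiv ℝ H p)) p :=
    fun p hp => hasFDerivAt_fst.prodMk ((hHat p hp).differentiableAt (by simp)).hasFDerivAt
  obtain ⟨e₀, he₀⟩ := hequiv (fderiv ℝ H 0) (by rw [hd]; simp)
  have hstrict : HasStrictFDerivAt Φ (e₀ : E × ℝ →L[ℝ] E × ℝ) 0 := by
    refine (hΦat 0 h0).hasStrictFDerivAt' ?_ (by simp)
    rw [he₀]
    exact hΦd 0 h0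
  set Ψ := hstrict.toOpenPartialHomeomorph Φ with hΨ
  have hΨc : (Ψ : E × ℝ → E × ℝ) = Φ := hstrict.toOpenPartialHomeomorph_coe
  have hΦ0 : Φ 0 = 0 := by simp [hΦ, hH0]
  have hsrc : (0 : E × ℝ) ∈ Ψ.source := hstrict.mem_toOpenPartialHomeomorph_source
  have htgt : (0 : E × ℝ) ∈ Ψ.target := by
    have := Ψ.map_source hsrc
    rwa [hΨc, hΦ0] at this
  have hsymm0 : Ψ.symm 0 = 0 := by
    have := Ψ.left_inv hsrc
    rwa [hΨc, hΦ0] at this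
  -- the points where the inverse is smooth
  have hfd : ∀ᶠ p in 𝓝 (0 : E × ℝ), fderiv ℝ H p (0, 1) ≠ 0 := by
    have h1 : ContinuousAt (fun p => fderiv ℝ H p (0, 1)) 0 :=
      ((hHat 0 h0).fderiv_right (m := 0) (by simp)).continuousAt.clm_apply continuousAt_const
    refine h1.eventually_ne ?_
    rw [hd]; simp
  have hsymmc : ContinuousAt Ψ.symm 0 := Ψ.symm.continuousAt htgt
  have hgood : ∀ᶠ q in 𝓝 (0 : E × ℝ), ContDiffAt ℝ ∞ Ψ.symm q := by
    have h1 : Tendsto Ψ.symm (𝓝 0) (𝓝 0) := by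
      have := hsymmc.tendsto
      rwa [hsymm0] at this
    filter_upwards [h1.eventually hfd, h1.eventually (hW.mem_nhds h0), Ψ.open_target.mem_nhds htgt]
      with q hq1 hq2 hq3
    obtain ⟨e, he⟩ := hequiv _ hq1
    refine Ψ.contDiffAt_symm hq3 (f₀' := e) ?_ ?_
    · rw [he, hΨc]
      exact hΦd _ hq2
    · rw [hΨc]
      exact hΦat _ hq2
  have hι : Tendsto (fun x : E => (x, (0 : ℝ))) (𝓝 0) (𝓝 0) := by
    have : Continuous fun x : E => (x, (0 : ℝ)) := by fun_prop
    exact this.tendsto 0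
  set ψ : E → ℝ := fun x => (Ψ.symm (x, 0)).2 with hψ
  have hψs : ∀ᶠ x in 𝓝 (0 : E), ContDiffAt ℝ ∞ ψ x := by
    filter_upwards [hι.eventually hgood] with x hx
    exact contDiffAt_snd.comp x (hx.comp x (contDiffAt_id.prodMk contDiffAt_const))
  have hψ0 : ψ 0 = 0 := by
    change (Ψ.symm 0).2 = 0
    rw [hsymm0]; rfl
  have hgraph : ∀ᶠ x in 𝓝 (0 : E), H (x, ψ x) = 0 := by
    filter_upwards [hι.eventually (Ψ.open_target.mem_nhds htgt)] with x hx
    have h1 := Ψ.right_inv hx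
    rw [hΨc] at h1
    have h2 : (Ψ.symm (x, 0)).1 = x := congrArg Prod.fst h1
    have h3 : H (Ψ.symm (x, 0)) = 0 := congrArg Prod.snd h1
    rwa [show (x, ψ x) = Ψ.symm (x, 0) from Prod.ext h2.symm rfl]
  obtain ⟨V, hVs, hV, h0V⟩ := eventually_nhds_iff.1 hψs
  refine ⟨ψ, ⟨V, hV, h0V, fun x hx => (hVs x hx).contDiffWithinAt⟩, hψ0, hgraph, ?_⟩
  have hsd : HasStrictFDerivAt H (ContinuousLinearMap.snd ℝ E ℝ) 0 := by
    have := (hHat 0 h0).hasStrictFDerivAt (by simp)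
    rwa [hd] at this
  -- Near `0` the increments of `H` along a vertical segment differ from those of the coordinate by
  -- at most half, so the sign of `H` tells on which side of the graph a point lies.
  have hlip := hsd.isLittleO.bound (show (0 : ℝ) < 1 / 2 by norm_num)
  have hψc : Tendsto ψ (𝓝 0) (𝓝 0) := by
    have := (hVs 0 h0V).continuousAt.tendsto
    rwa [hψ0] at this
  have hfst : Tendsto (fun p : E × ℝ => p.1) (𝓝 0) (𝓝 0) := continuous_fst.tendsto 0
  have hpair : Tendsto (fun p : E × ℝ => (p, (p.1, ψ p.1))) (𝓝 0) (𝓝 ((0 : E × ℝ), (0 : E × ℝ))) :=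
    tendsto_id.prodMk_nhds (hfst.prodMk_nhds (hψc.comp hfst))
  filter_upwards [hpair.eventually hlip, hfst.eventually hgraph] with p hp1 hp2
  simp only [hp2, sub_zero] at hp1
  have h1 : p - (p.1, ψ p.1) = (0, p.2 - ψ p.1) := by ext <;> simp
  rw [h1] at hp1
  simp only [ContinuousLinearMap.coe_snd', Prod.norm_def, norm_zero, Real.norm_eq_abs] at hp1
  rw [max_eq_right (abs_nonneg _)] at hp1
  have h2 := abs_le.1 hp1
  constructor
  · intro h
    by_contra hle
    rw [abs_of_nonpos (by linarith)] at h2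
    linarith
  · intro h
    rw [abs_of_pos (by linarith)] at h2
    linarith

end BoundaryJets

/-! ### The action of projective maps on polynomials in low bidegree. -/

namespace BoundaryJets

open Asymptotics Filter MvPolynomial

variable {n : ℕ}

/-- The degree in `z` and `z̄` together. -/
def totalDegree (v : Vars n) : ℕ := holDegree v + antiholDegree v

theorem weight_totalDegree (m : Vars n →₀ ℕ) : Finsupp.weight totalDegree m =
    Finsupp.weight holDegree m + Finsupp.weight antiholDegree m := by
  simp only [Finsupp.weight_apply, Finsupp.sum, totalDegree, smul_add, Finset.sum_add_distrib]

theorem mem_orderIdeal_totalDegree {j k : ℕ} {p : MvPolynomial (Vars n) ℂ}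
    (h1 : p ∈ orderIdeal holDegree j) (h2 : p ∈ orderIdeal antiholDegree k) :
    p ∈ orderIdeal totalDegree (j + k) := fun m hm => by
  rw [weight_totalDegree]
  exact add_le_add (h1 m hm) (h2 m hm)

theorem normSq_mem_orderIdeal : normSq n ∈ orderIdeal totalDegree 2 := fun m hm => by
  have h := bidegree_normSq (n := n) hm
  rw [weight_bidegree, Prod.mk.injEq] at h
  rw [weight_totalDegree, h.1, h.2]

/-- The substitution `z ↦ A z`, `z̄ ↦ B z̄`, `u ↦ V`. -/
noncomputable def scaling (A B V : MvPolynomial (Vars n) ℂ) : Vars n → MvPolynomial (Vars n) ℂ :=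
  Sum.elim (fun i => X (Sum.inl i) * A)
    (Sum.elim (fun i => X (Sum.inr (Sum.inl i)) * B) fun _ => V)

theorem aeval_scaling_monomial (A B V : MvPolynomial (Vars n) ℂ) (m : Vars n →₀ ℕ) (a : ℂ) :
    aeval (scaling A B V) (monomial m a) =
      aeval (scaling 1 1 1) (monomial m a) *
        (A ^ (Finsupp.weight holDegree m) * B ^ (Finsupp.weight antiholDegree m) *
          V ^ m (Sum.inr (Sum.inr ()))) := by
  rw [aeval_monomial, aeval_monomial, weight_holDegree, weight_antiholDegree,
    Finsupp.prod_fintype _ _ (fun _ => pow_zero _), Finsupp.prod_fintype _ _ (fun _ => pow_zero _)]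
  simp only [Fintype.prod_sum_type, scaling, Sum.elim_inl, Sum.elim_inr, mul_pow,
    Finset.prod_mul_distrib, Finset.prod_pow_eq_pow_sum, mul_one, one_pow, Finset.prod_const_one, Finset.univ_unique,
    Finset.sum_singleton, PUnit.default_eq_unit]
  ring

theorem aeval_scaling_one_mem (m : Vars n →₀ ℕ) (a : ℂ) :
    aeval (scaling 1 1 1) (monomial m a) ∈ orderIdeal totalDegree
      (Finsupp.weight holDegree m + Finsupp.weight antiholDegree m) := by
  rw [← weight_totalDegree]
  refine aeval_mem_orderIdeal (fun v => ?_) (monomial_mem_orderIdeal _ m a)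
  rcases v with i | i | i
  · simpa [scaling] using X_mem_orderIdeal totalDegree (Sum.inl i)
  · simpa [scaling] using X_mem_orderIdeal totalDegree (Sum.inr (Sum.inl i))
  · exact orderIdeal_zero _ _

theorem scaling_mem_holDegree (A B V : MvPolynomial (Vars n) ℂ) (v : Vars n) :
    scaling A B V v ∈ orderIdeal holDegree (holDegree v) := by
  rcases v with i | i | i
  · exact Ideal.mul_mem_right _ _ (X_mem_orderIdeal holDegree (Sum.inl i))
  · exact orderIdeal_zero _ _
  · exact orderIdeal_zero _ _

theorem scaling_mem_antiholDegree (A B V : MvPolynomial (Vars n) ℂ) (v : Vars n) :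
    scaling A B V v ∈ orderIdeal antiholDegree (antiholDegree v) := by
  rcases v with i | i | i
  · exact orderIdeal_zero _ _
  · exact Ideal.mul_mem_right _ _ (X_mem_orderIdeal antiholDegree (Sum.inr (Sum.inl i)))
  · exact orderIdeal_zero _ _

/-- The indeterminate `u`. -/
noncomputable abbrev uVar : MvPolynomial (Vars n) ℂ := X (Sum.inr (Sum.inr ()))

/-- The trace conditions concern total degree at most six in `z`, `z̄`, so an error of degree seven
is harmless. A monomial of bidegree `(2, 2)` contributes degree four, and the linear term in `s`
cancels by the symmetry between `W` and `W'`, leaving a factor in `s²`. Any other monomial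
contributes degree at least five, and one factor `s` of degree two is enough. -/
theorem scaling_sub_mem_orderIdeal (c : ℂ) (ε : Polynomial ℂ) {s : MvPolynomial (Vars n) ℂ}
    (hs : s ∈ orderIdeal totalDegree 2) {W W' : MvPolynomial (Vars n) ℂ}
    (hW : W = uVar + C Complex.I * s) (hW' : W' = uVar - C Complex.I * s)
    {p : MvPolynomial (Vars n) ℂ} (hp : p ∈ orderIdeal holDegree 2)
    (hp' : p ∈ orderIdeal antiholDegree 2) :
    (1 - C c * W) * (1 - C c * W') * aeval (scaling (ε.aeval W) (ε.aeval W')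
        (C (1 / 2) * (W * ε.aeval W + W' * ε.aeval W'))) p -
      (1 - C c * uVar) ^ 2 * aeval (scaling (ε.aeval uVar) (ε.aeval uVar)
        (uVar * ε.aeval uVar)) p ∈ orderIdeal totalDegree 7 := by
  have half : ∀ J : Ideal (MvPolynomial (Vars n) ℂ),
      Ideal.Quotient.mk J (C (1 / 2)) + Ideal.Quotient.mk J (C (1 / 2)) = 1 := fun J => by
    rw [← map_add, ← C_add, add_halves, C_1, map_one]
  have haeval : ∀ (J : Ideal (MvPolynomial (Vars n) ℂ)) (Y : MvPolynomial (Vars n) ℂ),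
      Ideal.Quotient.mk J (ε.aeval Y) = ε.aeval (Ideal.Quotient.mk J Y) := fun J Y => by
    have := Polynomial.aeval_algHom_apply (Ideal.Quotient.mkₐ ℂ J) Y ε
    simpa using this.symm
  have key : ∀ m ∈ p.support, (1 - C c * W) * (1 - C c * W') *
      ((ε.aeval W) ^ (Finsupp.weight holDegree m) * (ε.aeval W') ^ (Finsupp.weight antiholDegree m) *
        (C (1 / 2) * (W * ε.aeval W + W' * ε.aeval W')) ^ m (Sum.inr (Sum.inr ()))) -
      (1 - C c * uVar) ^ 2 * ((ε.aeval uVar) ^ (Finsupp.weight holDegree m) *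
        (ε.aeval uVar) ^ (Finsupp.weight antiholDegree m) *
        (uVar * ε.aeval uVar) ^ m (Sum.inr (Sum.inr ()))) ∈
      orderIdeal totalDegree
        (7 - (Finsupp.weight holDegree m + Finsupp.weight antiholDegree m)) := by
    intro m hm
    have h1 := hp m (mem_support_iff.1 hm)
    have h2 := hp' m (mem_support_iff.1 hm)
    by_cases h3 : Finsupp.weight holDegree m = 2 ∧ Finsupp.weight antiholDegree m = 2
    -- Bidegree `(2, 2)`: compute modulo degree four, where `s² = 0` and first order expansions are
    -- exact.
    · refine orderIdeal_mono (show _ ≤ 4 by omega) ?_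
      rw [h3.1, h3.2, ← Ideal.Quotient.eq]
      set J : Ideal (MvPolynomial (Vars n) ℂ) := orderIdeal totalDegree 4
      set π := Ideal.Quotient.mk J
      have haeval' : ∀ Y, π (ε.aeval Y) = ε.aeval (π Y) := haeval J
      have hs2 : (π (C Complex.I) * π s) ^ 2 = 0 := by
        rw [← map_mul, ← map_pow, Ideal.Quotient.eq_zero_iff_mem]
        exact pow_mem_orderIdeal (k := 2) (Ideal.mul_mem_left _ _ hs) 2
      have hEW : ε.aeval (π W) = ε.aeval (π uVar) +
          (Polynomial.derivative ε).aeval (π uVar) * (π (C Complex.I) * π s) := by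
        rw [hW, map_add, map_mul, Polynomial.aeval_add_of_sq_eq_zero _ _ _ hs2]
      have hEW' : ε.aeval (π W') = ε.aeval (π uVar) -
          (Polynomial.derivative ε).aeval (π uVar) * (π (C Complex.I) * π s) := by
        rw [hW', map_sub, map_mul, sub_eq_add_neg,
          Polynomial.aeval_add_of_sq_eq_zero _ _ _ (by linear_combination hs2)]
        ring
      have hh : π (C (1 / 2)) + π (C (1 / 2)) = 1 := half J
      simp only [map_mul, map_pow, map_sub, map_add, map_one, haeval', hEW, hEW']
      have hπW : π W = π uVar + π (C Complex.I) * π s := by rw [hW, map_add, map_mul]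
      have hπW' : π W' = π uVar - π (C Complex.I) * π s := by rw [hW', map_sub, map_mul]
      rw [hπW, hπW']
      set σ := π (C Complex.I) * π s
      set e := ε.aeval (π uVar)
      set e' := (Polynomial.derivative ε).aeval (π uVar)
      have hU : π (C (1 / 2)) * ((π uVar + σ) * (e + e' * σ) + (π uVar - σ) * (e - e' * σ)) =
          π uVar * e := by
        linear_combination (π uVar * e + e' * σ ^ 2) * hh + e' * hs2
      have hcu : (1 - π (C c) * (π uVar + σ)) * (1 - π (C c) * (π uVar - σ)) =
          (1 - π (C c) * π uVar) ^ 2 := by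
        linear_combination -(π (C c) ^ 2) * hs2
      have hE : (e + e' * σ) ^ 2 * (e - e' * σ) ^ 2 = e ^ 2 * e ^ 2 := by
        linear_combination (-2 * e ^ 2 * e' ^ 2 + e' ^ 4 * σ ^ 2) * hs2
      rw [hU, hcu, hE]
    -- All other bidegrees: compute modulo degree two, where `W` and `W'` both reduce to `u`.
    · refine orderIdeal_mono (show _ ≤ 2 by omega) ?_
      rw [← Ideal.Quotient.eq]
      set J : Ideal (MvPolynomial (Vars n) ℂ) := orderIdeal totalDegree 2
      set π := Ideal.Quotient.mk J
      have haeval' : ∀ Y, π (ε.aeval Y) = ε.aeval (π Y) := haeval J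
      have hs0 : π s = 0 := Ideal.Quotient.eq_zero_iff_mem.2 hs
      have hπW : π W = π uVar := by rw [hW, map_add, map_mul, hs0, mul_zero, add_zero]
      have hπW' : π W' = π uVar := by rw [hW', map_sub, map_mul, hs0, mul_zero, sub_zero]
      have hh : π (C (1 / 2)) + π (C (1 / 2)) = 1 := half J
      simp only [map_mul, map_pow, map_sub, map_add, map_one, haeval', hπW, hπW']
      have hU : π (C (1 / 2)) * (π uVar * ε.aeval (π uVar) + π uVar * ε.aeval (π uVar)) =
          π uVar * ε.aeval (π uVar) := by
        linear_combination (π uVar * ε.aeval (π uVar)) * hh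
      rw [hU]
      ring
  rw [p.as_sum]
  simp only [map_sum, Finset.mul_sum]
  rw [← Finset.sum_sub_distrib]
  refine Ideal.sum_mem _ fun m hm => ?_
  rw [aeval_scaling_monomial, aeval_scaling_monomial (ε.aeval uVar)]
  have h1 := mul_mem_orderIdeal (aeval_scaling_one_mem m (coeff m p)) (key m hm)
  refine orderIdeal_mono (show 7 ≤ (Finsupp.weight holDegree m + Finsupp.weight antiholDegree m) +
    (7 - (Finsupp.weight holDegree m + Finsupp.weight antiholDegree m)) by omega) ?_
  convert h1 using 1
  ring

theorem coeff_laplacian (Q : MvPolynomial (Vars n) ℂ) (m : Vars n →₀ ℕ) :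
    coeff m (laplacian Q) = ∑ α : Fin n,
      coeff (m + Finsupp.single (Sum.inl α) 1 + Finsupp.single (Sum.inr (Sum.inl α)) 1) Q *
        (m (Sum.inr (Sum.inl α)) + 1) * (m (Sum.inl α) + 1) := by
  rw [laplacian_apply, coeff_sum]
  refine Finset.sum_congr rfl fun α _ => ?_
  rw [coeff_pderiv, coeff_pderiv]
  simp

theorem laplacian_component (μ : ℕ) (Q : MvPolynomial (Vars n) ℂ) :
    laplacian (weightedHomogeneousComponent weight (μ + 2) Q) =
      weightedHomogeneousComponent weight μ (laplacian Q) := by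
  classical
  ext m
  rw [coeff_laplacian, coeff_weightedHomogeneousComponent, coeff_laplacian]
  have h1 : ∀ α : Fin n, Finsupp.weight weight (m + Finsupp.single (Sum.inl α) 1 +
      Finsupp.single (Sum.inr (Sum.inl α)) 1) = Finsupp.weight weight m + 2 := fun α => by
    rw [map_add, map_add, Finsupp.weight_single, Finsupp.weight_single]
    simp [weight]
  simp only [coeff_weightedHomogeneousComponent, h1, add_left_inj]
  split_ifs <;> simp

theorem laplacian_component_eq_zero {μ : ℕ} (hμ : μ < 2) (Q : MvPolynomial (Vars n) ℂ) :
    laplacian (weightedHomogeneousComponent weight μ Q) = 0 := by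
  classical
  ext m
  rw [coeff_laplacian, coeff_zero]
  refine Finset.sum_eq_zero fun α _ => ?_
  rw [coeff_weightedHomogeneousComponent, if_neg, zero_mul, zero_mul]
  rw [map_add, map_add, Finsupp.weight_single, Finsupp.weight_single]
  simp only [weight, Sum.elim_inl, Sum.elim_inr, smul_eq_mul]
  omega

theorem iterate_laplacian_component {r : ℕ} :
    ∀ {Q : MvPolynomial (Vars n) ℂ}, laplacian^[r] Q = 0 →
      ∀ μ, laplacian^[r] (weightedHomogeneousComponent weight μ Q) = 0 := by
  induction r with
  | zero => intro Q hQ μ; simp only [Function.iterate_zero, id] at hQ ⊢; rw [hQ, map_zero]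
  | succ r ih =>
    intro Q hQ μ
    rw [Function.iterate_succ_apply] at hQ ⊢
    rcases lt_or_ge μ 2 with h | h
    · rw [laplacian_component_eq_zero h]
      exact Function.iterate_fixed (map_zero _) r
    · obtain ⟨μ, rfl⟩ := Nat.exists_eq_add_of_le' h
      rw [laplacian_component]
      exact ih hQ μ

theorem pderiv_aeval_uVar (ε : Polynomial ℂ) {v : Vars n} (hv : v ≠ Sum.inr (Sum.inr ())) :
    pderiv v (ε.aeval (uVar : MvPolynomial (Vars n) ℂ)) = 0 := by
  rw [Derivation.map_aeval]
  rw [pderiv_X_of_ne (Ne.symm hv), smul_zero]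

theorem pderiv_scaling_hol (ε : Polynomial ℂ) (i : Fin n) (Q : MvPolynomial (Vars n) ℂ) :
    pderiv (Sum.inl i) (aeval (scaling (ε.aeval uVar) (ε.aeval uVar) (uVar * ε.aeval uVar)) Q) =
      ε.aeval uVar *
        aeval (scaling (ε.aeval uVar) (ε.aeval uVar) (uVar * ε.aeval uVar)) (pderiv (Sum.inl i) Q) := by
  classical
  have h0 := pderiv_aeval_uVar (n := n) ε (v := Sum.inl i) (by simp)
  induction Q using MvPolynomial.induction_on with
  | C a => simp
  | add p q hp hq => simp only [map_add, hp, hq, mul_add]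
  | mul_X p j hp =>
    rw [map_mul, Derivation.leibniz, Derivation.leibniz, hp, aeval_X, map_add, smul_eq_mul,
      smul_eq_mul, smul_eq_mul, smul_eq_mul, map_mul, map_mul, aeval_X]
    rcases j with j | j | j
    · by_cases hj : j = i
      · subst hj
        simp [scaling, Derivation.leibniz, h0]
        ring
      · simp [scaling, Derivation.leibniz, h0, hj]
        ring
    · simp [scaling, Derivation.leibniz, h0]
      ring
    · simp [scaling, Derivation.leibniz, h0]
      ring

theorem pderiv_scaling_antihol (ε : Polynomial ℂ) (i : Fin n) (Q : MvPolynomial (Vars n) ℂ) :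
    pderiv (Sum.inr (Sum.inl i))
        (aeval (scaling (ε.aeval uVar) (ε.aeval uVar) (uVar * ε.aeval uVar)) Q) =
      ε.aeval uVar * aeval (scaling (ε.aeval uVar) (ε.aeval uVar) (uVar * ε.aeval uVar))
        (pderiv (Sum.inr (Sum.inl i)) Q) := by
  classical
  have h0 := pderiv_aeval_uVar (n := n) ε (v := Sum.inr (Sum.inl i)) (by simp)
  induction Q using MvPolynomial.induction_on with
  | C a => simp
  | add p q hp hq => simp only [map_add, hp, hq, mul_add]
  | mul_X p j hp =>
    rw [map_mul, Derivation.leibniz, Derivation.leibniz, hp, aeval_X, map_add, smul_eq_mul,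
      smul_eq_mul, smul_eq_mul, smul_eq_mul, map_mul, map_mul, aeval_X]
    rcases j with j | j | j
    · simp [scaling, Derivation.leibniz, h0]
      ring
    · by_cases hj : j = i
      · subst hj
        simp [scaling, Derivation.leibniz, h0]
        ring
      · simp [scaling, Derivation.leibniz, h0, hj]
        ring
    · simp [scaling, Derivation.leibniz, h0]
      ring

/-- The operator `P(z, z̄, u) ↦ (1 - c u)² P(ε(u) z, ε(u) z̄, ε(u) u)`. -/
noncomputable def leadingOperator (c : ℂ) (ε : Polynomial ℂ) (P : MvPolynomial (Vars n) ℂ) :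
    MvPolynomial (Vars n) ℂ :=
  (1 - C c * uVar) ^ 2 *
    aeval (scaling (ε.aeval uVar) (ε.aeval uVar) (uVar * ε.aeval uVar)) P

theorem laplacian_mul_of_pderiv_eq_zero {f : MvPolynomial (Vars n) ℂ}
    (h1 : ∀ i, pderiv (Sum.inl i) f = 0) (h2 : ∀ i, pderiv (Sum.inr (Sum.inl i)) f = 0)
    (Q : MvPolynomial (Vars n) ℂ) : laplacian (f * Q) = f * laplacian Q := by
  simp only [laplacian_apply, Finset.mul_sum]
  refine Finset.sum_congr rfl fun i _ => ?_
  rw [Derivation.leibniz, h2, smul_zero, add_zero, smul_eq_mul, Derivation.leibniz, h1, smul_zero,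
    add_zero, smul_eq_mul]

/-- Functions of `u` are constants for the derivatives in `z` and `z̄`, so the chain rule produces
just a factor `ε(u)²` for each Laplacian. Vanishing iterated traces therefore stay zero. -/
theorem iterate_laplacian_leadingOperator (c : ℂ) (ε : Polynomial ℂ)
    (P : MvPolynomial (Vars n) ℂ) (r : ℕ) :
    laplacian^[r] (leadingOperator c ε P) = ε.aeval uVar ^ (2 * r) *
      leadingOperator c ε (laplacian^[r] P) := by
  induction r generalizing P with
  | zero => simp
  | succ r ih =>
    have h1 : ∀ v : Vars n, v ≠ Sum.inr (Sum.inr ()) →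
        pderiv v ((1 - C c * uVar : MvPolynomial (Vars n) ℂ) ^ 2) = 0 := fun v hv => by
      simp [Derivation.leibniz_pow, pderiv_X_of_ne (Ne.symm hv)]
    rw [Function.iterate_succ_apply', ih, leadingOperator, Function.iterate_succ_apply',
      laplacian_mul_of_pderiv_eq_zero (fun i => ?_) (fun i => ?_),
      laplacian_mul_of_pderiv_eq_zero (fun i => h1 _ (by simp)) (fun i => h1 _ (by simp)),
      leadingOperator]
    · have h2 : ∀ Q : MvPolynomial (Vars n) ℂ,
          laplacian (aeval (scaling (ε.aeval uVar) (ε.aeval uVar) (uVar * ε.aeval uVar)) Q) =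
          ε.aeval uVar ^ 2 *
            aeval (scaling (ε.aeval uVar) (ε.aeval uVar) (uVar * ε.aeval uVar)) (laplacian Q) := by
        intro Q
        simp only [laplacian_apply, map_sum, Finset.mul_sum]
        refine Finset.sum_congr rfl fun i _ => ?_
        rw [pderiv_scaling_antihol, Derivation.leibniz, pderiv_scaling_hol,
          pderiv_aeval_uVar ε (by simp)]
        simp only [smul_eq_mul, mul_zero, add_zero]
        ring
      rw [h2]
      ring
    · rw [Derivation.leibniz_pow, pderiv_aeval_uVar ε (by simp)]; simp
    · rw [Derivation.leibniz_pow, pderiv_aeval_uVar ε (by simp)]; simp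

/-- Only factors depending on `u` are introduced, and `u` has bidegree `(0, 0)`. -/
theorem bidegreePart_leadingOperator (c : ℂ) (ε : Polynomial ℂ) (j k : ℕ)
    (P : MvPolynomial (Vars n) ℂ) :
    bidegreePart j k (leadingOperator c ε P) = leadingOperator c ε (bidegreePart j k P) := by
  classical
  have hu : (uVar : MvPolynomial (Vars n) ℂ).IsWeightedHomogeneous bidegree 0 :=
    isWeightedHomogeneous_X _ _ _
  have hpow : ∀ f : Polynomial ℂ,
      (f.aeval (uVar : MvPolynomial (Vars n) ℂ)).IsWeightedHomogeneous bidegree 0 := by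
    intro f
    induction f using Polynomial.induction_on' with
    | add p q hp hq => rw [map_add]; exact hp.add hq
    | monomial l a =>
      rw [Polynomial.aeval_monomial, MvPolynomial.algebraMap_eq]
      simpa using (isWeightedHomogeneous_C bidegree a).mul (hu.pow l)
  have hc : ((1 - C c * uVar : MvPolynomial (Vars n) ℂ) ^ 2).IsWeightedHomogeneous bidegree 0 := by
    have := hpow ((1 - Polynomial.C c * Polynomial.X) ^ 2)
    simpa [MvPolynomial.algebraMap_eq] using this
  have hmono : ∀ (m : Vars n →₀ ℕ) (a : ℂ),
      (leadingOperator c ε (monomial m a)).IsWeightedHomogeneous bidegree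
        (Finsupp.weight bidegree m) := by
    intro m a
    have hq : ∀ v, (scaling (ε.aeval uVar) (ε.aeval uVar) (uVar * ε.aeval uVar) v :
        MvPolynomial (Vars n) ℂ).IsWeightedHomogeneous bidegree (bidegree v) := by
      rintro (i | i | i)
      · exact (bidegree_X_hol i).mul (hpow ε)
      · exact (bidegree_X_antihol i).mul (hpow ε)
      · exact hu.mul (hpow ε)
    have h1 := hc.mul ((isWeightedHomogeneous_C bidegree a).mul
      (IsWeightedHomogeneous.prod m.support _ _ fun v _ => (hq v).pow (m v)))
    rw [zero_add, zero_add] at h1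
    rw [leadingOperator, aeval_monomial, Finsupp.weight_apply]
    exact h1
  induction P using MvPolynomial.induction_on' with
  | monomial m a =>
    rw [bidegreePart, weightedHomogeneousComponent_of_mem (hmono m a), bidegreePart,
      weightedHomogeneousComponent_of_mem (isWeightedHomogeneous_monomial bidegree m a rfl)]
    split_ifs
    · rfl
    · simp [leadingOperator]
  | add p q hp hq =>
    simp only [bidegreePart, leadingOperator, map_add, mul_add] at hp hq ⊢
    rw [hp, hq]

end BoundaryJets

/-! ### Graphs moved by a projective map and their approximations. -/

namespace BoundaryJets

open Asymptotics Filter MvPolynomial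

variable {n : ℕ}

theorem Approx.polynomial {k : ℕ} {f : Param n → ℂ} {P : MvPolynomial (Vars n) ℂ}
    (hf : Approx k f P) (ε : Polynomial ℂ) : Approx k (fun x => ε.eval (f x)) (ε.aeval P) := by
  induction ε using Polynomial.induction_on' with
  | add p q hp hq => simpa using hp.add hq
  | monomial l a =>
    simpa [Polynomial.aeval_monomial, MvPolynomial.algebraMap_eq] using
      (Approx.const (n := n) k a).mul (hf.pow l)

/-- The truncated geometric series `∑ (c X) ^ m`. -/
noncomputable def geomPoly (c : ℂ) (k : ℕ) : Polynomial ℂ :=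
  ∑ m ∈ Finset.range (k + 1), (Polynomial.C c * Polynomial.X) ^ m

theorem Approx.inv_one_sub {k : ℕ} {f : Param n → ℂ} {P : MvPolynomial (Vars n) ℂ}
    (hf : Approx k f P) (hO : f =O[𝓝 0] fun x => gauge x ^ 2) (c : ℂ) :
    Approx k (fun x => (1 - c * f x)⁻¹) ((geomPoly c k).aeval P) := by
  have h0 : Tendsto f (𝓝 0) (𝓝 0) := hO.trans_tendsto (by simpa using (tendsto_gauge (n := n)).pow 2)
  have h1 : Tendsto (fun x => 1 - c * f x) (𝓝 0) (𝓝 1) := by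
    simpa using (h0.const_mul c).const_sub 1
  have h2 : (fun x => (1 - c * f x)⁻¹) =O[𝓝 0] fun _ => (1 : ℝ) := by
    have := h1.inv₀ one_ne_zero
    exact this.isBigO_one ℝ
  have h3 : (fun x => (c * f x) ^ (k + 1)) =O[𝓝 0] fun x => gauge x ^ (k + 1) := by
    refine ((hO.const_mul_left c).pow (k + 1)).trans ?_
    simp only [← pow_mul]
    exact isBigO_gauge_pow (by omega)
  have h4 := h3.mul h2
  simp only [mul_one] at h4
  refine (IsBigO.add (hf.polynomial (geomPoly c k)) h4).congr' ?_ EventuallyEq.rfl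
  filter_upwards [h1.eventually_ne one_ne_zero] with x hx
  have h5 : (geomPoly c k).eval (f x) = ∑ m ∈ Finset.range (k + 1), (c * f x) ^ m := by
    simp [geomPoly, Polynomial.eval_finsetSum]
  have h6 := mul_neg_geom_sum (c * f x) (k + 1)
  rw [h5]
  have h7 : (1 - c * f x) * (1 - c * f x)⁻¹ = 1 := mul_inv_cancel₀ hx
  have h8 : ∑ m ∈ Finset.range (k + 1), (c * f x) ^ m =
      (1 - (c * f x) ^ (k + 1)) * (1 - c * f x)⁻¹ := by
    rw [← h6]
    linear_combination (-∑ m ∈ Finset.range (k + 1), (c * f x) ^ m) * h7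
  rw [h8]
  ring

/-- The point `(z / (1 - r w), Re (w / (1 - r w)))`, for `(z, w)` on the hypersurface of `ψ`. -/
noncomputable def movedPoint (r : ℝ) (ψ : Param n → ℝ) (x : Param n) : Param n :=
  ((1 - r * (boundaryPoint ψ x).2)⁻¹ • x.1,
    ((1 - r * (boundaryPoint ψ x).2)⁻¹ * (boundaryPoint ψ x).2).re)

theorem tendsto_boundaryPoint_snd {ψ : Param n → ℝ} (hψ : ContinuousAt ψ 0) (h0 : ψ 0 = 0) :
    Tendsto (fun x => (boundaryPoint ψ x).2) (𝓝 0) (𝓝 0) := by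
  have h1 := (continuous_snd.continuousAt.comp (continuousAt_boundaryPoint hψ)).tendsto
  rw [Function.comp_apply, boundaryPoint_zero h0] at h1
  exact h1

theorem tendsto_movedPoint (r : ℝ) {ψ : Param n → ℝ} (hψ : ContinuousAt ψ 0) (h0 : ψ 0 = 0) :
    Tendsto (movedPoint r ψ) (𝓝 0) (𝓝 0) := by
  have h1 := tendsto_boundaryPoint_snd hψ h0
  have h2 : Tendsto (fun x => (1 - (r : ℂ) * (boundaryPoint ψ x).2)⁻¹) (𝓝 0) (𝓝 1) := by
    simpa using ((h1.const_mul (r : ℂ)).const_sub 1).inv₀ (by simp)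
  have h3 : Tendsto (fun x : Param n => x.1) (𝓝 0) (𝓝 0) := continuous_fst.tendsto 0
  have h4 := h2.smul h3
  have h5 := (Complex.continuous_re.tendsto _).comp (h2.mul h1)
  simp only [smul_zero, mul_zero, Complex.zero_re] at h4 h5
  exact h4.prodMk_nhds h5

theorem norm_boundaryPoint_snd_le (ψ : Param n → ℝ) (x : Param n) :
    ‖(boundaryPoint ψ x).2‖ ≤ 2 * gauge x ^ 2 + |ψ x| := by
  have h1 : ‖x.1‖ ^ 2 ≤ gauge x ^ 2 := pow_le_pow_left₀ (norm_nonneg _) (norm_fst_le_gauge x) 2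
  calc ‖(boundaryPoint ψ x).2‖ ≤ ‖(x.2 : ℂ)‖ + ‖Complex.I * ((‖x.1‖ ^ 2 + ψ x : ℝ) : ℂ)‖ :=
        norm_add_le _ _
    _ = |x.2| + |‖x.1‖ ^ 2 + ψ x| := by
        rw [norm_mul, Complex.norm_I, one_mul, Complex.norm_real, Complex.norm_real,
          Real.norm_eq_abs, Real.norm_eq_abs]
    _ ≤ gauge x ^ 2 + (gauge x ^ 2 + |ψ x|) := by
        refine add_le_add (abs_snd_le_gauge_sq x) ((abs_add_le _ _).trans ?_)
        rw [abs_of_nonneg (by positivity : 0 ≤ ‖x.1‖ ^ 2)]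
        linarith
    _ = _ := by ring

theorem eventually_gauge_movedPoint_sq_le (r : ℝ) {ψ : Param n → ℝ} (hψ : ContinuousAt ψ 0)
    (h0 : ψ 0 = 0) : ∀ᶠ x in 𝓝 (0 : Param n), ‖1 - (r : ℂ) * (boundaryPoint ψ x).2‖ ≤ 2 ∧
      gauge (movedPoint r ψ x) ^ 2 ≤ 4 * gauge x ^ 2 + 2 * |ψ x| := by
  have h1 := tendsto_boundaryPoint_snd hψ h0
  have h2 : Tendsto (fun x => 1 - (r : ℂ) * (boundaryPoint ψ x).2) (𝓝 0) (𝓝 1) := by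
    simpa using (h1.const_mul (r : ℂ)).const_sub 1
  have h3 := (h2.inv₀ one_ne_zero).norm
  have h4 := h2.norm
  rw [inv_one, norm_one] at h3
  rw [norm_one] at h4
  filter_upwards [h3.eventually_le_const one_lt_two, h4.eventually_le_const one_lt_two]
    with x hx1 hx2
  refine ⟨hx2, ?_⟩
  have h5 : gauge (movedPoint r ψ x) ≤ √(4 * gauge x ^ 2 + 2 * |ψ x|) := by
    have hg := gauge_nonneg x
    have ha := abs_nonneg (ψ x)
    refine gauge_le_of (Real.sqrt_nonneg _) (Real.le_sqrt_of_sq_le ?_) ?_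
    · rw [movedPoint, norm_smul]
      have : ‖(1 - (r : ℂ) * (boundaryPoint ψ x).2)⁻¹‖ * ‖x.1‖ ≤ 2 * gauge x :=
        mul_le_mul hx1 (norm_fst_le_gauge x) (norm_nonneg _) zero_le_two
      calc _ ≤ (2 * gauge x) ^ 2 := pow_le_pow_left₀ (by positivity) this 2
        _ ≤ _ := by nlinarith
    · rw [Real.sq_sqrt (by positivity)]
      refine (Complex.abs_re_le_norm _).trans ?_
      rw [norm_mul]
      calc _ ≤ 2 * (2 * gauge x ^ 2 + |ψ x|) :=
            mul_le_mul hx1 (norm_boundaryPoint_snd_le ψ x) (norm_nonneg _) zero_le_two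
        _ = _ := by ring
  calc _ ≤ √(4 * gauge x ^ 2 + 2 * |ψ x|) ^ 2 := pow_le_pow_left₀ (gauge_nonneg _) h5 2
    _ = _ := Real.sq_sqrt (by have := abs_nonneg (ψ x); positivity)

/-- The function `ψ` defines the image of the hypersurface of `φ` under `(z, w) ↦ (z, w) / (1 + r w)`. -/
def IsMovedGraph (r : ℝ) (φ ψ : Param n → ℝ) : Prop :=
  ∀ᶠ x in 𝓝 (0 : Param n),
    ψ x = ‖1 - (r : ℂ) * (boundaryPoint ψ x).2‖ ^ 2 * φ (movedPoint r ψ x)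

/-- A bootstrap: the graph equation gives `|ψ| ≤ 4 C (32 gauge⁴ + 8 |ψ|²)`. Since `ψ → 0`,
eventually `32 C |ψ| ≤ 1 / 2`, so the quadratic term is absorbed into the left-hand side, which
accounts for the constant `256 C`. -/
theorem IsMovedGraph.isBigO {r : ℝ} {φ ψ : Param n → ℝ} (h : IsMovedGraph r φ ψ)
    (hψ : ContinuousAt ψ 0) (h0 : ψ 0 = 0) (hφ : φ =O[𝓝 0] fun x => gauge x ^ 4) :
    ψ =O[𝓝 0] fun x => gauge x ^ 4 := by
  obtain ⟨C, hC0, hC⟩ := hφ.exists_pos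
  have hsmall : ∀ᶠ x in 𝓝 (0 : Param n), 32 * C * |ψ x| ≤ 1 / 2 := by
    have h1 : Tendsto (fun x => 32 * C * |ψ x|) (𝓝 0) (𝓝 0) := by
      have := (hψ.tendsto.abs).const_mul (32 * C)
      simpa [h0] using this
    exact h1.eventually_le_const (by norm_num)
  refine IsBigO.of_bound (256 * C) ?_
  filter_upwards [h, hsmall, eventually_gauge_movedPoint_sq_le r hψ h0,
    (tendsto_movedPoint r hψ h0).eventually hC.bound] with x hx h1 h2 h3
  rw [Real.norm_eq_abs, Real.norm_of_nonneg (pow_nonneg (gauge_nonneg _) 4)] at h3 ⊢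
  have hg := gauge_nonneg x
  have hg' := gauge_nonneg (movedPoint r ψ x)
  have ha := abs_nonneg (ψ x)
  have h4 : |ψ x| ≤ 4 * (C * gauge (movedPoint r ψ x) ^ 4) := by
    conv_lhs => rw [hx, abs_mul, abs_of_nonneg (by positivity : 0 ≤ ‖1 - (r : ℂ) *
      (boundaryPoint ψ x).2‖ ^ 2)]
    refine mul_le_mul ?_ h3 (abs_nonneg _) (by norm_num)
    calc _ ≤ (2 : ℝ) ^ 2 := pow_le_pow_left₀ (norm_nonneg _) h2.1 2
      _ = 4 := by norm_num
  have h5 : gauge (movedPoint r ψ x) ^ 4 ≤ 32 * gauge x ^ 4 + 8 * |ψ x| ^ 2 := by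
    calc gauge (movedPoint r ψ x) ^ 4 = (gauge (movedPoint r ψ x) ^ 2) ^ 2 := by ring
      _ ≤ (4 * gauge x ^ 2 + 2 * |ψ x|) ^ 2 := pow_le_pow_left₀ (by positivity) h2.2 2
      _ ≤ _ := by nlinarith [sq_nonneg (4 * gauge x ^ 2 - 2 * |ψ x|)]
  have h6 : |ψ x| ≤ 4 * (C * (32 * gauge x ^ 4 + 8 * |ψ x| ^ 2)) :=
    h4.trans (by gcongr)
  nlinarith

theorem IsMovedGraph.gauge_isBigO {r : ℝ} {ψ : Param n → ℝ} (hψ : ContinuousAt ψ 0)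
    (h0 : ψ 0 = 0) (hO : ψ =O[𝓝 0] fun x => gauge x ^ 4) :
    (fun x => gauge (movedPoint r ψ x)) =O[𝓝 0] gauge := by
  obtain ⟨C, hC0, hC⟩ := (hO.trans (isBigO_gauge_pow (show 2 ≤ 4 by norm_num))).exists_pos
  refine IsBigO.of_bound (√(4 + 2 * C)) ?_
  filter_upwards [eventually_gauge_movedPoint_sq_le r hψ h0, hC.bound] with x h2 h3
  rw [Real.norm_eq_abs, Real.norm_of_nonneg (pow_nonneg (gauge_nonneg _) 2)] at h3
  rw [Real.norm_of_nonneg (gauge_nonneg _), Real.norm_of_nonneg (gauge_nonneg _)]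
  refine abs_le_of_sq_le_sq' ?_ (by have := gauge_nonneg x; positivity) |>.2
  rw [mul_pow, Real.sq_sqrt (by positivity)]
  linarith [h2.2]

/-- The graph equation is substituted into itself: `W`, `W'` approximate `w` and its conjugate, and
truncated geometric series approximate `1 / (1 - r w)` and its conjugate. -/
theorem IsMovedGraph.approx {r : ℝ} {φ ψ : Param n → ℝ} (h : IsMovedGraph r φ ψ)
    (hψ : ContinuousAt ψ 0) (h0 : ψ 0 = 0) (hφ : φ =O[𝓝 0] fun x => gauge x ^ 4)
    {k : ℕ} {p p' : MvPolynomial (Vars n) ℂ} (hp' : Approx k (fun x => (φ x : ℂ)) p')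
    (hp : Approx k (fun x => (ψ x : ℂ)) p) {W W' : MvPolynomial (Vars n) ℂ}
    (hW : W = uVar + C Complex.I * (normSq n + p)) (hW' : W' = uVar - C Complex.I * (normSq n + p)) :
    Approx k (fun x => (ψ x : ℂ)) ((1 - C (r : ℂ) * W) * (1 - C (r : ℂ) * W') *
      aeval (scaling ((geomPoly r k).aeval W) ((geomPoly r k).aeval W')
        (C (1 / 2) * (W * (geomPoly r k).aeval W + W' * (geomPoly r k).aeval W'))) p') := by
  have hO := h.isBigO hψ h0 hφ
  set w : Param n → ℂ := fun x => (boundaryPoint ψ x).2 with hw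
  have hX : ∀ v : Vars n, Approx k (fun x => varValue x v) (X v) := fun v => by
    simpa [evalAt_eq] using Approx.evalAt_self (n := n) k (X v)
  have hu : Approx k (fun x : Param n => (x.2 : ℂ)) uVar := hX (Sum.inr (Sum.inr ()))
  have hs : Approx k (fun x : Param n => ((‖x.1‖ ^ 2 : ℝ) : ℂ)) (normSq n) := by
    simpa only [evalAt_normSq] using Approx.evalAt_self (n := n) k (normSq n)
  have hσ := (Approx.const (n := n) k Complex.I).mul (hs.add hp)
  have hwW : Approx k w W := by
    rw [hW]
    refine (hu.add hσ).congr (Eventually.of_forall fun x => ?_)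
    simp [hw, boundaryPoint]
  have hwW' : Approx k (fun x => (starRingEnd ℂ) (w x)) W' := by
    rw [hW']
    refine (hu.sub hσ).congr (Eventually.of_forall fun x => ?_)
    simp only [hw, boundaryPoint, map_add, map_mul, Complex.conj_ofReal, Complex.conj_I]
    push_cast
    ring
  have hwO : w =O[𝓝 0] fun x => gauge x ^ 2 := boundaryPoint_isBigO hO
  have hwO' : (fun x => (starRingEnd ℂ) (w x)) =O[𝓝 0] fun x => gauge x ^ 2 :=
    (IsBigO.of_bound 1 (Eventually.of_forall fun x => by simp)).trans hwO
  have hE := hwW.inv_one_sub hwO r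
  have hE' := hwW'.inv_one_sub hwO' r
  have hconj : ∀ x, (starRingEnd ℂ) (1 - (r : ℂ) * w x)⁻¹ =
      (1 - (r : ℂ) * (starRingEnd ℂ) (w x))⁻¹ := fun x => by simp
  have hval : ∀ v, Approx k (fun x => varValue (movedPoint r ψ x) v)
      (scaling ((geomPoly r k).aeval W) ((geomPoly r k).aeval W')
        (C (1 / 2) * (W * (geomPoly r k).aeval W + W' * (geomPoly r k).aeval W')) v) := by
    rintro (i | i | i)
    · refine ((hX (Sum.inl i)).mul hE).congr (Eventually.of_forall fun x => ?_)
      simp [varValue, movedPoint, hw, mul_comm]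
    · refine ((hX (Sum.inr (Sum.inl i))).mul hE').congr (Eventually.of_forall fun x => ?_)
      simp [varValue, movedPoint, hw, mul_comm]
    · refine ((Approx.const (n := n) k (1 / 2)).mul ((hwW.mul hE).add (hwW'.mul hE'))).congr
        (Eventually.of_forall fun x => ?_)
      simp only
      rw [← hconj, ← map_mul, Complex.add_conj]
      simp [varValue, movedPoint, hw, mul_comm]
  have hev := Approx.eval₂ hval p'
  have hφy : Approx k (fun x => (φ (movedPoint r ψ x) : ℂ)) (aeval (scaling
      ((geomPoly r k).aeval W) ((geomPoly r k).aeval W')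
        (C (1 / 2) * (W * (geomPoly r k).aeval W + W' * (geomPoly r k).aeval W'))) p') := by
    have h1 := (IsBigO.comp_tendsto hp' (tendsto_movedPoint r hψ h0)).trans
      ((IsMovedGraph.gauge_isBigO hψ h0 hO).pow (k + 1))
    refine (h1.add hev).congr_left fun x => ?_
    simp only [Function.comp, evalAt_eq]
    ring
  have hone : Approx k (fun _ : Param n => (1 : ℂ)) 1 := by
    simpa using Approx.const (n := n) k 1
  have hr := Approx.const (n := n) k (r : ℂ)
  refine (((hone.sub (hr.mul hwW)).mul (hone.sub (hr.mul hwW'))).mul hφy).congr ?_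
  filter_upwards [h] with x hx
  conv_rhs => rw [hx]
  push_cast
  rw [← Complex.mul_conj']
  simp [hw]

end BoundaryJets

/-! ### Persistence of the Chern–Moser conditions, and the projective map itself. -/

namespace BoundaryJets

open Asymptotics Filter MvPolynomial

variable {n : ℕ}

theorem component_mem_orderIdeal {ν ν' : Vars n → ℕ} {k μ : ℕ} {p : MvPolynomial (Vars n) ℂ}
    (hp : p ∈ orderIdeal ν k) : weightedHomogeneousComponent ν' μ p ∈ orderIdeal ν k := by
  classical
  intro m hm
  rw [coeff_weightedHomogeneousComponent] at hm
  exact hp m fun h => hm (by rw [h, ite_self])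

theorem bidegreePart_component (j k μ : ℕ) (p : MvPolynomial (Vars n) ℂ) :
    bidegreePart j k (weightedHomogeneousComponent weight μ p) =
      weightedHomogeneousComponent weight μ (bidegreePart j k p) := by
  classical
  ext m
  simp only [bidegreePart, coeff_weightedHomogeneousComponent]
  split_ifs <;> rfl

theorem bidegreePart_eq_zero_of_mem {j k l : ℕ} (h : j + k < l) {p : MvPolynomial (Vars n) ℂ}
    (hp : p ∈ orderIdeal totalDegree l) : bidegreePart j k p = 0 := by
  classical
  ext m
  rw [bidegreePart, coeff_weightedHomogeneousComponent, coeff_zero]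
  split_ifs with h1
  · by_contra h2
    have h3 := hp m h2
    rw [weight_bidegree, Prod.mk.injEq] at h1
    rw [weight_totalDegree, h1.1, h1.2] at h3
    omega
  · rfl

theorem iterate_laplacian_sum {ι : Type*} (r : ℕ) (s : Finset ι)
    (f : ι → MvPolynomial (Vars n) ℂ) :
    laplacian^[r] (∑ i ∈ s, f i) = ∑ i ∈ s, laplacian^[r] (f i) := by
  simp only [← Module.End.pow_apply, map_sum]

theorem mem_orderIdeal_holDegree_iff {k : ℕ} {p : MvPolynomial (Vars n) ℂ} :
    p ∈ orderIdeal holDegree k ↔ ∀ m ∈ p.support, k ≤ ∑ i : Fin n, m (Sum.inl i) := by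
  simp only [mem_orderIdeal, mem_support_iff, weight_holDegree]

theorem mem_orderIdeal_antiholDegree_iff {k : ℕ} {p : MvPolynomial (Vars n) ℂ} :
    p ∈ orderIdeal antiholDegree k ↔
      ∀ m ∈ p.support, k ≤ ∑ i : Fin n, m (Sum.inr (Sum.inl i)) := by
  simp only [mem_orderIdeal, mem_support_iff, weight_antiholDegree]

/-- The Taylor polynomials of a moved graph. -/
theorem IsMovedGraph.exists_approx {r : ℝ} {φ ψ : Param n → ℝ} (h : IsMovedGraph r φ ψ)
    (hψ : ContDiffAt ℝ ∞ ψ 0) (h0 : ψ 0 = 0) (hφ : φ =O[𝓝 0] fun x => gauge x ^ 4)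
    {k : ℕ} {p' : MvPolynomial (Vars n) ℂ} (hp' : Approx k (fun x => (φ x : ℂ)) p')
    (hhol : p' ∈ orderIdeal holDegree 2) (hanti : p' ∈ orderIdeal antiholDegree 2) :
    ∃ p R ε, Approx k (fun x => (ψ x : ℂ)) p ∧ p ∈ orderIdeal holDegree 2 ∧
      p ∈ orderIdeal antiholDegree 2 ∧ p - R ∈ orderIdeal weight (k + 1) ∧
      R - leadingOperator (r : ℂ) ε p' ∈ orderIdeal totalDegree 7 := by
  have hψc := hψ.continuousAt
  obtain ⟨p₀, hp₀⟩ := BoundaryJets.exists_approx hψ k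
  have h1 := hp₀.sub_mem_orderIdeal (h.approx hψc h0 hφ hp' hp₀ rfl rfl)
  set R₀ := (1 - C (r : ℂ) * (uVar + C Complex.I * (normSq n + p₀))) *
    (1 - C (r : ℂ) * (uVar - C Complex.I * (normSq n + p₀))) * aeval _ p'
  have hR₀ : R₀ ∈ orderIdeal holDegree 2 :=
    Ideal.mul_mem_left _ _ (aeval_mem_orderIdeal (scaling_mem_holDegree _ _ _) hhol)
  have hR₀' : R₀ ∈ orderIdeal antiholDegree 2 :=
    Ideal.mul_mem_left _ _ (aeval_mem_orderIdeal (scaling_mem_antiholDegree _ _ _) hanti)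
  -- Through weight `k` the Taylor polynomial of `ψ` agrees with `R₀`, which inherits degree at
  -- least two in `z` and in `z̄` from `p'`. The truncation `p` therefore has these degrees as well,
  -- and the graph equation is then expanded once more with `p` in place of `p₀`.
  have hcomp : ∀ μ ∈ Finset.range (k + 1), weightedHomogeneousComponent weight μ p₀ =
      weightedHomogeneousComponent weight μ R₀ := fun μ hμ => by
    rw [← sub_eq_zero, ← map_sub]
    exact component_eq_zero_of_mem_orderIdeal h1 (Finset.mem_range.1 hμ)
  set p := ∑ μ ∈ Finset.range (k + 1), weightedHomogeneousComponent weight μ p₀ with hp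
  have hpa : Approx k (fun x => (ψ x : ℂ)) p :=
    hp₀.congr_right (sub_sum_component_mem_orderIdeal _ _ _)
  have hph : p ∈ orderIdeal holDegree 2 := Ideal.sum_mem _ fun μ hμ => by
    rw [hcomp μ hμ]
    exact component_mem_orderIdeal hR₀
  have hpa' : p ∈ orderIdeal antiholDegree 2 := Ideal.sum_mem _ fun μ hμ => by
    rw [hcomp μ hμ]
    exact component_mem_orderIdeal hR₀'
  refine ⟨p, _, geomPoly r k, hpa, hph, hpa',
    hpa.sub_mem_orderIdeal (h.approx hψc h0 hφ hp' hpa rfl rfl), ?_⟩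
  refine scaling_sub_mem_orderIdeal (r : ℂ) (geomPoly r k) ?_ rfl rfl hhol hanti
  exact Ideal.add_mem _ normSq_mem_orderIdeal
    (orderIdeal_mono (by norm_num) (mem_orderIdeal_totalDegree hph hpa'))

/-- In total degree below seven, each weighted component of `ψ` is that of the leading operator
applied to the Taylor polynomial of `φ`. This operator respects bidegrees and vanishing of iterated
traces. Truncating at weight `μ` ensures that only components of `φ` of weight at most `μ ≤ N` are
used. -/
theorem IsMovedGraph.chernMoserConditions {r : ℝ} {φ ψ : Param n → ℝ} (h : IsMovedGraph r φ ψ)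
    (hψ : ContDiffAt ℝ ∞ ψ 0) (h0 : ψ 0 = 0) (hφs : ContDiffAt ℝ ∞ φ 0)
    (hφ : φ =O[𝓝 0] fun x => gauge x ^ 4) {N : ℕ∞} (hcm : ChernMoserConditions N φ) :
    ChernMoserConditions N ψ := by
  obtain ⟨P, hhom, heval, hsupp, htr⟩ := hcm
  set p' : ℕ → MvPolynomial (Vars n) ℂ := fun k => ∑ μ ∈ Finset.range (k + 1), P μ with hp'
  have hex := fun k => h.exists_approx (k := k) (p' := p' k) hψ h0 hφ
    (approx_of_weightedPart hφs fun μ _ x => heval μ x)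
    (Ideal.sum_mem _ fun μ _ => mem_orderIdeal_holDegree_iff.2 fun m hm => (hsupp μ m hm).1)
    (Ideal.sum_mem _ fun μ _ => mem_orderIdeal_antiholDegree_iff.2 fun m hm => (hsupp μ m hm).2)
  choose p R ε hpa hph hpa' hpR hRL using hex
  refine ⟨fun μ => weightedHomogeneousComponent weight μ (p μ),
    fun μ => weightedHomogeneousComponent_isWeightedHomogeneous _ _,
    fun μ x => weightedPart_eq_evalAt hψ (hpa μ) le_rfl x,
    fun μ m hm => ⟨mem_orderIdeal_holDegree_iff.1 (component_mem_orderIdeal (hph μ)) m hm,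
      mem_orderIdeal_antiholDegree_iff.1 (component_mem_orderIdeal (hpa' μ)) m hm⟩,
    fun μ hμ => ?_⟩
  have hbi : ∀ j k, j + k < 7 → bidegreePart j k (weightedHomogeneousComponent weight μ (p μ)) =
      weightedHomogeneousComponent weight μ (leadingOperator (r : ℂ) (ε μ)
        (bidegreePart j k (p' μ))) := by
    intro j k hjk
    have h1 : weightedHomogeneousComponent weight μ (p μ) =
        weightedHomogeneousComponent weight μ (R μ) := by
      rw [← sub_eq_zero, ← map_sub]
      exact component_eq_zero_of_mem_orderIdeal (hpR μ) (Nat.lt_succ_self μ)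
    rw [h1, bidegreePart_component, ← bidegreePart_leadingOperator, ← sub_eq_zero, ← map_sub]
    have h2 := bidegreePart_eq_zero_of_mem hjk (hRL μ)
    rw [bidegreePart, map_sub] at h2
    rw [bidegreePart, bidegreePart, h2, map_zero]
  have hkey : ∀ s j k, j + k < 7 → (∀ μ' : ℕ, (μ' : ℕ∞) ≤ N →
      laplacian^[s] (bidegreePart j k (P μ')) = 0) →
      laplacian^[s] (bidegreePart j k (weightedHomogeneousComponent weight μ (p μ))) = 0 := by
    intro s j k hjk hP
    rw [hbi j k hjk]
    refine iterate_laplacian_component ?_ μ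
    have h1 : bidegreePart j k (p' μ) = ∑ μ' ∈ Finset.range (μ + 1), bidegreePart j k (P μ') := by
      simp only [hp', bidegreePart, map_sum]
    rw [iterate_laplacian_leadingOperator, h1, iterate_laplacian_sum, Finset.sum_eq_zero]
    · simp [leadingOperator]
    · intro μ' hμ'
      refine hP μ' (le_trans ?_ hμ)
      exact_mod_cast Nat.lt_succ_iff.1 (Finset.mem_range.1 hμ')
  rw [trace_eq_zero_iff (by norm_num) (by norm_num), trace_trace_eq_zero_iff (by norm_num) (by norm_num)
    (by norm_num) (by norm_num), trace_trace_eq_zero_iff (by norm_num) (by norm_num)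
    (by norm_num) (by norm_num), trace_trace_trace_eq_zero_iff (by norm_num) (by norm_num)
    (by norm_num) (by norm_num) (by norm_num) (by norm_num)]
  refine ⟨hkey 1 2 2 (by norm_num) fun μ' hμ' => ?_, hkey 2 3 2 (by norm_num) fun μ' hμ' => ?_,
    hkey 2 2 3 (by norm_num) fun μ' hμ' => ?_, hkey 3 3 3 (by norm_num) fun μ' hμ' => ?_⟩
  · exact (trace_eq_zero_iff (by norm_num) (by norm_num)).1 (htr μ' hμ').1
  · exact (trace_trace_eq_zero_iff (by norm_num) (by norm_num) (by norm_num) (by norm_num)).1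
      (htr μ' hμ').2.1
  · exact (trace_trace_eq_zero_iff (by norm_num) (by norm_num) (by norm_num) (by norm_num)).1
      (htr μ' hμ').2.2.1
  · exact (trace_trace_trace_eq_zero_iff (by norm_num) (by norm_num) (by norm_num) (by norm_num)
      (by norm_num) (by norm_num)).1 (htr μ' hμ').2.2.2

/-- The biholomorphic map `(z, w) ↦ (z, w) / (1 + r w)`. -/
noncomputable def projectiveMap (n : ℕ) (r : ℝ) : OpenPartialHomeomorph (Space n) (Space n) where
  toFun Z := (1 + (r : ℂ) * Z.2)⁻¹ • Z
  invFun Z := (1 - (r : ℂ) * Z.2)⁻¹ • Z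
  source := {Z | 1 + (r : ℂ) * Z.2 ≠ 0}
  target := {Z | 1 - (r : ℂ) * Z.2 ≠ 0}
  map_source' Z hZ := by
    have h1 : 1 - (r : ℂ) * ((1 + (r : ℂ) * Z.2)⁻¹ * Z.2) = (1 + (r : ℂ) * Z.2)⁻¹ := by
      have h2 : (1 + (r : ℂ) * Z.2) ≠ 0 := hZ
      field_simp
      ring
    simpa [h1] using hZ
  map_target' Z hZ := by
    have h1 : 1 + (r : ℂ) * ((1 - (r : ℂ) * Z.2)⁻¹ * Z.2) = (1 - (r : ℂ) * Z.2)⁻¹ := by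
      have h2 : (1 - (r : ℂ) * Z.2) ≠ 0 := hZ
      field_simp
      ring
    simpa [h1] using hZ
  left_inv' Z hZ := by
    have h2 : (1 + (r : ℂ) * Z.2) ≠ 0 := hZ
    have h1 : 1 - (r : ℂ) * ((1 + (r : ℂ) * Z.2)⁻¹ * Z.2) = (1 + (r : ℂ) * Z.2)⁻¹ := by
      field_simp
      ring
    simp [h1, smul_smul, h2]
  right_inv' Z hZ := by
    have h2 : (1 - (r : ℂ) * Z.2) ≠ 0 := hZ
    have h1 : 1 + (r : ℂ) * ((1 - (r : ℂ) * Z.2)⁻¹ * Z.2) = (1 - (r : ℂ) * Z.2)⁻¹ := by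
      field_simp
      ring
    simp [h1, smul_smul, h2]
  open_source := isOpen_ne_fun (by fun_prop) (by fun_prop)
  open_target := isOpen_ne_fun (by fun_prop) (by fun_prop)
  continuousOn_toFun := by
    refine ContinuousOn.smul (ContinuousOn.inv₀ (by fun_prop) fun Z hZ => hZ) continuousOn_id
  continuousOn_invFun := by
    refine ContinuousOn.smul (ContinuousOn.inv₀ (by fun_prop) fun Z hZ => hZ) continuousOn_id

theorem isLocalCoordinates_projectiveMap (n : ℕ) (r : ℝ) :
    IsLocalCoordinates (projectiveMap n r) 0 := by
  refine ⟨?_, ?_, ?_, ?_⟩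
  · simp [projectiveMap]
  · simp [projectiveMap]
  · refine DifferentiableOn.smul (DifferentiableOn.inv (by fun_prop) fun Z hZ => hZ)
      differentiableOn_id
  · refine DifferentiableOn.smul (DifferentiableOn.inv (by fun_prop) fun Z hZ => hZ)
      differentiableOn_id

end BoundaryJets

/-! ### Images of normal forms under projective maps, and construction of the flat coordinates. -/

namespace BoundaryJets

open Asymptotics Filter MvPolynomial

variable {n : ℕ}

/-- The point `w = u + i (‖z‖² + s)`. -/
noncomputable def lift (p : Param n × ℝ) : ℂ :=
  (p.1.2 : ℂ) + Complex.I * ((‖p.1.1‖ ^ 2 + p.2 : ℝ) : ℂ)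

theorem contDiff_lift : ContDiff ℝ ∞ (lift (n := n)) := by
  have h1 : ContDiff ℝ ∞ fun p : Param n × ℝ => (p.1.2 : ℂ) :=
    Complex.ofRealCLM.contDiff.comp (contDiff_snd.comp contDiff_fst)
  have h2 : ContDiff ℝ ∞ fun p : Param n × ℝ => ((‖p.1.1‖ ^ 2 + p.2 : ℝ) : ℂ) :=
    Complex.ofRealCLM.contDiff.comp (((contDiff_fst.comp contDiff_fst).norm_sq ℝ).add contDiff_snd)
  exact h1.add (contDiff_const.mul h2)

/-- The coordinates `(z / (1 - r w), Re (w / (1 - r w)))` of the image of `(z, w)`. -/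
noncomputable def movedCoords (r : ℝ) (p : Param n × ℝ) : Param n :=
  ((1 - r * lift p)⁻¹ • p.1.1, ((1 - r * lift p)⁻¹ * lift p).re)

theorem contDiffAt_movedCoords {r : ℝ} {p : Param n × ℝ} (hp : 1 - (r : ℂ) * lift p ≠ 0) :
    ContDiffAt ℝ ∞ (movedCoords r) p := by
  have h1 : ContDiffAt ℝ ∞ (fun p : Param n × ℝ => (1 - (r : ℂ) * lift p)⁻¹) p :=
    (contDiff_const.sub (contDiff_const.mul contDiff_lift)).contDiffAt.inv hp
  have h2 : ContDiffAt ℝ ∞ (fun p : Param n × ℝ => p.1.1) p :=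
    (contDiff_fst.comp contDiff_fst).contDiffAt
  exact (h1.smul h2).prodMk
    (Complex.reCLM.contDiff.contDiffAt.comp p (h1.mul contDiff_lift.contDiffAt))

theorem lift_zero : lift (0 : Param n × ℝ) = 0 := by simp [lift]

theorem movedCoords_zero (r : ℝ) : movedCoords r (0 : Param n × ℝ) = 0 := by
  simp [movedCoords, lift_zero]

/-- The defining equation of a moved graph. -/
noncomputable def graphEquation (r : ℝ) (φ : Param n → ℝ) (p : Param n × ℝ) : ℝ :=
  p.2 - ‖1 - (r : ℂ) * lift p‖ ^ 2 * φ (movedCoords r p)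

/-- Being `O(gauge⁴)`, the function `φ` is quadratically small in the norm and has zero differential
at `0`. The derivative of the graph equation there is thus the last coordinate, and the implicit
function theorem applies. -/
theorem exists_movedGraph (r : ℝ) {φ : Param n → ℝ} {V : Set (Param n)} (hV : IsOpen V)
    (h0V : (0 : Param n) ∈ V) (hφ : ContDiffOn ℝ ∞ φ V) (hO : φ =O[𝓝 0] fun x => gauge x ^ 4) :
    ∃ ψ : Param n → ℝ, (∃ V : Set (Param n), IsOpen V ∧ (0 : Param n) ∈ V ∧ ContDiffOn ℝ ∞ ψ V) ∧
      ψ 0 = 0 ∧ IsMovedGraph r φ ψ ∧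
      ∀ᶠ p in 𝓝 (0 : Param n × ℝ), 0 < graphEquation r φ p ↔ ψ p.1 < p.2 := by
  have hφ0 : φ 0 = 0 := by
    have := hO.eq_zero_imp.self_of_nhds
    simpa [gauge] using this
  set S : Set (Param n × ℝ) := {p | 1 - (r : ℂ) * lift p ≠ 0} with hS
  have hSo : IsOpen S := isOpen_ne_fun
    (continuous_const.sub (continuous_const.mul contDiff_lift.continuous)) continuous_const
  have hYS : ContDiffOn ℝ ∞ (movedCoords r) S :=
    fun p hp => (contDiffAt_movedCoords hp).contDiffWithinAt
  have hW : IsOpen (S ∩ movedCoords r ⁻¹' V) := hYS.continuousOn.isOpen_inter_preimage hSo hV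
  have h0S : (0 : Param n × ℝ) ∈ S := by simp [hS, lift_zero]
  have h0W : (0 : Param n × ℝ) ∈ S ∩ movedCoords r ⁻¹' V :=
    ⟨h0S, by rw [Set.mem_preimage, movedCoords_zero]; exact h0V⟩
  have hA : ContDiff ℝ ∞ fun p : Param n × ℝ => ‖1 - (r : ℂ) * lift p‖ ^ 2 :=
    (contDiff_const.sub (contDiff_const.mul contDiff_lift)).norm_sq ℝ
  have hH : ContDiffOn ℝ ∞ (graphEquation r φ) (S ∩ movedCoords r ⁻¹' V) := by
    intro p hp
    refine ContDiffAt.contDiffWithinAt ?_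
    have h1 : ContDiffAt ℝ ∞ (fun p => φ (movedCoords r p)) p :=
      ContDiffAt.comp p (hφ.contDiffAt (hV.mem_nhds hp.2)) (contDiffAt_movedCoords hp.1)
    exact contDiffAt_snd.sub (hA.contDiffAt.mul h1)
  have hd : HasFDerivAt (graphEquation r φ) (ContinuousLinearMap.snd ℝ (Param n) ℝ) 0 := by
    have h1 : HasFDerivAt φ (0 : Param n →L[ℝ] ℝ) (movedCoords r (0 : Param n × ℝ)) := by
      rw [movedCoords_zero]
      refine IsBigO.hasFDerivAt (n := 2) ?_ (by norm_num)
      simpa using hO.trans gauge_pow_four_isBigO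
    have h2 := ((contDiffAt_movedCoords h0S).differentiableAt (by simp)).hasFDerivAt
    have h3 := h1.comp (0 : Param n × ℝ) h2
    have h4 := (hA.contDiffAt.differentiableAt (by simp)).hasFDerivAt.mul h3 (x := 0)
    have h5 := (hasFDerivAt_snd (𝕜 := ℝ) (p := (0 : Param n × ℝ))).sub h4
    refine h5.congr_fderiv ?_
    simp [movedCoords_zero, hφ0]
  obtain ⟨ψ, hψs, hψ0, hg, hiff⟩ := exists_implicit_of_fderiv_eq_one hW h0W hH
    (by simp [graphEquation, movedCoords_zero, hφ0]) hd.fderiv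
  refine ⟨ψ, hψs, hψ0, ?_, hiff⟩
  filter_upwards [hg] with x hx
  exact sub_eq_zero.1 hx

/-- For real `r`, multiplying by `|1 - r w|²` turns `Im (w / (1 - r w))` back into `Im w` and the
squared norm of `z / (1 - r w)` into `‖z‖²`: the map preserves the model quadric, and only the `φ`
term is changed. -/
theorem normSq_mul_definingFunction (r : ℝ) (φ : Param n → ℝ) {Z : Space n}
    (hZ : 1 - (r : ℂ) * Z.2 ≠ 0) :
    ‖1 - (r : ℂ) * Z.2‖ ^ 2 * definingFunction φ ((1 - (r : ℂ) * Z.2)⁻¹ • Z) =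
      graphEquation r φ ((Z.1, Z.2.re), Z.2.im - ‖Z.1‖ ^ 2) := by
  have h1 : lift ((Z.1, Z.2.re), Z.2.im - ‖Z.1‖ ^ 2) = Z.2 := by
    simp only [lift]
    rw [add_sub_cancel, mul_comm, Complex.re_add_im]
  have h2 : ‖1 - (r : ℂ) * Z.2‖ ^ 2 ≠ 0 := pow_ne_zero 2 (norm_ne_zero_iff.2 hZ)
  have h3 : ‖1 - (r : ℂ) * Z.2‖ ^ 2 * ((1 - (r : ℂ) * Z.2)⁻¹ * Z.2).im = Z.2.im := by
    have h4 : ((‖1 - (r : ℂ) * Z.2‖ ^ 2 : ℝ) : ℂ) * ((1 - (r : ℂ) * Z.2)⁻¹ * Z.2) =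
        (starRingEnd ℂ) (1 - (r : ℂ) * Z.2) * Z.2 := by
      rw [Complex.ofReal_pow, ← Complex.conj_mul', mul_assoc, mul_inv_cancel_left₀ hZ]
    rw [← Complex.im_ofReal_mul, h4]
    simp
    ring
  rw [graphEquation, movedCoords, h1, definingFunction]
  simp only [Prod.smul_fst, Prod.smul_snd, smul_eq_mul]
  rw [norm_smul, norm_inv, mul_sub, mul_sub, h3, mul_pow, inv_pow, mul_inv_cancel_left₀ h2]

theorem HasNormalForm.projectiveMap {N : ℕ∞} {D : Set (Space n)} {φ : Param n → ℝ}
    (hD : HasNormalForm N D φ) (hO : φ =O[𝓝 0] fun x => gauge x ^ 4) (r : ℝ) :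
    InNormalForm N (projectiveMap n r '' ((projectiveMap n r).source ∩ D)) := by
  have hg := isLocalCoordinates_projectiveMap n r
  obtain ⟨V, hV, h0V, hφ⟩ := hD.1
  obtain ⟨ψ, hψs, hψ0, hmoved, hiff⟩ := exists_movedGraph r hV h0V hφ hO
  have hψat : ContDiffAt ℝ ∞ ψ 0 := by
    obtain ⟨V', hV', h0V', hψ⟩ := hψs
    exact hψ.contDiffAt (hV'.mem_nhds h0V')
  refine ⟨ψ, hψs, ?_, hmoved.chernMoserConditions hψat hψ0 hD.contDiffAt hO hD.2.2⟩
  have hp : Tendsto (fun Z : Space n => ((Z.1, Z.2.re), Z.2.im - ‖Z.1‖ ^ 2)) (𝓝 0)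
      (𝓝 (0 : Param n × ℝ)) := by
    have : Continuous fun Z : Space n => ((Z.1, Z.2.re), Z.2.im - ‖Z.1‖ ^ 2) := by fun_prop
    have h1 := this.tendsto 0
    have h2 : (((0 : Space n).1, (0 : Space n).2.re), (0 : Space n).2.im - ‖(0 : Space n).1‖ ^ 2) =
        (0 : Param n × ℝ) := by simp
    rwa [h2] at h1
  have hsymm : Tendsto (BoundaryJets.projectiveMap n r).symm (𝓝 0) (𝓝 0) := by
    have := ((BoundaryJets.projectiveMap n r).symm.continuousAt hg.zero_mem_target).tendsto
    rwa [hg.symm_zero] at this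
  filter_upwards [hp.eventually hiff, hsymm.eventually (eventually_mem_iff_definingFunction hD),
    (BoundaryJets.projectiveMap n r).open_target.mem_nhds hg.zero_mem_target] with Z h1 h2 h3
  have h4 := normSq_mul_definingFunction r φ (Z := Z) h3
  have h5 : 0 < ‖1 - (r : ℂ) * Z.2‖ ^ 2 := pow_pos (norm_pos_iff.2 h3) 2
  have h6 : Z ∈ BoundaryJets.projectiveMap n r '' ((BoundaryJets.projectiveMap n r).source ∩ D) ↔
      (BoundaryJets.projectiveMap n r).symm Z ∈ D := by
    conv_lhs => rw [← (BoundaryJets.projectiveMap n r).right_inv h3]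
    exact mem_image_source_inter_iff ((BoundaryJets.projectiveMap n r).map_target h3)
  rw [h6, h2, ← lt_sub_iff_add_lt', ← h1, ← h4]
  exact (mul_pos_iff_of_pos_left h5).symm

/-- The denominator involves the `w`-component of `F Z` instead of `w`. The two differ by `O(2)`,
which after multiplication by `Z` is an error of order three. -/
theorem isBigO_projectiveMap_comp_sub {r : ℝ} {F : Space n → Space n} (hF : ContDiffAt ℝ ∞ F 0)
    (hF0 : F 0 = 0) (hsec : IsBigO 3 fun Z : Space n => F Z - (1 + (r : ℂ) * Z.2) • Z) :
    IsBigO 3 fun Z : Space n => projectiveMap n r (F Z) - Z := by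
  have hquad : ContDiff ℝ ∞ fun Z : Space n => (1 + (r : ℂ) * Z.2) • Z :=
    (contDiff_const.add (contDiff_const.mul contDiff_snd)).smul contDiff_id
  have hR := isBigO_of_iteratedFDeriv_eq_zero 2 (hF.sub hquad.contDiffAt) hsec
  have hFc : Tendsto F (𝓝 0) (𝓝 0) := by
    have := hF.continuousAt.tendsto
    rwa [hF0] at this
  have hg := isLocalCoordinates_projectiveMap n r
  refine iteratedFDeriv_eq_zero_of_isBigO ?_ ?_
  · refine ContDiffAt.sub (ContDiffAt.comp (0 : Space n) ?_ hF) contDiffAt_id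
    rw [hF0]
    exact contDiffAt_of_differentiableOn (projectiveMap n r).open_source hg.1 hg.2.2.1
  · have hFs : Tendsto (fun Z => (F Z).2) (𝓝 0) (𝓝 0) :=
      (continuous_snd.tendsto (0 : Space n)).comp hFc
    have h1 : Tendsto (fun Z => 1 + (r : ℂ) * (F Z).2) (𝓝 0) (𝓝 1) := by
      simpa using (hFs.const_mul (r : ℂ)).const_add 1
    have hinv : (fun Z => (1 + (r : ℂ) * (F Z).2)⁻¹) =O[𝓝 0] fun _ => (1 : ℝ) :=
      (h1.inv₀ one_ne_zero).isBigO_one ℝ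
    have hn : ∀ {j k : ℕ}, k ≤ j → (fun Z : Space n => ‖Z‖ ^ j) =O[𝓝 0] fun Z => ‖Z‖ ^ k := by
      intro j k hjk
      refine IsBigO.of_bound 1 ?_
      have h2 : Tendsto (fun Z : Space n => ‖Z‖) (𝓝 0) (𝓝 0) := by
        simpa using (continuous_norm (E := Space n)).tendsto 0
      filter_upwards [h2.eventually_lt_const one_pos] with Z hZ
      rw [one_mul, Real.norm_of_nonneg (by positivity), Real.norm_of_nonneg (by positivity)]
      exact pow_le_pow_of_le_one (norm_nonneg _) hZ.le hjk
    have hsnd : (fun Z : Space n => Z.2) =O[𝓝 0] fun Z => ‖Z‖ :=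
      IsBigO.of_bound 1 (Eventually.of_forall fun Z => by
        rw [one_mul, norm_norm]; exact norm_snd_le Z)
    have hdiff : (fun Z : Space n => (F Z).2 - Z.2) =O[𝓝 0] fun Z => ‖Z‖ ^ 2 := by
      have h2 : (fun Z : Space n => (F Z - (1 + (r : ℂ) * Z.2) • Z).2) =O[𝓝 0] fun Z => ‖Z‖ ^ 2 :=
        ((isBigO_snd_prod' (f' := fun Z => F Z - (1 + (r : ℂ) * Z.2) • Z)).trans hR).trans
          (hn (by norm_num))
      refine (h2.add ((hsnd.pow 2).const_mul_left (r : ℂ))).congr_left fun Z => ?_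
      simp only [Prod.snd_sub, Prod.smul_snd, smul_eq_mul]
      ring
    have hid : (fun Z : Space n => Z) =O[𝓝 0] fun Z => ‖Z‖ := (isBigO_refl _ _).norm_right
    have h3 : (fun Z : Space n => ((r : ℂ) * ((F Z).2 - Z.2)) • Z) =O[𝓝 0] fun Z => ‖Z‖ ^ 3 :=
      ((hdiff.const_mul_left (r : ℂ)).smul hid).congr_right fun Z => by
        rw [smul_eq_mul]; ring
    refine ((hinv.smul (hR.sub h3)).congr' ?_ (Eventually.of_forall fun Z => ?_))
    · filter_upwards [h1.eventually_ne one_ne_zero] with Z hZ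
      have h4 : F Z - (1 + (r : ℂ) * Z.2) • Z - ((r : ℂ) * ((F Z).2 - Z.2)) • Z =
          F Z - (1 + (r : ℂ) * (F Z).2) • Z := by
        module
      rw [h4, smul_sub, smul_smul, inv_mul_cancel₀ hZ, one_smul]
      rfl
    · simp

/-- Condition 3 forces `a = 0`, `c` real and `B = c · id`, so `F = (1 + c w) (z, w) + O(3)`. The
source coordinates can stay unchanged, and the projective map with `r = Re c` is used in the target.
-/
theorem isFlat_of_im_inner_eq_zero (hn : 1 ≤ n) {N : ℕ∞} (hN : 5 ≤ N)
    {D D' : Set (Space n)} {φ φ' : Param n → ℝ}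
    (hD : HasNormalForm N D φ) (hD' : HasNormalForm N D' φ')
    {F : Space n → Space n} (hF : IsBoundaryGerm D D' 0 0 F)
    {B : EuclideanSpace ℂ (Fin n) →L[ℂ] EuclideanSpace ℂ (Fin n)}
    {a : EuclideanSpace ℂ (Fin n)} {c : ℂ}
    (hsec : IsBigO 3 (fun Z : Space n =>
      F Z - (Z + (Z.2 • B Z.1 + Z.2 ^ 2 • a, c * Z.2 ^ 2))))
    (him : ∀ z, (inner ℂ z (B z) : ℂ).im = 0) : IsFlat N 2 D D' 0 0 F := by
  have h := hF.isNormalizedGerm hN hD hD' hsec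
  obtain ⟨_, _, J'⟩ := hD'.exists_jet hN
  have ha := h.translation_eq_zero hn him
  have hc : c = (c.re : ℂ) := Complex.ext rfl (by
    simpa using (h.vanishes_of_im_inner_eq_zero hn him).2.1)
  have hB := h.linear_part_eq hn him
  refine ⟨OpenPartialHomeomorph.refl _, projectiveMap n c.re,
    ⟨Set.mem_univ _, rfl, differentiableOn_id, differentiableOn_id⟩,
    isLocalCoordinates_projectiveMap n c.re, ⟨φ, ?_⟩, hD'.projectiveMap J'.isBigO c.re, ?_⟩
  · simpa using hD
  · have e : (fun Z => F Z - (1 + (c.re : ℂ) * Z.2) • Z) = fun Z =>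
        F Z - (Z + (Z.2 • B Z.1 + Z.2 ^ 2 • a, c * Z.2 ^ 2)) := by
      funext Z
      congr 1
      rw [← hc, ha, hB, smul_zero, add_zero]
      refine Prod.ext ?_ ?_
      · simp only [Prod.smul_fst, Prod.fst_add]
        module
      · simp only [Prod.smul_snd, Prod.snd_add, smul_eq_mul]
        ring
    change IsBigO 3 fun Z => projectiveMap n c.re (F Z) - Z
    refine isBigO_projectiveMap_comp_sub (contDiffAt_germ hF) hF.1 ?_
    rw [e]
    exact hsec

end BoundaryJets

theorem proposition3p5 {n : ℕ} (hn : 1 ≤ n) (N : ℕ∞) (hN : 5 ≤ N)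
    (D D' : Set (BoundaryJets.Space n)) (φ φ' : BoundaryJets.Param n → ℝ)
    (hD : BoundaryJets.HasNormalForm N D φ) (hD' : BoundaryJets.HasNormalForm N D' φ')
    (F : BoundaryJets.Space n → BoundaryJets.Space n)
    (hF : BoundaryJets.IsBoundaryGerm D D' 0 0 F)
    -- the second order terms: `F^z_{1,1}(z, w) = w B z`, `F^z_{0,2}(w) = w² a`, `F^w_{0,2}(w) = c w²`
    (B : EuclideanSpace ℂ (Fin n) →L[ℂ] EuclideanSpace ℂ (Fin n))
    (a : EuclideanSpace ℂ (Fin n)) (c : ℂ)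
    (hsec : BoundaryJets.IsBigO 3 (fun Z : BoundaryJets.Space n =>
      F Z - (Z + (Z.2 • B Z.1 + Z.2 ^ 2 • a, c * Z.2 ^ 2)))) :
    List.TFAE
      [BoundaryJets.IsFlat N 2 D D' 0 0 F,
       BoundaryJets.ImageTangentToOrder 4 φ φ' F,
       ∀ z : EuclideanSpace ℂ (Fin n),
         (∑ i : Fin n, z i * (starRingEnd ℂ) (B z i)).im = 0] := by
  -- The inner product used in the proof is conjugate linear in the first slot, so the sum in
  -- condition 3 is its complex conjugate and only the sign of the imaginary part changes.
  have key : ∀ z : EuclideanSpace ℂ (Fin n), (∑ i : Fin n, z i * (starRingEnd ℂ) (B z i)).im =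
      -(inner ℂ z (B z) : ℂ).im := by
    intro z
    have h1 : ∑ i : Fin n, z i * (starRingEnd ℂ) (B z i) = inner ℂ (B z) z := by
      simp [PiLp.inner_apply]
    rw [h1, ← inner_conj_symm, Complex.conj_im]
  tfae_have 1 → 2 := BoundaryJets.imageTangent_of_isFlat hn hN hD hD' hF
  tfae_have 2 → 3 := fun h z => by
    rw [key, (hF.isNormalizedGerm hN hD hD' hsec).im_inner_eq_zero
      (fun x => h 4 le_rfl x) z, neg_zero]
  tfae_have 3 → 1 := fun h => BoundaryJets.isFlat_of_im_inner_eq_zero hn hN hD hD' hF hsec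
    fun z => by have := h z; rw [key] at this; linarith
  tfae_finish
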